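/- Conventions. Let $n\ge 1$. A weight is a non-negative, locally integrable function $w$ on $\mathbb R^n$ that is not almost everywhere zero; $w(E)=\int_E w\,dx$. For $1<q<\infty$, $w\in A_q$ means $$[w]_{A_q}=\sup_Q\Big(\frac1{|Q|}\int_Q w\,dx\Big)\Big(\frac1{|Q|}\int_Q w^{1/(1-q)}\,dx\Big)^{q-1}<\infty,$$ the supremum being over all cubes $Q\subset\mathbb R^n$ with sides parallel to the axes, and $r_w=\inf\{q>1: w\in A_q\}$. For $\Omega\subseteq\mathbb R^n$ open, $L^p(\Omega,w)$ is the $L^p$ space of the measure $w\,dx$ on $\Omega$, and $W^{1,p}(\Omega,w)$ is the set of $f\in L^p(\Omega,w)$ that have weak partial derivatives $D_1f,\dots,D_nf$ on $\Omega$ belonging to $L^p(\Omega,w)$. For measurable $f:\Omega\to\mathbb R$ let $$V_p(f;\Omega,w)=\sup_{\mathcal D}\Big[\sum_{B_k\in\mathcal D}\Big(\frac{\operatorname{osc}_{B_k}(f)}{r_k}\Big)^p w(B_k)\Big]^{1/p},\qquad \operatorname{osc}_B(f)=\sup_{x,y\in B}|f(x)-f(y)|,$$ where the supremum is over all countable collections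 $\mathcal D=\{B_k\}$ of disjoint balls contained in $\Omega$, $B_k$ having radius $r_k$; $f\in RBV^p(\Omega,w)$ means $V_p(f;\Omega,w)<\infty$. Theorem. Let $\Omega\subseteq\mathbb R^n$ be open, let $p>n$, and let $w\in A_p$ satisfy $p>n\,r_w$. Then $w\in A_{p/n}$, and $f\in W^{1,p}(\Omega,w)$ if and only if $f$ coincides almost everywhere on $\Omega$ with a function $\tilde f$ that is continuous on $\Omega$ and belongs to $RBV^p(\Omega,w)\cap L^p(\Omega,w)$. Furthermore, for every $f\in W^{1,p}(\Omega,w)$ with continuous representative $\tilde f$, $$\|\nabla f\|_{L^p(\Omega,w)}\le C_1\,V_p(\tilde f;\Omega,w)\qquad\text{and}\qquad V_p(\tilde f;\Omega,w)\le C_2\,\|\nabla f\|_{L^p(\Omega,w)},$$ where $C_1$ depends only on $p$, $n$ and an upper bound for $[w]_{A_p}$, and $C_2$ depends only on $p$, $n$ and an upper bound for $[w]_{A_{p/n}}$. -/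

import Mathlib

open MeasureTheory Set
open scoped ENNReal NNReal ContDiff

namespace RieszBV

noncomputable section

/-- The closed cube in `ℝⁿ` with sides parallel to the axes, center `c` and side length `2 * r`. -/
def cube {n : ℕ} (c : EuclideanSpace ℝ (Fin n)) (r : ℝ) : Set (EuclideanSpace ℝ (Fin n)) :=
  {x | ∀ i, |x i - c i| ≤ r}

/-- A weight: a non-negative, locally integrable function on `ℝⁿ`. -/
structure IsWeight {n : ℕ} (w : EuclideanSpace ℝ (Fin n) → ℝ) : Prop where
  nonneg : ∀ x, 0 ≤ w x
  locallyIntegrable : LocallyIntegrable w volume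

/-- The Muckenhoupt characteristic `[w]_{A_q}`, for `1 < q < ∞`: the supremum over all cubes `Q` of
`(⨍_Q w) * (⨍_Q w ^ (1 / (1 - q))) ^ (q - 1)`. All quantities live in `[0, ∞]`, so that
`w ^ (1 / (1 - q)) = ∞` where `w = 0`. -/
def apConst {n : ℕ} (q : ℝ) (w : EuclideanSpace ℝ (Fin n) → ℝ) : ℝ≥0∞ :=
  ⨆ (c : EuclideanSpace ℝ (Fin n)) (r : ℝ) (_ : 0 < r),
    (⨍⁻ x in cube c r, ENNReal.ofReal (w x) ∂volume) *
      (⨍⁻ x in cube c r, ENNReal.ofReal (w x) ^ (1 / (1 - q)) ∂volume) ^ (q - 1)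

/-- `w ∈ A_q`, for `1 < q < ∞`. The weight that vanishes almost everywhere is excluded: it would
qualify only through the convention `0 * ∞ = 0`. -/
structure MemAp {n : ℕ} (q : ℝ) (w : EuclideanSpace ℝ (Fin n) → ℝ) : Prop where
  isWeight : IsWeight w
  ne_zero : ¬ (w =ᵐ[volume] 0)
  apConst_lt_top : apConst q w < ⊤

/-- The critical index `r_w = inf {q > 1 : w ∈ A_q}`. -/
def critIndex {n : ℕ} (w : EuclideanSpace ℝ (Fin n) → ℝ) : ℝ :=
  sInf {q : ℝ | 1 < q ∧ MemAp q w}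

/-- The measure `w dx` on `Ω`; `L^p(Ω, w)` is `L^p` of this measure. -/
def weightedMeasure {n : ℕ} (Ω : Set (EuclideanSpace ℝ (Fin n)))
    (w : EuclideanSpace ℝ (Fin n) → ℝ) : Measure (EuclideanSpace ℝ (Fin n)) :=
  (volume.restrict Ω).withDensity fun x => ENNReal.ofReal (w x)

/-- `f ∈ L^p(Ω, w)`, for a function `f` with values in `ℝ` or `ℝⁿ`. -/
def MemLpWeighted {n : ℕ} {F : Type*} [NormedAddCommGroup F] (p : ℝ)
    (Ω : Set (EuclideanSpace ℝ (Fin n))) (w : EuclideanSpace ℝ (Fin n) → ℝ)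
    (f : EuclideanSpace ℝ (Fin n) → F) : Prop :=
  MemLp f (ENNReal.ofReal p) (weightedMeasure Ω w)

/-- The norm of `L^p(Ω, w)`, with values in `[0, ∞]`. -/
def lpNormWeighted {n : ℕ} {F : Type*} [NormedAddCommGroup F] (p : ℝ)
    (Ω : Set (EuclideanSpace ℝ (Fin n))) (w : EuclideanSpace ℝ (Fin n) → ℝ)
    (f : EuclideanSpace ℝ (Fin n) → F) : ℝ≥0∞ :=
  eLpNorm f (ENNReal.ofReal p) (weightedMeasure Ω w)

/-- `g = (D_1 f, …, D_n f)` is the weak (distributional) gradient of `f` on the open set `Ω`. -/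
structure HasWeakGradient {n : ℕ} (Ω : Set (EuclideanSpace ℝ (Fin n)))
    (f : EuclideanSpace ℝ (Fin n) → ℝ)
    (g : EuclideanSpace ℝ (Fin n) → EuclideanSpace ℝ (Fin n)) : Prop where
  locallyIntegrableOn : LocallyIntegrableOn f Ω volume
  locallyIntegrableOn_grad : LocallyIntegrableOn g Ω volume
  integral_eq : ∀ φ : EuclideanSpace ℝ (Fin n) → ℝ, ContDiff ℝ ∞ φ → HasCompactSupport φ →
    tsupport φ ⊆ Ω → ∀ j : Fin n,
      ∫ x in Ω, f x * fderiv ℝ φ x (EuclideanSpace.single j 1) = - ∫ x in Ω, g x j * φ x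

/-- `f ∈ W^{1,p}(Ω, w)`: `f ∈ L^p(Ω, w)`, and `f` has weak derivatives on `Ω` that belong to
`L^p(Ω, w)`. -/
def MemW1p {n : ℕ} (p : ℝ) (Ω : Set (EuclideanSpace ℝ (Fin n)))
    (w : EuclideanSpace ℝ (Fin n) → ℝ) (f : EuclideanSpace ℝ (Fin n) → ℝ) : Prop :=
  MemLpWeighted p Ω w f ∧
    ∃ g : EuclideanSpace ℝ (Fin n) → EuclideanSpace ℝ (Fin n),
      HasWeakGradient Ω f g ∧ MemLpWeighted p Ω w g

/-- The oscillation of `f` on `E`: the supremum of `|f x - f y|` over `x, y ∈ E`, in `[0, ∞]`. -/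
def osc {n : ℕ} (f : EuclideanSpace ℝ (Fin n) → ℝ) (E : Set (EuclideanSpace ℝ (Fin n))) : ℝ≥0∞ :=
  ⨆ x ∈ E, ⨆ y ∈ E, ENNReal.ofReal |f x - f y|

/-- A countable collection of pairwise disjoint open balls contained in `Ω`; a ball is given by
its center and its radius. -/
structure IsBallFamily {n : ℕ} (Ω : Set (EuclideanSpace ℝ (Fin n)))
    (D : Set (EuclideanSpace ℝ (Fin n) × ℝ)) : Prop where
  countable : D.Countable
  radius_pos : ∀ b ∈ D, 0 < b.2
  subset : ∀ b ∈ D, Metric.ball b.1 b.2 ⊆ Ω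
  disjoint : D.PairwiseDisjoint fun b => Metric.ball b.1 b.2

/-- The weighted Riesz `p`-variation `V_p(f; Ω, w)`, with values in `[0, ∞]`. -/
def rieszVar {n : ℕ} (p : ℝ) (Ω : Set (EuclideanSpace ℝ (Fin n)))
    (w : EuclideanSpace ℝ (Fin n) → ℝ) (f : EuclideanSpace ℝ (Fin n) → ℝ) : ℝ≥0∞ :=
  ⨆ (D : Set (EuclideanSpace ℝ (Fin n) × ℝ)) (_ : IsBallFamily Ω D),
    (∑' b : D, (osc f (Metric.ball b.1.1 b.1.2) / ENNReal.ofReal b.1.2) ^ p *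
      ∫⁻ x in Metric.ball b.1.1 b.1.2, ENNReal.ofReal (w x)) ^ (1 / p)

/-- `f ∈ RBV^p(Ω, w)`: `f` is measurable on `Ω` and `V_p(f; Ω, w) < ∞`. -/
def MemRBV {n : ℕ} (p : ℝ) (Ω : Set (EuclideanSpace ℝ (Fin n)))
    (w : EuclideanSpace ℝ (Fin n) → ℝ) (f : EuclideanSpace ℝ (Fin n) → ℝ) : Prop :=
  AEMeasurable f (volume.restrict Ω) ∧ rieszVar p Ω w f < ⊤

/-- `h` is a continuous representative of `f` on `Ω`. -/
def IsContinuousRep {n : ℕ} (Ω : Set (EuclideanSpace ℝ (Fin n)))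
    (f h : EuclideanSpace ℝ (Fin n) → ℝ) : Prop :=
  ContinuousOn h Ω ∧ h =ᵐ[volume.restrict Ω] f

end

end RieszBV

open Filter Topology

/-! Write `σ = w ^ (1 / (1 - p / n))` for the dual weight of `A_{p/n}`. Membership in `A_{p/n}`
follows from `p / n > r_w`, because the `A_q` classes increase with `q`.

From Sobolev to bounded variation, the engine is Morrey's telescoping argument. Let `B` be a ball of
radius `r` and `x ∈ B`. Shrinking `B` by half towards `x` changes a smooth average of `f` by at most
a constant times `r ^ (1 - n) * ∫_B |∇f|`. Hölder with the exponents `1/p`, `1/n - 1/p`, `1 - 1/n`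
bounds this integral by `(∫_B |∇f|^p w)^(1/p) * σ(B)^(1/n - 1/p) * |B|^(1 - 1/n)`, and the last
factor cancels `r ^ (1 - n)`. By `A_{p/n}`, `σ` loses a fixed proportion of its mass at each halving
(`exists_dualMass_le_mul_of_volume_le_half`), so the telescoping series is geometric. The
oscillation of `f` on `B` is therefore at most `C * (∫_B |∇f|^p w)^(1/p) * σ(B)^(1/n - 1/p)`. This
gives a continuous representative. Raised to the power `p` and multiplied by `w(B) / r^p`, it gives
`C * ∫_B |∇f|^p w`, because `w(B) * σ(B)^(p/n - 1) ≤ [w] * (2r)^p`. Summing over disjoint balls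
bounds the variation (`exists_rieszVar_le`).

Conversely, cover `Ω`, away from its boundary, by the cells of a grid of side `ε`. A ball of radius
comparable to `ε` contains a cell and its translate by `ε e_j`, so the difference quotient on the
cell is controlled by the oscillation on the ball. The balls split into boundedly many disjoint
families, whence a bound in `L^p(w)` by the variation, uniform in `ε`
(`lintegral_difference_quotient_le`). A weak limit in `L^p(w)` is the weak derivative: a test
function `φ` is paired through `φ / w`, which lies in the dual space because `w ∈ A_p`.

The weak compactness used here (`exists_memLp_of_tsendsto` type argument below) rests on nearly
minimising a strictly convex functional over convex hulls of tails: the minimisers converge almost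
everywhere, and bounded sequences in `L^p` that converge almost everywhere converge weakly. -/

/-! ### Weak sequential compactness in `L^p` through convex combinations -/

/-- Two rationalisations: the gap times `x + y + 2z` is `2(xy - (1 + ab))`, and `xy - (1 + ab)`
times its conjugate is `(a - b)²`. This quantifies the strict convexity of `t ↦ √(1 + t²)`, a
function of linear growth and hence suited to `L¹` bounds. -/
theorem sq_sub_le_sqrt_convexity_gap (a b : ℝ) :
    0 ≤ √(1 + a ^ 2) + √(1 + b ^ 2) - 2 * √(1 + ((a + b) / 2) ^ 2) ∧
    (a - b) ^ 2 ≤ (√(1 + a ^ 2) + √(1 + b ^ 2)) ^ 3 *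
      (√(1 + a ^ 2) + √(1 + b ^ 2) - 2 * √(1 + ((a + b) / 2) ^ 2)) := by
  set x := √(1 + a ^ 2)
  set y := √(1 + b ^ 2)
  set z := √(1 + ((a + b) / 2) ^ 2)
  have hx : x ^ 2 = 1 + a ^ 2 := Real.sq_sqrt (by positivity)
  have hy : y ^ 2 = 1 + b ^ 2 := Real.sq_sqrt (by positivity)
  have hz : z ^ 2 = 1 + ((a + b) / 2) ^ 2 := Real.sq_sqrt (by positivity)
  have x0 : 0 ≤ x := Real.sqrt_nonneg _
  have y0 : 0 ≤ y := Real.sqrt_nonneg _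
  have z0 : 0 ≤ z := Real.sqrt_nonneg _
  have e1 : (x + y - 2 * z) * (x + y + 2 * z) = 2 * (x * y - (1 + a * b)) := by
    linear_combination hx + hy - 4 * hz
  have e2 : (x * y - (1 + a * b)) * (x * y + (1 + a * b)) = (a - b) ^ 2 := by
    linear_combination y ^ 2 * hx + (1 + a ^ 2) * hy
  have hxy : |1 + a * b| ≤ x * y := by
    apply abs_le_of_sq_le_sq _ (by positivity)
    nlinarith [sq_nonneg (a - b)]
  have hS : 2 * z ≤ x + y := by
    apply le_of_sq_le_sq _ (by positivity)
    nlinarith [(abs_le.mp hxy).2]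
  refine ⟨by linarith, ?_⟩
  have h3 : 0 ≤ x + y - 2 * z := by linarith
  have h4 := abs_le.mp hxy
  calc (a - b) ^ 2 = (x + y - 2 * z) * ((x + y + 2 * z) / 2) * (x * y + (1 + a * b)) := by
        rw [← e2]; linear_combination -(x * y + (1 + a * b)) / 2 * e1
    _ ≤ (x + y - 2 * z) * (x + y) * (x + y) ^ 2 := by
        gcongr
        · nlinarith
        · linarith
        · nlinarith
    _ = _ := by ring

/-- The infima of `J v = ∫ √(1 + v²)` over the hulls of the tails increase to a finite limit `L`.
Near-minimisers far out have `J` close to `L`, and so do their midpoints, so the convexity gap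
forces consecutive ones to be close. -/
theorem exists_convexHull_tsum_lintegral_sqrt_lt_top {X : Type*} [MeasurableSpace X]
    (ν : Measure X) [IsFiniteMeasure ν] {u : ℕ → X → ℝ} {R : ℝ} (hu : ∀ k, Integrable (u k) ν)
    (hR : ∀ k, ∫ x, |u k x| ∂ν ≤ R) :
    ∃ v : ℕ → X → ℝ, (∀ k, v k ∈ convexHull ℝ (u '' Ici k)) ∧
      ∑' k, ∫⁻ x, ‖v (k + 1) x - v k x‖ₑ ^ (1 / 2 : ℝ) ∂ν < ⊤ := by
  set C : ℕ → Set (X → ℝ) := fun k => convexHull ℝ (u '' Ici k)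
  have hCanti : Antitone C := fun i j hij => convexHull_mono (image_mono (Ici_subset_Ici.2 hij))
  have hCint : ∀ k, C k ⊆ {v | Integrable v ν ∧ ∫ x, |v x| ∂ν ≤ R} := by
    intro k
    refine convexHull_min ?_ ?_
    · rintro _ ⟨i, -, rfl⟩
      exact ⟨hu i, hR i⟩
    · rintro f ⟨hf, hf'⟩ g ⟨hg, hg'⟩ a b ha hb hab
      have h1 := (hf.const_mul a).add (hg.const_mul b)
      refine ⟨h1, ?_⟩
      calc ∫ x, |(a • f + b • g) x| ∂ν ≤ ∫ x, (a * |f x| + b * |g x|) ∂ν := by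
            refine integral_mono h1.abs ((hf.abs.const_mul a).add (hg.abs.const_mul b)) ?_
            intro x
            simp only [Pi.add_apply, Pi.smul_apply, smul_eq_mul]
            refine (abs_add_le _ _).trans ?_
            rw [abs_mul, abs_mul, abs_of_nonneg ha, abs_of_nonneg hb]
        _ = a * ∫ x, |f x| ∂ν + b * ∫ x, |g x| ∂ν := by
            rw [integral_add (hf.abs.const_mul a) (hg.abs.const_mul b), integral_const_mul,
              integral_const_mul]
        _ ≤ a * R + b * R := by gcongr
        _ = R := by rw [← add_mul, hab, one_mul]
  have hψle : ∀ t : ℝ, √(1 + t ^ 2) ≤ 1 + |t| := fun t => by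
    rw [Real.sqrt_le_left (by positivity)]
    nlinarith [abs_nonneg t, sq_abs t]
  have hψint : ∀ v : X → ℝ, Integrable v ν → Integrable (fun x => √(1 + v x ^ 2)) ν := by
    intro v hv
    refine ((integrable_const (1 : ℝ)).add hv.abs).mono ?_ (Eventually.of_forall fun x => ?_)
    · exact (by fun_prop : Continuous fun t : ℝ => √(1 + t ^ 2)).comp_aestronglyMeasurable hv.1
    · simp only [Pi.add_apply]
      rw [Real.norm_of_nonneg (Real.sqrt_nonneg _), Real.norm_of_nonneg (by positivity)]
      exact hψle _
  set J : (X → ℝ) → ℝ := fun v => ∫ x, √(1 + v x ^ 2) ∂ν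
  have hJ0 : ∀ v, 0 ≤ J v := fun v => integral_nonneg fun x => Real.sqrt_nonneg _
  have hJle : ∀ k, ∀ v ∈ C k, J v ≤ ν.real univ + R := by
    intro k v hv
    obtain ⟨hv1, hv2⟩ := hCint k hv
    calc J v ≤ ∫ x, (1 + |v x|) ∂ν :=
          integral_mono (hψint v hv1) ((integrable_const _).add hv1.abs) fun x => hψle _
      _ ≤ _ := by
          rw [integral_add (integrable_const _) hv1.abs]
          simpa using hv2
  have huC : ∀ k, u k ∈ C k := fun k => subset_convexHull _ _ ⟨k, self_mem_Ici, rfl⟩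
  set a : ℕ → ℝ := fun k => sInf (J '' C k)
  have hbb : ∀ k, BddBelow (J '' C k) := fun k => ⟨0, by rintro _ ⟨v, -, rfl⟩; exact hJ0 v⟩
  have hne : ∀ k, (J '' C k).Nonempty := fun k => ⟨_, _, huC k, rfl⟩
  have hale : ∀ k, ∀ v ∈ C k, a k ≤ J v := fun k v hv => csInf_le (hbb k) ⟨v, hv, rfl⟩
  have hamono : Monotone a := fun i j hij => csInf_le_csInf (hbb i) (hne j)
    (image_mono (hCanti hij))
  have habdd : BddAbove (range a) := by
    refine ⟨ν.real univ + R, ?_⟩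
    rintro _ ⟨k, rfl⟩
    exact (hale k _ (huC k)).trans (hJle k _ (huC k))
  set L := ⨆ k, a k
  -- The error `16⁻ᵏ` enters below with exponent `1/4`, which leaves the summable `2⁻ᵏ`.
  have hsel : ∀ k : ℕ, ∃ m, k ≤ m ∧ L - (1 / 16) ^ k < a m ∧
      ∃ v ∈ C m, J v < L + (1 / 16) ^ k := by
    intro k
    have hk : (0 : ℝ) < (1 / 16) ^ k := by positivity
    obtain ⟨i, hi⟩ := exists_lt_of_lt_ciSup (show L - (1 / 16) ^ k < ⨆ k, a k by linarith)
    refine ⟨max i k, le_max_right _ _, hi.trans_le (hamono (le_max_left _ _)), ?_⟩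
    have h1 : a (max i k) ≤ L := le_ciSup habdd _
    obtain ⟨_, ⟨v, hv, rfl⟩, hlt⟩ := exists_lt_of_csInf_lt (hne (max i k))
      (show sInf (J '' C (max i k)) < L + (1 / 16) ^ k by
        change a _ < _
        linarith)
    exact ⟨v, hv, hlt⟩
  choose m hkm ham v hv hJv using hsel
  refine ⟨v, fun k => hCanti (hkm k) (hv k), ?_⟩
  have hvint : ∀ k, Integrable (v k) ν := fun k => (hCint _ (hv k)).1
  have key : ∀ k, ∫⁻ x, ‖v (k + 1) x - v k x‖ₑ ^ (1 / 2 : ℝ) ∂ν ≤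
      ENNReal.ofReal (2 * (ν.real univ + R)) ^ (3 / 4 : ℝ) *
        (ENNReal.ofReal 4 ^ (1 / 4 : ℝ) * ENNReal.ofReal (1 / 2) ^ k) := by
    intro k
    set w : X → ℝ := (1 / 2 : ℝ) • v (k + 1) + (1 / 2 : ℝ) • v k
    -- The indices `m k` need not be monotone; the midpoint lies in the larger of the two hulls,
    -- where `J` is still above `L - 16⁻ᵏ`.
    have hw : w ∈ C (min (m (k + 1)) (m k)) :=
      (convex_convexHull ℝ _) (hCanti (min_le_left _ _) (hv (k + 1)))
        (hCanti (min_le_right _ _) (hv k)) (by norm_num) (by norm_num) (by norm_num)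
    have hwx : ∀ x, w x = (v (k + 1) x + v k x) / 2 := fun x => by
      simp only [w, Pi.add_apply, Pi.smul_apply, smul_eq_mul]; ring
    have hwint : Integrable w ν := (hCint _ hw).1
    have hJw : L - (1 / 16) ^ k < J w := by
      refine lt_of_lt_of_le ?_ (hale _ _ hw)
      rcases min_choice (m (k + 1)) (m k) with h | h <;> rw [h]
      · refine lt_of_le_of_lt (sub_le_sub_left ?_ _) (ham (k + 1))
        exact pow_le_pow_of_le_one (a := (1 / 16 : ℝ)) (by norm_num) (by norm_num) (Nat.le_succ k)
      · exact ham k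
    have hJ1 : J (v (k + 1)) < L + (1 / 16) ^ k := (hJv (k + 1)).trans_le (by
      refine add_le_add_right ?_ _
      exact pow_le_pow_of_le_one (a := (1 / 16 : ℝ)) (by norm_num) (by norm_num) (Nat.le_succ k))
    have i1 := hψint _ (hvint (k + 1))
    have i2 := hψint _ (hvint k)
    have i3 := hψint _ hwint
    set S : X → ℝ := fun x => √(1 + v (k + 1) x ^ 2) + √(1 + v k x ^ 2)
    set G : X → ℝ := fun x => √(1 + v (k + 1) x ^ 2) + √(1 + v k x ^ 2) - 2 * √(1 + w x ^ 2)
    have hS0 : ∀ x, 0 ≤ S x := fun x => by positivity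
    have hgap := fun x => sq_sub_le_sqrt_convexity_gap (v (k + 1) x) (v k x)
    simp only [← hwx] at hgap
    have hG0 : ∀ x, 0 ≤ G x := fun x => (hgap x).1
    have hSint : Integrable S ν := i1.add i2
    have hGint : Integrable G ν := hSint.sub (i3.const_mul 2)
    have hSI : ∫ x, S x ∂ν ≤ 2 * (ν.real univ + R) := by
      rw [integral_add i1 i2]
      have := hJle _ _ (hv (k + 1))
      have := hJle _ _ (hv k)
      simp only [J] at *
      linarith
    have hGI : ∫ x, G x ∂ν ≤ 4 * (1 / 16) ^ k := by
      rw [integral_sub hSint (i3.const_mul 2), integral_add i1 i2, integral_const_mul]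
      have := hJv k
      simp only [J] at *
      linarith
    -- The gap inequality reads `|a - b|² ≤ S³ G`; its fourth root prepares Hölder with exponents
    -- `3/4` and `1/4`.
    calc ∫⁻ x, ‖v (k + 1) x - v k x‖ₑ ^ (1 / 2 : ℝ) ∂ν
        ≤ ∫⁻ x, ENNReal.ofReal (S x) ^ (3 / 4 : ℝ) * ENNReal.ofReal (G x) ^ (1 / 4 : ℝ) ∂ν := by
          refine lintegral_mono fun x => ?_
          rw [← ofReal_norm, ENNReal.ofReal_rpow_of_nonneg (norm_nonneg _) (by norm_num),
            ENNReal.ofReal_rpow_of_nonneg (hS0 x) (by norm_num),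
            ENNReal.ofReal_rpow_of_nonneg (hG0 x) (by norm_num),
            ← ENNReal.ofReal_mul (Real.rpow_nonneg (hS0 x) _)]
          refine ENNReal.ofReal_le_ofReal ?_
          have e1 : ‖v (k + 1) x - v k x‖ ^ (1 / 2 : ℝ) =
              ((v (k + 1) x - v k x) ^ 2) ^ (1 / 4 : ℝ) := by
            rw [Real.norm_eq_abs, ← sq_abs (v (k + 1) x - v k x), ← Real.rpow_natCast,
              ← Real.rpow_mul (abs_nonneg _)]
            norm_num
          have e2 : S x ^ (3 / 4 : ℝ) * G x ^ (1 / 4 : ℝ) = (S x ^ 3 * G x) ^ (1 / 4 : ℝ) := by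
            rw [Real.mul_rpow (pow_nonneg (hS0 x) _) (hG0 x), ← Real.rpow_natCast,
              ← Real.rpow_mul (hS0 x)]
            norm_num
          rw [e1, e2]
          exact Real.rpow_le_rpow (sq_nonneg _) (hgap x).2 (by norm_num)
      _ ≤ (∫⁻ x, ENNReal.ofReal (S x) ∂ν) ^ (3 / 4 : ℝ) *
            (∫⁻ x, ENNReal.ofReal (G x) ∂ν) ^ (1 / 4 : ℝ) :=
          ENNReal.lintegral_mul_norm_pow_le hSint.1.aemeasurable.ennreal_ofReal
            hGint.1.aemeasurable.ennreal_ofReal (by norm_num) (by norm_num) (by norm_num)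
      _ ≤ ENNReal.ofReal (2 * (ν.real univ + R)) ^ (3 / 4 : ℝ) *
            (ENNReal.ofReal (4 * (1 / 16) ^ k)) ^ (1 / 4 : ℝ) := by
          rw [← ofReal_integral_eq_lintegral_ofReal hSint (Eventually.of_forall hS0),
            ← ofReal_integral_eq_lintegral_ofReal hGint (Eventually.of_forall fun x => (hgap x).1)]
          gcongr
      _ = _ := by
          congr 1
          rw [ENNReal.ofReal_mul (by norm_num), ENNReal.mul_rpow_of_nonneg _ _ (by norm_num)]
          congr 1
          rw [ENNReal.ofReal_rpow_of_nonneg (by positivity) (by norm_num),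
            ← ENNReal.ofReal_pow (by norm_num)]
          congr 1
          rw [show (1 / 16 : ℝ) = (1 / 2) ^ (4 : ℕ) by norm_num, ← pow_mul, mul_comm 4 k, pow_mul,
            ← Real.rpow_natCast _ 4, ← Real.rpow_mul (by positivity)]
          norm_num
  refine (ENNReal.tsum_le_tsum key).trans_lt ?_
  rw [ENNReal.tsum_mul_left, ENNReal.tsum_mul_left, ENNReal.tsum_geometric]
  refine ENNReal.mul_lt_top (by finiteness) (ENNReal.mul_lt_top (by finiteness) ?_)
  rw [ENNReal.inv_lt_top, tsub_pos_iff_lt]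
  exact ENNReal.ofReal_lt_one.2 (by norm_num)

/-- Almost everywhere the square roots of the increments are summable, so the increments are
eventually below `1`, where `t ≤ √t`; hence the increments are summable too. -/
theorem ae_exists_tendsto_of_tsum_lintegral_sqrt_lt_top {X : Type*} [MeasurableSpace X]
    {ν : Measure X} {v : ℕ → X → ℝ} (hv : ∀ k, AEStronglyMeasurable (v k) ν)
    (h : ∑' k, ∫⁻ x, ‖v (k + 1) x - v k x‖ₑ ^ (1 / 2 : ℝ) ∂ν < ⊤) :
    ∀ᵐ x ∂ν, ∃ l, Tendsto (fun k => v k x) atTop (𝓝 l) := by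
  have hm : ∀ k, AEMeasurable (fun x => ‖v (k + 1) x - v k x‖ₑ ^ (1 / 2 : ℝ)) ν :=
    fun k => ((hv _).sub (hv _)).enorm.pow_const _
  rw [← lintegral_tsum hm] at h
  filter_upwards [ae_lt_top' (AEMeasurable.tsum hm) h.ne] with x hx
  refine cauchySeq_tendsto_of_complete (cauchySeq_of_edist_le_of_tsum_ne_top
    (fun k => ‖v (k + 1) x - v k x‖ₑ) (fun k => ?_) ?_)
  · rw [edist_comm, edist_eq_enorm_sub]
  · have h0 := ENNReal.tendsto_atTop_zero_of_tsum_ne_top hx.ne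
    obtain ⟨N, hN⟩ := eventually_atTop.1 (h0.eventually_lt_const (zero_lt_one))
    rw [← ENNReal.summable.sum_add_tsum_nat_add' (k := N)]
    refine (ENNReal.add_lt_top.2 ⟨ENNReal.sum_lt_top.2 fun i _ => enorm_lt_top, ?_⟩).ne
    refine lt_of_le_of_lt (ENNReal.tsum_le_tsum fun k => ?_)
      (lt_of_le_of_lt (ENNReal.tsum_comp_le_tsum_of_injective (add_left_injective N) _) hx)
    have h1 := hN (k + N) (by omega)
    have h2 : ‖v (k + N + 1) x - v (k + N) x‖ₑ < 1 := by
      by_contra hcon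
      exact absurd h1 (not_lt.2 (ENNReal.one_le_rpow (not_lt.1 hcon) (by norm_num)))
    calc ‖v (k + N + 1) x - v (k + N) x‖ₑ = ‖v (k + N + 1) x - v (k + N) x‖ₑ ^ (1 : ℝ) := by simp
      _ ≤ _ := ENNReal.rpow_le_rpow_of_exponent_ge h2.le (by norm_num)

/-- With `d = v k - v₀`, truncate `|d|` at height `s |φ|^(q-1)`. The truncated product is dominated
by `s |φ|^q` and tends to zero. Above that height `|d φ| ≤ s^(1-p) |d|^p`, whose integral is small
for large `s`, uniformly in `k`. -/
theorem tendsto_integral_mul_of_ae_tendsto_of_eLpNorm_le {X : Type*} [MeasurableSpace X]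
    {μ : Measure X} {p q : ℝ} (hpq : p.HolderConjugate q) {v : ℕ → X → ℝ} {v₀ φ : X → ℝ}
    {A : ℝ≥0∞} (hA : A ≠ ⊤) (hv : ∀ k, AEStronglyMeasurable (v k) μ)
    (hvA : ∀ k, eLpNorm (v k) (ENNReal.ofReal p) μ ≤ A) (hv₀ : MemLp v₀ (ENNReal.ofReal p) μ)
    (hφ : MemLp φ (ENNReal.ofReal q) μ)
    (hlim : ∀ᵐ x ∂μ, Tendsto (fun k => v k x) atTop (𝓝 (v₀ x))) :
    Tendsto (fun k => ∫ x, v k x * φ x ∂μ) atTop (𝓝 (∫ x, v₀ x * φ x ∂μ)) := by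
  have hp0 : 0 < p := hpq.pos
  have hq0 : 0 < q := hpq.symm.pos
  have hp1 : 1 < p := hpq.lt
  have hq1 : 1 < q := hpq.symm.lt
  have hp1' : (1 : ℝ≥0∞) ≤ ENNReal.ofReal p := by
    rw [← ENNReal.ofReal_one]; exact ENNReal.ofReal_le_ofReal hp1.le
  have hpn : ENNReal.ofReal p ≠ 0 := by simpa using hp0
  have hqn : ENNReal.ofReal q ≠ 0 := by simpa using hq0
  have : (ENNReal.ofReal p).HolderConjugate (ENNReal.ofReal q) := by
    rw [ENNReal.holderConjugate_iff, ← ENNReal.ofReal_inv_of_pos hp0,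
      ← ENNReal.ofReal_inv_of_pos hq0, ← ENNReal.ofReal_add (by positivity) (by positivity),
      hpq.inv_add_inv_eq_one, ENNReal.ofReal_one]
  have hvL : ∀ k, MemLp (v k) (ENNReal.ofReal p) μ := fun k => ⟨hv k, (hvA k).trans_lt hA.lt_top⟩
  have hmul : ∀ f : X → ℝ, MemLp f (ENNReal.ofReal p) μ → Integrable (fun x => f x * φ x) μ :=
    fun f hf => hf.integrable_mul hφ
  set d : ℕ → X → ℝ := fun k => v k - v₀
  have hd : ∀ k, MemLp (d k) (ENNReal.ofReal p) μ := fun k => (hvL k).sub hv₀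
  have hdp : ∀ k, Integrable (fun x => |d k x| ^ p) μ := fun k => by
    simpa [ENNReal.toReal_ofReal hp0.le] using (hd k).integrable_norm_rpow hpn ENNReal.ofReal_ne_top
  have hφq : Integrable (fun x => |φ x| ^ q) μ := by
    simpa [ENNReal.toReal_ofReal hq0.le] using hφ.integrable_norm_rpow hqn ENNReal.ofReal_ne_top
  set B : ℝ := ((A + eLpNorm v₀ (ENNReal.ofReal p) μ) ^ p).toReal
  have hB : ∀ k, ∫ x, |d k x| ^ p ∂μ ≤ B := by
    intro k
    rw [integral_eq_lintegral_of_nonneg_ae (Eventually.of_forall fun x => by positivity) (hdp k).1]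
    refine ENNReal.toReal_mono ?_ ?_
    · exact ENNReal.rpow_ne_top_of_nonneg hp0.le (ENNReal.add_ne_top.2 ⟨hA, hv₀.2.ne⟩)
    · have h1 : eLpNorm (d k) (ENNReal.ofReal p) μ ≤ A + eLpNorm v₀ (ENNReal.ofReal p) μ :=
        (eLpNorm_sub_le (hv k) hv₀.1 hp1').trans (by gcongr; exact hvA k)
      rw [eLpNorm_eq_lintegral_rpow_enorm_toReal hpn ENNReal.ofReal_ne_top,
        ENNReal.toReal_ofReal hp0.le] at h1
      have h2 := ENNReal.rpow_le_rpow h1 hp0.le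
      rw [← ENNReal.rpow_mul, one_div_mul_cancel hp0.ne', ENNReal.rpow_one] at h2
      refine le_trans (le_of_eq (lintegral_congr fun x => ?_)) h2
      rw [← ENNReal.ofReal_rpow_of_nonneg (abs_nonneg _) hp0.le, ← Real.norm_eq_abs, ofReal_norm]
  have hB0 : 0 ≤ B := ENNReal.toReal_nonneg
  have main : Tendsto (fun k => ∫ x, |d k x * φ x| ∂μ) atTop (𝓝 0) := by
    rw [Metric.tendsto_atTop]
    intro ε hε
    obtain ⟨s, hs0, hs⟩ : ∃ s : ℝ, 0 < s ∧ B * s ^ (1 - p) < ε / 2 := by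
      have h1 : Tendsto (fun s : ℝ => B * s ^ (-(p - 1))) atTop (𝓝 (B * 0)) :=
        (tendsto_rpow_neg_atTop (by linarith)).const_mul B
      rw [mul_zero] at h1
      obtain ⟨s, h2, h3⟩ := ((h1.eventually_lt_const (half_pos hε)).and
        (eventually_gt_atTop 0)).exists
      exact ⟨s, h3, by rwa [neg_sub] at h2⟩
    set t : ℕ → X → ℝ := fun k x => min |d k x| (s * |φ x| ^ (q - 1)) * |φ x|
    have ht0 : ∀ k x, 0 ≤ t k x := fun k x => by positivity
    have htle : ∀ k x, t k x ≤ s * |φ x| ^ q := by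
      intro k x
      calc t k x ≤ s * |φ x| ^ (q - 1) * |φ x| := by
            simp only [t]; gcongr; exact min_le_right _ _
        _ = s * |φ x| ^ q := by
            rw [mul_assoc, ← Real.rpow_add_one' (abs_nonneg _) (by linarith)]
            ring_nf
    have htm : ∀ k, AEStronglyMeasurable (t k) μ := fun k => by
      have h1 := (hd k).1.aemeasurable
      have h2 := hφ.1.aemeasurable
      have h3 : AEMeasurable (t k) μ := by
        simp only [t]
        have h4 : AEMeasurable (fun x => |d k x|) μ := h1.abs
        have h5 : AEMeasurable (fun x => |φ x|) μ := h2.abs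
        exact (h4.min ((h5.pow_const _).const_mul s)).mul h5
      exact h3.aestronglyMeasurable
    have hti : ∀ k, Integrable (t k) μ := fun k =>
      (hφq.const_mul s).mono' (htm k) (Eventually.of_forall fun x => by
        rw [Real.norm_of_nonneg (ht0 k x)]; exact htle k x)
    have htlim : Tendsto (fun k => ∫ x, t k x ∂μ) atTop (𝓝 0) := by
      have := tendsto_integral_of_dominated_convergence (F := t) (f := fun _ => (0 : ℝ)) _ htm
        (hφq.const_mul s) (fun k => Eventually.of_forall fun x => by
          rw [Real.norm_of_nonneg (ht0 k x)]; exact htle k x) ?_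
      · simpa using this
      · filter_upwards [hlim] with x hx
        have h1 : Tendsto (fun k => |d k x| * |φ x|) atTop (𝓝 0) := by
          have : Tendsto (fun k => |v k x - v₀ x| * |φ x|) atTop (𝓝 (|v₀ x - v₀ x| * |φ x|)) :=
            ((hx.sub_const _).abs).mul_const _
          simpa [d] using this
        refine squeeze_zero (fun k => ht0 k x) (fun k => ?_) h1
        simp only [t]
        gcongr
        exact min_le_left _ _
    have hpt : ∀ k x, |d k x * φ x| ≤ t k x + |d k x| ^ p * s ^ (1 - p) := by
      intro k x
      rw [abs_mul]
      by_cases hc : |d k x| ≤ s * |φ x| ^ (q - 1)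
      · simp only [t, min_eq_left hc]
        have : 0 ≤ |d k x| ^ p * s ^ (1 - p) := by positivity
        linarith
      · push Not at hc
        -- Conjugacy makes `t ↦ t^(p-1)` invert `t ↦ t^(q-1)`, which turns the lower bound on `|d|`
        -- into an upper bound on `|φ|`.
        have hqp : (q - 1) * (p - 1) = 1 := by
          linear_combination hpq.mul_eq_add
        have h1 : |φ x| ≤ (|d k x| / s) ^ (p - 1) := by
          have h2 : |φ x| ^ (q - 1) ≤ |d k x| / s := by
            rw [le_div_iff₀ hs0, mul_comm]; exact hc.le
          have h3 := Real.rpow_le_rpow (by positivity) h2 (by linarith : 0 ≤ p - 1)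
          rwa [← Real.rpow_mul (abs_nonneg _), hqp,
            Real.rpow_one] at h3
        calc |d k x| * |φ x| ≤ |d k x| * (|d k x| / s) ^ (p - 1) := by gcongr
          _ = |d k x| ^ p * s ^ (1 - p) := by
            rw [Real.div_rpow (abs_nonneg _) hs0.le, div_eq_mul_inv, ← Real.rpow_neg hs0.le,
              neg_sub, ← mul_assoc, mul_comm |d k x|, ← Real.rpow_add_one' (abs_nonneg _)
              (by linarith)]
            ring_nf
          _ ≤ _ := by linarith [ht0 k x]
    obtain ⟨N, hN⟩ := eventually_atTop.1 (htlim.eventually_lt_const (half_pos hε))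
    refine ⟨N, fun k hk => ?_⟩
    rw [Real.dist_0_eq_abs, abs_of_nonneg (integral_nonneg fun x => abs_nonneg _)]
    calc ∫ x, |d k x * φ x| ∂μ ≤ ∫ x, (t k x + |d k x| ^ p * s ^ (1 - p)) ∂μ :=
          integral_mono (hmul _ (hd k)).abs ((hti k).add ((hdp k).mul_const _)) (hpt k)
      _ = ∫ x, t k x ∂μ + (∫ x, |d k x| ^ p ∂μ) * s ^ (1 - p) := by
          rw [integral_add (hti k) ((hdp k).mul_const _), integral_mul_const]
      _ ≤ ∫ x, t k x ∂μ + B * s ^ (1 - p) := by gcongr; exact hB k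
      _ < ε := by linarith [hN k hk]
  rw [tendsto_iff_norm_sub_tendsto_zero]
  refine squeeze_zero (fun k => norm_nonneg _) (fun k => ?_) main
  rw [← integral_sub (hmul _ (hvL k)) (hmul _ hv₀)]
  refine (norm_integral_le_integral_norm _).trans (le_of_eq (integral_congr_ae ?_))
  exact Eventually.of_forall fun x => by simp [d, sub_mul]

/-- Weak sequential compactness of bounded sequences in `L^p`, `1 < p < ∞`: some function in the
ball represents every limit of pairings that exists along the sequence. -/
theorem exists_memLp_of_tendsto_integral_mul {X : Type*} [MeasurableSpace X]
    (μ : Measure X) [SigmaFinite μ] {p q : ℝ} (hpq : p.HolderConjugate q) {u : ℕ → X → ℝ}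
    {A : ℝ≥0∞} (hA : A ≠ ⊤) (hu : ∀ k, AEStronglyMeasurable (u k) μ)
    (huA : ∀ k, eLpNorm (u k) (ENNReal.ofReal p) μ ≤ A) :
    ∃ v : X → ℝ, AEStronglyMeasurable v μ ∧ eLpNorm v (ENNReal.ofReal p) μ ≤ A ∧
      ∀ φ : X → ℝ, MemLp φ (ENNReal.ofReal q) μ → ∀ l,
        Tendsto (fun k => ∫ x, u k x * φ x ∂μ) atTop (𝓝 l) → ∫ x, v x * φ x ∂μ = l := by
  have hp0 : 0 < p := hpq.pos
  have hq0 : 0 < q := hpq.symm.pos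
  have hp1' : (1 : ℝ≥0∞) ≤ ENNReal.ofReal p := by
    rw [← ENNReal.ofReal_one]; exact ENNReal.ofReal_le_ofReal hpq.lt.le
  have : (ENNReal.ofReal p).HolderConjugate (ENNReal.ofReal q) := by
    rw [ENNReal.holderConjugate_iff, ← ENNReal.ofReal_inv_of_pos hp0,
      ← ENNReal.ofReal_inv_of_pos hq0, ← ENNReal.ofReal_add (by positivity) (by positivity),
      hpq.inv_add_inv_eq_one, ENNReal.ofReal_one]
  obtain ⟨ρ, hρ0, hρm, hρ1⟩ := exists_pos_lintegral_lt_of_sigmaFinite μ one_ne_zero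
  -- A positive density, integrable and at most `1`: `ν` is finite, has the null sets of `μ`, and
  -- satisfies `ν ≤ μ`, so bounds in `L^p(μ)` become bounds in `L¹(ν)`.
  set σ : X → ℝ≥0∞ := fun x => ((min (ρ x) 1 : ℝ≥0) : ℝ≥0∞)
  have hσm : Measurable σ := (hρm.min measurable_const).coe_nnreal_ennreal
  set ν := μ.withDensity σ
  have hνμ : ν ≤ μ := by
    calc ν ≤ μ.withDensity 1 := withDensity_mono (Eventually.of_forall fun x => by simp [σ])
      _ = μ := withDensity_one
  have hμν : μ ≪ ν := withDensity_absolutelyContinuous' hσm.aemeasurable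
    (Eventually.of_forall fun x => by simp [σ, (hρ0 x).ne'])
  have : IsFiniteMeasure ν := by
    refine isFiniteMeasure_withDensity (ne_of_lt (lt_of_le_of_lt (lintegral_mono fun x => ?_)
      (hρ1.trans ENNReal.one_lt_top)))
    exact ENNReal.coe_le_coe.2 (min_le_left _ _)
  have huL : ∀ k, MemLp (u k) (ENNReal.ofReal p) μ := fun k => ⟨hu k, (huA k).trans_lt hA.lt_top⟩
  have hui : ∀ k, Integrable (u k) ν := fun k => ((huL k).mono_measure hνμ).integrable hp1'
  set R' := A * ν univ ^ (1 / (1 : ℝ≥0∞).toReal - 1 / (ENNReal.ofReal p).toReal)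
  have hR'top : R' ≠ ⊤ := by
    refine ENNReal.mul_ne_top hA (ENNReal.rpow_ne_top_of_nonneg ?_ (measure_ne_top _ _))
    rw [ENNReal.toReal_ofReal hp0.le, ENNReal.toReal_one, one_div, inv_one, sub_nonneg, one_div]
    exact inv_le_one_of_one_le₀ hpq.lt.le
  have huR : ∀ k, ∫ x, |u k x| ∂ν ≤ R'.toReal := by
    intro k
    have h1 : ∫ x, |u k x| ∂ν = (eLpNorm (u k) 1 ν).toReal := by
      rw [eLpNorm_one_eq_lintegral_enorm]
      exact integral_norm_eq_lintegral_enorm (hui k).1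
    rw [h1]
    refine ENNReal.toReal_mono hR'top ?_
    refine (eLpNorm_le_eLpNorm_mul_rpow_measure_univ hp1' (hui k).1).trans ?_
    exact mul_le_mul_left ((eLpNorm_mono_measure _ hνμ).trans (huA k)) _
  obtain ⟨v, hvC, hvsum⟩ := exists_convexHull_tsum_lintegral_sqrt_lt_top ν hui huR
  have hvA : ∀ k, AEStronglyMeasurable (v k) μ ∧ eLpNorm (v k) (ENNReal.ofReal p) μ ≤ A := by
    intro k
    refine convexHull_min (t := {f | AEStronglyMeasurable f μ ∧
      eLpNorm f (ENNReal.ofReal p) μ ≤ A}) ?_ ?_ (hvC k)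
    · rintro _ ⟨i, -, rfl⟩
      exact ⟨hu i, huA i⟩
    · rintro f ⟨hf, hf'⟩ g ⟨hg, hg'⟩ a b ha hb hab
      refine ⟨(hf.const_smul a).add (hg.const_smul b), ?_⟩
      refine (eLpNorm_add_le (hf.const_smul a) (hg.const_smul b) hp1').trans ?_
      rw [eLpNorm_const_smul, eLpNorm_const_smul]
      calc ‖a‖ₑ * eLpNorm f (ENNReal.ofReal p) μ + ‖b‖ₑ * eLpNorm g (ENNReal.ofReal p) μ
          ≤ ‖a‖ₑ * A + ‖b‖ₑ * A := by gcongr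
        _ = A := by
          rw [← add_mul, Real.enorm_eq_ofReal ha, Real.enorm_eq_ofReal hb,
            ← ENNReal.ofReal_add ha hb, hab, ENNReal.ofReal_one, one_mul]
  have hlim : ∀ᵐ x ∂μ, ∃ l, Tendsto (fun k => v k x) atTop (𝓝 l) :=
    hμν.ae_le (ae_exists_tendsto_of_tsum_lintegral_sqrt_lt_top
      (fun k => (hvA k).1.mono_measure hνμ) hvsum)
  obtain ⟨v₀, hv₀m, hv₀⟩ := exists_stronglyMeasurable_limit_of_tendsto_ae (fun k => (hvA k).1) hlim
  have hv₀A : eLpNorm v₀ (ENNReal.ofReal p) μ ≤ A := by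
    refine (Lp.eLpNorm_lim_le_liminf_eLpNorm (fun k => (hvA k).1) v₀ hv₀).trans ?_
    exact liminf_le_of_le (by isBoundedDefault) fun b hb => by
      obtain ⟨k, hk⟩ := hb.exists
      exact hk.trans (hvA k).2
  refine ⟨v₀, hv₀m.aestronglyMeasurable, hv₀A, fun φ hφ l hl => ?_⟩
  refine tendsto_nhds_unique (tendsto_integral_mul_of_ae_tendsto_of_eLpNorm_le hpq hA
    (fun k => (hvA k).1) (fun k => (hvA k).2)
    ⟨hv₀m.aestronglyMeasurable, hv₀A.trans_lt hA.lt_top⟩ hφ hv₀) ?_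
  rw [Metric.tendsto_atTop]
  intro ε hε
  obtain ⟨N, hN⟩ := Metric.tendsto_atTop.1 hl (ε / 2) (half_pos hε)
  refine ⟨N, fun k hk => lt_of_le_of_lt ?_ (half_lt_self hε)⟩
  -- Since `v k` is a convex combination of the `u i` with `i ≥ k`, its pairing stays in any closed
  -- interval around `l` that contains theirs.
  refine (convexHull_min (t := {f | MemLp f (ENNReal.ofReal p) μ ∧
      dist (∫ x, f x * φ x ∂μ) l ≤ ε / 2}) ?_ ?_ (hvC k)).2
  · rintro _ ⟨i, hi, rfl⟩
    exact ⟨huL i, (hN i (hk.trans hi)).le⟩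
  · rintro f ⟨hf, hf'⟩ g ⟨hg, hg'⟩ a b ha hb hab
    refine ⟨(hf.const_smul a).add (hg.const_smul b), ?_⟩
    have h1 : ∫ x, (a • f + b • g) x * φ x ∂μ =
        a • ∫ x, f x * φ x ∂μ + b • ∫ x, g x * φ x ∂μ := by
      have i1 : Integrable (fun x => f x * φ x) μ := hf.integrable_mul hφ
      have i2 : Integrable (fun x => g x * φ x) μ := hg.integrable_mul hφ
      rw [smul_eq_mul, smul_eq_mul, ← integral_const_mul, ← integral_const_mul,
        ← integral_add (i1.const_mul a) (i2.const_mul b)]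
      exact integral_congr_ae (Eventually.of_forall fun x => by
        simp only [Pi.add_apply, Pi.smul_apply, smul_eq_mul]; ring)
    rw [h1]
    exact convex_closedBall l (ε / 2) hf' hg' ha hb hab

/-! ### Muckenhoupt weights and their dual weights -/

namespace RieszBV

variable {n : ℕ}

/-- The mass `∫_E w ^ (1 / (1 - q))` of the dual weight. -/
noncomputable def dualMass (q : ℝ) (w : EuclideanSpace ℝ (Fin n) → ℝ)
    (E : Set (EuclideanSpace ℝ (Fin n))) : ℝ≥0∞ :=
  ∫⁻ x in E, ENNReal.ofReal (w x) ^ (1 / (1 - q))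

theorem cube_eq_preimage (c : EuclideanSpace ℝ (Fin n)) {r : ℝ} (hr : 0 ≤ r) :
    cube c r = WithLp.ofLp ⁻¹' Metric.closedBall (WithLp.ofLp c) r := by
  ext x
  simp [cube, dist_pi_le_iff hr, Real.dist_eq]

theorem volume_cube (c : EuclideanSpace ℝ (Fin n)) {r : ℝ} (hr : 0 ≤ r) :
    volume (cube c r) = ENNReal.ofReal ((2 * r) ^ n) := by
  rw [cube_eq_preimage c hr, (PiLp.volume_preserving_ofLp (Fin n)).measure_preimage
    measurableSet_closedBall.nullMeasurableSet, Real.volume_pi_closedBall _ hr, Fintype.card_fin]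

theorem volume_cube_pos (c : EuclideanSpace ℝ (Fin n)) {r : ℝ} (hr : 0 < r) :
    0 < volume (cube c r) := by
  rw [volume_cube c hr.le]; exact ENNReal.ofReal_pos.2 (by positivity)

theorem volume_cube_ne_top (c : EuclideanSpace ℝ (Fin n)) {r : ℝ} (hr : 0 ≤ r) :
    volume (cube c r) ≠ ⊤ := by
  rw [volume_cube c hr]; exact ENNReal.ofReal_ne_top

theorem closedBall_subset_cube (c : EuclideanSpace ℝ (Fin n)) (r : ℝ) :
    Metric.closedBall c r ⊆ cube c r := by
  intro x hx i
  rw [Metric.mem_closedBall, dist_eq_norm] at hx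
  exact (PiLp.norm_apply_le (x - c) i).trans hx

theorem iUnion_cube : ⋃ k : ℕ, cube (0 : EuclideanSpace ℝ (Fin n)) (k + 1) = univ := by
  refine eq_univ_of_forall fun x => mem_iUnion.2 ?_
  obtain ⟨k, hk⟩ := exists_nat_ge ‖x‖
  exact ⟨k, closedBall_subset_cube _ _ (by rw [mem_closedBall_zero_iff]; linarith)⟩

theorem cube_mono (c : EuclideanSpace ℝ (Fin n)) {r s : ℝ} (h : r ≤ s) : cube c r ⊆ cube c s :=
  fun _ hx i => (hx i).trans h

theorem cube_average_mul_le_apConst (q : ℝ) (w : EuclideanSpace ℝ (Fin n) → ℝ)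
    (c : EuclideanSpace ℝ (Fin n)) {r : ℝ} (hr : 0 < r) :
    (⨍⁻ x in cube c r, ENNReal.ofReal (w x) ∂volume) *
      (⨍⁻ x in cube c r, ENNReal.ofReal (w x) ^ (1 / (1 - q)) ∂volume) ^ (q - 1) ≤ apConst q w :=
  le_iSup_of_le c (le_iSup_of_le r (le_iSup_of_le hr le_rfl))

theorem lintegral_cube_mul_dualMass_le {q : ℝ} (hq : 1 < q) (w : EuclideanSpace ℝ (Fin n) → ℝ)
    (c : EuclideanSpace ℝ (Fin n)) {r : ℝ} (hr : 0 < r) :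
    (∫⁻ x in cube c r, ENNReal.ofReal (w x)) * dualMass q w (cube c r) ^ (q - 1) ≤
      apConst q w * volume (cube c r) ^ q := by
  have h := cube_average_mul_le_apConst q w c hr
  have hV0 := (volume_cube_pos c hr).ne'
  have hVt := volume_cube_ne_top c hr.le
  rw [setLAverage_eq, setLAverage_eq] at h
  set V := volume (cube c r)
  calc (∫⁻ x in cube c r, ENNReal.ofReal (w x)) * dualMass q w (cube c r) ^ (q - 1)
      = ((∫⁻ x in cube c r, ENNReal.ofReal (w x)) / V) * (dualMass q w (cube c r) / V) ^ (q - 1)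
          * (V * V ^ (q - 1)) := by
        rw [ENNReal.div_rpow_of_nonneg _ _ (by linarith), mul_mul_mul_comm,
          ENNReal.div_mul_cancel hV0 hVt, ENNReal.div_mul_cancel]
        · exact (ENNReal.rpow_pos (pos_iff_ne_zero.2 hV0) hVt).ne'
        · exact ENNReal.rpow_ne_top_of_nonneg (by linarith) hVt
    _ = _ * V ^ q := by
        congr 1
        nth_rewrite 1 [← ENNReal.rpow_one V]
        rw [← ENNReal.rpow_add _ _ hV0 hVt]
        ring_nf
    _ ≤ _ := by gcongr; exact h

theorem aemeasurable_ofReal_weight {w : EuclideanSpace ℝ (Fin n) → ℝ} (hw : IsWeight w) :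
    AEMeasurable (fun x => ENNReal.ofReal (w x)) volume :=
  hw.locallyIntegrable.aestronglyMeasurable.aemeasurable.ennreal_ofReal

/-- On a cube where `w` has positive mass, a finite characteristic makes the dual mass finite, and
the dual density is `∞` wherever `w = 0`. -/
theorem MemAp.ae_pos {q : ℝ} (hq : 1 < q) {w : EuclideanSpace ℝ (Fin n) → ℝ} (hw : MemAp q w) :
    ∀ᵐ x, 0 < w x := by
  have hm := aemeasurable_ofReal_weight hw.isWeight
  obtain ⟨k₀, hk₀⟩ : ∃ k : ℕ, ∫⁻ x in cube 0 ((k : ℝ) + 1), ENNReal.ofReal (w x) ≠ 0 := by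
    by_contra! hcon
    apply hw.ne_zero
    have h1 : ∀ᵐ x ∂volume.restrict (⋃ k : ℕ, cube (0 : EuclideanSpace ℝ (Fin n)) (k + 1)),
        w x = 0 := by
      rw [ae_restrict_iUnion_iff]
      intro k
      have := (lintegral_eq_zero_iff' hm.restrict).1 (hcon k)
      filter_upwards [this] with x hx
      exact le_antisymm (ENNReal.ofReal_eq_zero.1 hx) (hw.isWeight.nonneg x)
    rwa [iUnion_cube, Measure.restrict_univ] at h1
  have h2 : ∀ᵐ x ∂volume.restrict (⋃ k : ℕ, cube (0 : EuclideanSpace ℝ (Fin n)) (k + 1)),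
      0 < w x := by
    rw [ae_restrict_iUnion_iff]
    intro k
    -- The cube is enlarged to contain the one indexed by `k₀`, which carries mass of `w`.
    have hk : (0 : ℝ) < (max k k₀ : ℕ) + 1 := by positivity
    have h3 := (lintegral_cube_mul_dualMass_le hq w 0 hk).trans_lt
      (ENNReal.mul_lt_top hw.apConst_lt_top (ENNReal.rpow_lt_top_of_nonneg (by linarith)
        (volume_cube_ne_top 0 hk.le)))
    have h4 : ∫⁻ x in cube 0 (((max k k₀ : ℕ) : ℝ) + 1), ENNReal.ofReal (w x) ≠ 0 := by
      refine (lt_of_lt_of_le (pos_iff_ne_zero.2 hk₀) (lintegral_mono_set (cube_mono _ ?_))).ne'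
      gcongr
      exact le_max_right _ _
    have h5 : dualMass q w (cube 0 (((max k k₀ : ℕ) : ℝ) + 1)) ≠ ⊤ := by
      intro hcon
      rw [hcon, ENNReal.top_rpow_of_pos (by linarith), ENNReal.mul_top h4] at h3
      exact lt_irrefl _ h3
    have h6 := ae_lt_top' (hm.restrict.pow_const _) h5
    refine ae_restrict_of_ae_restrict_of_subset (cube_mono 0 ?_) (h6.mono fun x hx => ?_)
    · gcongr; exact le_max_left _ _
    · by_contra hcon
      rw [ENNReal.ofReal_of_nonpos (not_lt.1 hcon), ENNReal.zero_rpow_of_neg] at hx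
      · exact lt_irrefl _ hx
      · exact div_neg_of_pos_of_neg one_pos (by linarith)
  rwa [iUnion_cube, Measure.restrict_univ] at h2

theorem lintegral_weight_pos {w : EuclideanSpace ℝ (Fin n) → ℝ} (hm : IsWeight w)
    (hw : ∀ᵐ x, 0 < w x) {E : Set (EuclideanSpace ℝ (Fin n))} (hE : volume E ≠ 0) :
    ∫⁻ x in E, ENNReal.ofReal (w x) ≠ 0 := by
  intro h
  rw [lintegral_eq_zero_iff' (aemeasurable_ofReal_weight hm).restrict] at h
  apply hE
  have : ∀ᵐ x ∂volume.restrict E, False := by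
    filter_upwards [h, ae_restrict_of_ae hw] with x h1 h2
    exact absurd h1 (ENNReal.ofReal_pos.2 h2).ne'
  simpa using this

theorem dualMass_closedBall_lt_top {q : ℝ} (hq : 1 < q) {w : EuclideanSpace ℝ (Fin n) → ℝ}
    (hw : MemAp q w) (c : EuclideanSpace ℝ (Fin n)) (r : ℝ) :
    dualMass q w (Metric.closedBall c r) < ⊤ := by
  have hr : 0 < |r| + 1 := by positivity
  have hsub : Metric.closedBall c r ⊆ cube c (|r| + 1) :=
    (closedBall_subset_cube c r).trans (cube_mono c (by linarith [le_abs_self r]))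
  refine (lintegral_mono_set hsub).trans_lt ?_
  have h3 := (lintegral_cube_mul_dualMass_le hq w c hr).trans_lt
      (ENNReal.mul_lt_top hw.apConst_lt_top (ENNReal.rpow_lt_top_of_nonneg (by linarith)
        (volume_cube_ne_top c hr.le)))
  rw [lt_top_iff_ne_top]
  intro hcon
  rw [dualMass, hcon, ENNReal.top_rpow_of_pos (by linarith), ENNReal.mul_top
    (lintegral_weight_pos hw.isWeight (hw.ae_pos hq) (volume_cube_pos c hr).ne')] at h3
  exact lt_irrefl _ h3

theorem lintegral_closedBall_mul_dualMass_le {q : ℝ} (hq : 1 < q)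
    (w : EuclideanSpace ℝ (Fin n) → ℝ) (c : EuclideanSpace ℝ (Fin n)) {r : ℝ} (hr : 0 < r) :
    (∫⁻ x in Metric.closedBall c r, ENNReal.ofReal (w x)) *
      dualMass q w (Metric.closedBall c r) ^ (q - 1) ≤
      apConst q w * ENNReal.ofReal ((2 * r) ^ n) ^ q := by
  rw [← volume_cube c hr.le]
  refine le_trans ?_ (lintegral_cube_mul_dualMass_le hq w c hr)
  exact mul_le_mul' (lintegral_mono_set (closedBall_subset_cube c r))
    (ENNReal.rpow_le_rpow (lintegral_mono_set (closedBall_subset_cube c r)) (by linarith))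

/-- Hölder applied to `1 = w^(1/q) * w^(-1/q)`: the reverse of the `A_q` inequality, valid on every
set. -/
theorem volume_rpow_le_lintegral_mul_dualMass {q : ℝ} (hq : 1 < q)
    {w : EuclideanSpace ℝ (Fin n) → ℝ} (hm : IsWeight w) (hw : ∀ᵐ x, 0 < w x)
    (E : Set (EuclideanSpace ℝ (Fin n))) :
    volume E ^ q ≤ (∫⁻ x in E, ENNReal.ofReal (w x)) * dualMass q w E ^ (q - 1) := by
  have hq0 : 0 < q := by linarith
  have hwm := aemeasurable_ofReal_weight hm
  have h1 : volume E ≤ (∫⁻ x in E, ENNReal.ofReal (w x)) ^ (1 / q) *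
      dualMass q w E ^ ((q - 1) / q) := by
    calc volume E = ∫⁻ x in E, 1 := by simp
      _ = ∫⁻ x in E, ENNReal.ofReal (w x) ^ (1 / q) *
            (ENNReal.ofReal (w x) ^ (1 / (1 - q))) ^ ((q - 1) / q) := by
          refine lintegral_congr_ae (ae_restrict_of_ae (hw.mono fun x hx => ?_))
          have h0 := (ENNReal.ofReal_pos.2 hx).ne'
          dsimp only
          rw [← ENNReal.rpow_mul, ← ENNReal.rpow_add _ _ h0 ENNReal.ofReal_ne_top]
          have : 1 / q + 1 / (1 - q) * ((q - 1) / q) = 0 := by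
            have : 1 - q ≠ 0 := by linarith
            field_simp; ring
          rw [this, ENNReal.rpow_zero]
      _ ≤ _ := ENNReal.lintegral_mul_norm_pow_le hwm.restrict (hwm.restrict.pow_const _)
          (by positivity) (div_nonneg (by linarith) hq0.le) (by field_simp; ring)
  calc volume E ^ q ≤ ((∫⁻ x in E, ENNReal.ofReal (w x)) ^ (1 / q) *
      dualMass q w E ^ ((q - 1) / q)) ^ q := ENNReal.rpow_le_rpow h1 hq0.le
    _ = _ := by
      rw [ENNReal.mul_rpow_of_nonneg _ _ hq0.le, ← ENNReal.rpow_mul, ← ENNReal.rpow_mul,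
        one_div_mul_cancel hq0.ne', ENNReal.rpow_one, div_mul_cancel₀ _ hq0.ne']

/-- The remainder `B \ B'` has at least half the volume of `B`. Hölder on it, compared with the
`A_q` inequality on `B`, gives `σ(B) ≤ K σ(B \ B')`, so `B'` misses a fixed proportion of `σ(B)`.
This is the source of geometric decay in Morrey's estimate. -/
theorem exists_dualMass_le_mul_of_volume_le_half (n : ℕ) {q : ℝ} (hq : 1 < q) (M : ℝ≥0) :
    ∃ θ : ℝ≥0∞, θ < 1 ∧ ∀ w : EuclideanSpace ℝ (Fin n) → ℝ, MemAp q w → apConst q w ≤ M →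
      ∀ (c : EuclideanSpace ℝ (Fin n)) (r : ℝ), 0 < r → ∀ B' ⊆ Metric.closedBall c r,
        MeasurableSet B' → 2 * volume B' ≤ volume (Metric.closedBall c r) →
          dualMass q w B' ≤ θ * dualMass q w (Metric.closedBall c r) := by
  have hq0 : 0 < q := by linarith
  have hq1 : 0 < q - 1 := by linarith
  set β : ℝ≥0∞ := volume (Metric.ball (0 : EuclideanSpace ℝ (Fin n)) 1)
  have hβ0 : β ≠ 0 := (Metric.measure_ball_pos volume _ one_pos).ne'
  have hβt : β ≠ ⊤ := measure_ball_lt_top.ne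
  set K : ℝ≥0∞ := (M * (2 ^ n / (β / 2)) ^ q) ^ (1 / (q - 1))
  have hβ2 : β / 2 ≠ 0 := by simp [hβ0]
  have hK : K ≠ ⊤ := by
    refine ENNReal.rpow_ne_top_of_nonneg (by positivity) (ENNReal.mul_ne_top ENNReal.coe_ne_top
      (ENNReal.rpow_ne_top_of_nonneg hq0.le (ENNReal.div_ne_top (by finiteness) hβ2)))
  -- Adding `1` to `K` keeps the inverse finite; `K ≠ ⊤` keeps it positive.
  refine ⟨1 - (K + 1)⁻¹, ENNReal.sub_lt_self (by simp) (by simp) (by simp [hK]), ?_⟩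
  intro w hw hM c r hr B' hB' hB'm hvol
  set B := Metric.closedBall c r
  have hBt : volume B ≠ ⊤ := measure_closedBall_lt_top.ne
  have hpos := hw.ae_pos hq
  have hdB : dualMass q w B' + dualMass q w (B \ B') = dualMass q w B := by
    rw [dualMass, dualMass, add_comm, ← lintegral_union hB'm disjoint_sdiff_left,
      sdiff_union_of_subset hB', dualMass]
  have hfin : dualMass q w B < ⊤ := dualMass_closedBall_lt_top hq hw c r
  have hvE : volume B / 2 ≤ volume (B \ B') := by
    rw [measure_sdiff hB' hB'm.nullMeasurableSet (ne_top_of_le_ne_top hBt (measure_mono hB'))]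
    rw [ENNReal.div_le_iff (by simp) (by simp), ENNReal.sub_mul (by simp)]
    refine ENNReal.le_sub_of_add_le_left ?_ ?_
    · exact ENNReal.mul_ne_top (ne_top_of_le_ne_top hBt (measure_mono hB')) (by simp)
    · rw [mul_comm, mul_two (volume B)]; gcongr
  have hvB : volume B = ENNReal.ofReal (r ^ n) * β := by
    rw [Measure.addHaar_closedBall _ _ hr.le, finrank_euclideanSpace_fin]
  set ρ := ENNReal.ofReal (r ^ n)
  have hρ0 : ρ ≠ 0 := (ENNReal.ofReal_pos.2 (by positivity)).ne'
  have hρt : ρ ≠ ⊤ := ENNReal.ofReal_ne_top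
  have hcube : ENNReal.ofReal ((2 * r) ^ n) = 2 ^ n * ρ := by
    rw [mul_pow, ENNReal.ofReal_mul (by positivity), ENNReal.ofReal_pow (by norm_num)]
    norm_num
    rfl
  have h1 := volume_rpow_le_lintegral_mul_dualMass hq hw.isWeight hpos (B \ B')
  have h2 := lintegral_closedBall_mul_dualMass_le hq w c hr
  rw [hcube] at h2
  have h3 : (ρ * (β / 2)) ^ q * dualMass q w B ^ (q - 1) ≤
      M * (2 ^ n * ρ) ^ q * dualMass q w (B \ B') ^ (q - 1) := by
    calc (ρ * (β / 2)) ^ q * dualMass q w B ^ (q - 1)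
        = (volume B / 2) ^ q * dualMass q w B ^ (q - 1) := by rw [hvB, mul_div_assoc]
      _ ≤ (∫⁻ x in B, ENNReal.ofReal (w x)) * dualMass q w (B \ B') ^ (q - 1) *
            dualMass q w B ^ (q - 1) := by
          gcongr
          refine (ENNReal.rpow_le_rpow hvE hq0.le).trans (h1.trans ?_)
          gcongr
          exact sdiff_subset
      _ = (∫⁻ x in B, ENNReal.ofReal (w x)) * dualMass q w B ^ (q - 1) *
            dualMass q w (B \ B') ^ (q - 1) := by ring
      _ ≤ apConst q w * (2 ^ n * ρ) ^ q * dualMass q w (B \ B') ^ (q - 1) := by gcongr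
      _ ≤ _ := by gcongr
  have h4 : dualMass q w B ^ (q - 1) ≤ M * (2 ^ n / (β / 2)) ^ q *
      dualMass q w (B \ B') ^ (q - 1) := by
    have hne : (ρ * (β / 2)) ^ q ≠ 0 :=
      (ENNReal.rpow_pos (pos_iff_ne_zero.2 (mul_ne_zero hρ0 hβ2)) (by finiteness)).ne'
    have hnt : (ρ * (β / 2)) ^ q ≠ ⊤ := ENNReal.rpow_ne_top_of_nonneg hq0.le (by finiteness)
    rw [← ENNReal.mul_le_mul_iff_right hne hnt]
    refine h3.trans (le_of_eq ?_)
    have : (2 : ℝ≥0∞) ^ n * ρ = (ρ * (β / 2)) * (2 ^ n / (β / 2)) := by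
      rw [mul_assoc, ENNReal.mul_div_cancel hβ2 (by finiteness), mul_comm]
    rw [this, ENNReal.mul_rpow_of_nonneg _ _ hq0.le]
    ring
  have h5 : dualMass q w B ≤ K * dualMass q w (B \ B') := by
    have := ENNReal.rpow_le_rpow h4 (by positivity : 0 ≤ 1 / (q - 1))
    rwa [ENNReal.mul_rpow_of_nonneg _ _ (by positivity), ← ENNReal.rpow_mul, ← ENNReal.rpow_mul,
      mul_one_div_cancel hq1.ne', ENNReal.rpow_one, ENNReal.rpow_one] at this
  have h6 : (K + 1)⁻¹ * dualMass q w B ≤ dualMass q w (B \ B') := by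
    rw [mul_comm, ← div_eq_mul_inv]
    refine ENNReal.div_le_of_le_mul' (h5.trans ?_)
    gcongr
    exact le_self_add
  rw [ENNReal.sub_mul (fun _ _ => hfin.ne), one_mul]
  refine ENNReal.le_sub_of_add_le_right ?_ ?_
  · exact ENNReal.mul_ne_top (by simp) hfin.ne
  · rw [← hdB]
    gcongr
    rwa [hdB]

/-- The dual weight for `q'` is the power `(q - 1) / (q' - 1) ≤ 1` of the one for `q`, so Hölder on
the normalised cube compares the two averages and the characteristic does not increase. -/
theorem MemAp.mono {q q' : ℝ} (hq : 1 < q) (hqq' : q ≤ q') {w : EuclideanSpace ℝ (Fin n) → ℝ}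
    (hw : MemAp q w) : MemAp q' w := by
  refine ⟨hw.isWeight, hw.ne_zero, lt_of_le_of_lt ?_ hw.apConst_lt_top⟩
  refine iSup_le fun c => iSup_le fun r => iSup_le fun hr => ?_
  refine le_trans ?_ (cube_average_mul_le_apConst q w c hr)
  gcongr
  have hwm := (aemeasurable_ofReal_weight hw.isWeight)
  have hV0 := (volume_cube_pos c hr).ne'
  have hVt := volume_cube_ne_top c hr.le
  rw [laverage_eq', laverage_eq', Measure.restrict_apply_univ]
  set μ := (volume (cube c r))⁻¹ • volume.restrict (cube c r)
  have hμ1 : μ univ = 1 := by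
    simp [μ, ENNReal.inv_mul_cancel hV0 hVt]
  have ha : 0 ≤ (q - 1) / (q' - 1) := div_nonneg (by linarith) (by linarith)
  have hb : 0 ≤ 1 - (q - 1) / (q' - 1) := by
    rw [sub_nonneg, div_le_one (by linarith)]; linarith
  have hwm' : AEMeasurable (fun x => ENNReal.ofReal (w x)) μ := hwm.restrict.smul_measure _
  have h1 := ENNReal.lintegral_mul_norm_pow_le (μ := μ) (hwm'.pow_const (1 / (1 - q)))
    (aemeasurable_const (b := (1 : ℝ≥0∞))) ha hb (by ring)
  simp only [ENNReal.one_rpow, mul_one, lintegral_const, hμ1] at h1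
  have h2 := ENNReal.rpow_le_rpow h1 (by linarith : 0 ≤ q' - 1)
  rw [← ENNReal.rpow_mul _ _ (q' - 1), div_mul_cancel₀ _ (by linarith)] at h2
  refine le_trans (le_of_eq ?_) h2
  congr 1
  refine lintegral_congr fun x => ?_
  rw [← ENNReal.rpow_mul]
  congr 1
  have : 1 - q ≠ 0 := by linarith
  have : 1 - q' ≠ 0 := by linarith
  have : q' - 1 ≠ 0 := by linarith
  field_simp
  ring

theorem MemAp.div_of_mul_critIndex_lt (hn : 1 ≤ n) {p : ℝ} (hp : (n : ℝ) < p)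
    {w : EuclideanSpace ℝ (Fin n) → ℝ} (hw : MemAp p w) (hc : n * critIndex w < p) :
    MemAp (p / n) w := by
  have hn0 : (0 : ℝ) < n := by exact_mod_cast hn
  have hn1 : (1 : ℝ) ≤ n := by exact_mod_cast hn
  have h1 : critIndex w < p / n := by rwa [lt_div_iff₀ hn0, mul_comm]
  obtain ⟨q, ⟨hq, hqw⟩, hlt⟩ := exists_lt_of_csInf_lt
    (show {q : ℝ | 1 < q ∧ MemAp q w}.Nonempty from ⟨p, by linarith, hw⟩) h1
  exact hqw.mono hq hlt.le

/-! ### Dilated averages and the weak gradient -/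

theorem map_eq_sum_single (L : EuclideanSpace ℝ (Fin n) →L[ℝ] ℝ) (y : EuclideanSpace ℝ (Fin n)) :
    ∑ j, y j * L (EuclideanSpace.single j 1) = L y := by
  conv_rhs => rw [← (EuclideanSpace.basisFun (Fin n) ℝ).sum_repr y]
  simp [map_sum]

theorem hasDerivAt_dilation {ζ : EuclideanSpace ℝ (Fin n) → ℝ} (hζ : Differentiable ℝ ζ)
    (v : EuclideanSpace ℝ (Fin n)) {s : ℝ} (hs : 0 < s) :
    HasDerivAt (fun s : ℝ => (s ^ n)⁻¹ * ζ (s⁻¹ • v))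
      (-((s ^ (n + 1))⁻¹ * (n * ζ (s⁻¹ • v) + fderiv ℝ ζ (s⁻¹ • v) (s⁻¹ • v)))) s := by
  have h1 : HasDerivAt (fun s : ℝ => s⁻¹ • v) ((-(s ^ 2)⁻¹) • v) s :=
    (hasDerivAt_inv hs.ne').smul_const v
  have h2 := (hζ (s⁻¹ • v)).hasFDerivAt.comp_hasDerivAt s h1
  have h3 : HasDerivAt (fun s : ℝ => (s ^ n)⁻¹) (-(n * s ^ (n - 1)) / (s ^ n) ^ 2) s :=
    (hasDerivAt_pow n s).fun_inv (pow_ne_zero _ hs.ne')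
  have h4 := h3.mul h2
  refine h4.congr_deriv ?_
  simp only [Function.comp, map_smul, smul_eq_mul]
  rcases n with _ | m
  · simp
    field_simp
  · simp only [Nat.add_sub_cancel]
    field_simp
    ring

/-- The components of the vector field `s⁻ⁿ y ζ(y)`, `y = s⁻¹ (z - x)`, whose divergence is the
derivative in `s` of `-s⁻ⁿ ζ(y)`. -/
noncomputable def dilationField (ζ : EuclideanSpace ℝ (Fin n) → ℝ) (x : EuclideanSpace ℝ (Fin n))
    (s : ℝ) (j : Fin n) (z : EuclideanSpace ℝ (Fin n)) : ℝ :=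
  (s ^ n)⁻¹ * ((s⁻¹ • (z - x)) j * ζ (s⁻¹ • (z - x)))

theorem contDiff_dilationField {ζ : EuclideanSpace ℝ (Fin n) → ℝ} (hζ : ContDiff ℝ ∞ ζ)
    (x : EuclideanSpace ℝ (Fin n)) (s : ℝ) (j : Fin n) :
    ContDiff ℝ ∞ (dilationField ζ x s j) := by
  have h1 : ContDiff ℝ ∞ fun z : EuclideanSpace ℝ (Fin n) => s⁻¹ • (z - x) := by fun_prop
  have h2 : ContDiff ℝ ∞ fun z : EuclideanSpace ℝ (Fin n) => (s⁻¹ • (z - x)) j :=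
    (EuclideanSpace.proj j : EuclideanSpace ℝ (Fin n) →L[ℝ] ℝ).contDiff.comp h1
  exact contDiff_const.mul (h2.mul (hζ.comp h1))

/-- Against `hasDerivAt_dilation`, the divergence is minus the `s`-derivative of the dilated kernel.
The derivative of an average of `f` in the scale thus becomes a pairing of the weak gradient with
this field. -/
theorem sum_fderiv_dilationField {ζ : EuclideanSpace ℝ (Fin n) → ℝ} (hζ : Differentiable ℝ ζ)
    (x : EuclideanSpace ℝ (Fin n)) {s : ℝ} (hs : 0 < s) (z : EuclideanSpace ℝ (Fin n)) :
    ∑ j, fderiv ℝ (dilationField ζ x s j) z (EuclideanSpace.single j 1) =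
      (s ^ (n + 1))⁻¹ * (n * ζ (s⁻¹ • (z - x)) +
        fderiv ℝ ζ (s⁻¹ • (z - x)) (s⁻¹ • (z - x))) := by
  set y := s⁻¹ • (z - x)
  have hy : HasFDerivAt (fun z : EuclideanSpace ℝ (Fin n) => s⁻¹ • (z - x))
      (s⁻¹ • ContinuousLinearMap.id ℝ (EuclideanSpace ℝ (Fin n))) z :=
    ((hasFDerivAt_id z).sub_const x).const_smul s⁻¹
  have key : ∀ j, fderiv ℝ (dilationField ζ x s j) z (EuclideanSpace.single j 1) =
      (s ^ (n + 1))⁻¹ * (ζ y + y j * fderiv ℝ ζ y (EuclideanSpace.single j 1)) := by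
    intro j
    have h1 := (EuclideanSpace.proj j : EuclideanSpace ℝ (Fin n) →L[ℝ] ℝ).hasFDerivAt.comp z hy
    have h2 := (hζ y).hasFDerivAt.comp z hy
    have h3 := (h1.mul h2).const_mul (s ^ n)⁻¹
    rw [HasFDerivAt.fderiv (f := dilationField ζ x s j) h3]
    simp [y]
    field_simp
    ring
  rw [Finset.sum_congr rfl fun j _ => key j, ← Finset.mul_sum, Finset.sum_add_distrib,
    map_eq_sum_single]
  simp

/-- By convexity: `‖a‖ ≤ r` says that the ball around `x + a` contains `x`, so contracting it
towards `x` stays inside. -/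
theorem mem_closedBall_of_dilation {x a z : EuclideanSpace ℝ (Fin n)} {r s : ℝ} (ha : ‖a‖ ≤ r)
    (hs : 0 < s) (hs1 : s ≤ 1) (hz : s⁻¹ • (z - x) ∈ Metric.closedBall a r) :
    z ∈ Metric.closedBall (x + a) r := by
  rw [mem_closedBall_iff_norm] at hz ⊢
  have h1 : z - (x + a) = s • (s⁻¹ • (z - x) - a) - (1 - s) • a := by
    rw [smul_sub, smul_inv_smul₀ hs.ne', sub_smul, one_smul]; abel
  rw [h1]
  refine (norm_sub_le _ _).trans ?_
  rw [norm_smul, norm_smul, Real.norm_of_nonneg hs.le, Real.norm_of_nonneg (by linarith)]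
  calc s * _ + (1 - s) * _ ≤ s * r + (1 - s) * r := by gcongr
    _ = r := by ring

theorem hasDerivAt_integral_dilation {ζ : EuclideanSpace ℝ (Fin n) → ℝ} (hζ : ContDiff ℝ ∞ ζ)
    (hc : HasCompactSupport ζ) {f : EuclideanSpace ℝ (Fin n) → ℝ} (hf : Integrable f)
    (x : EuclideanSpace ℝ (Fin n)) {s : ℝ} (hs : 0 < s) :
    HasDerivAt (fun s : ℝ => ∫ z, f z * ((s ^ n)⁻¹ * ζ (s⁻¹ • (z - x))))
      (∫ z, f z * -((s ^ (n + 1))⁻¹ * (n * ζ (s⁻¹ • (z - x)) +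
        fderiv ℝ ζ (s⁻¹ • (z - x)) (s⁻¹ • (z - x))))) s := by
  have hdiff : Differentiable ℝ ζ := hζ.differentiable (by simp)
  set D : EuclideanSpace ℝ (Fin n) → ℝ := fun y => n * ζ y + fderiv ℝ ζ y y
  have hDc : Continuous D :=
    (hζ.continuous.const_mul _).add ((hζ.continuous_fderiv (by simp)).clm_apply continuous_id)
  have hDs : HasCompactSupport D := by
    refine HasCompactSupport.intro hc fun y hy => ?_
    have h1 := image_eq_zero_of_notMem_tsupport hy
    have h2 : fderiv ℝ ζ y = 0 :=
      image_eq_zero_of_notMem_tsupport fun h => hy (tsupport_fderiv_subset ℝ h)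
    simp [D, h1, h2]
  obtain ⟨C, hC⟩ := hDc.bounded_above_of_compact_support hDs
  have hC0 : 0 ≤ C := (norm_nonneg _).trans (hC 0)
  obtain ⟨C', hC'⟩ := hζ.continuous.bounded_above_of_compact_support hc
  have hcont : ∀ s : ℝ, Continuous fun z : EuclideanSpace ℝ (Fin n) => s⁻¹ • (z - x) :=
    fun s => by fun_prop
  refine (hasDerivAt_integral_of_dominated_loc_of_deriv_le
    (bound := fun z => ‖f z‖ * (((s / 2) ^ (n + 1))⁻¹ * C))
    (F' := fun s z => f z * -((s ^ (n + 1))⁻¹ * D (s⁻¹ • (z - x)))) (Ioi_mem_nhds (half_lt_self hs))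
    ?_ ?_ ?_ ?_ (hf.norm.mul_const _) ?_).2
  · refine Eventually.of_forall fun t => hf.1.mul ?_
    exact (continuous_const.mul (hζ.continuous.comp (hcont t))).aestronglyMeasurable
  · refine hf.mul_bdd (c := (s ^ n)⁻¹ * C')
      (continuous_const.mul (hζ.continuous.comp (hcont s))).aestronglyMeasurable
      (Eventually.of_forall fun z => ?_)
    rw [norm_mul, Real.norm_of_nonneg (by positivity : 0 ≤ (s ^ n)⁻¹)]
    gcongr
    exact hC' _
  · exact hf.1.mul (continuous_const.mul (hDc.comp (hcont s))).neg.aestronglyMeasurable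
  · refine Eventually.of_forall fun z t ht => ?_
    have ht' : s / 2 < t := ht
    have ht0 : 0 < t := lt_trans (by positivity) ht'
    rw [norm_mul, norm_neg, norm_mul, Real.norm_of_nonneg (by positivity : 0 ≤ (t ^ (n + 1))⁻¹)]
    gcongr
    exact hC _
  · refine Eventually.of_forall fun z t ht => ?_
    have ht' : s / 2 < t := ht
    exact (hasDerivAt_dilation hdiff (z - x) (lt_trans (by positivity) ht')).const_mul (f z)

/-- Averages of `f` against a bump on a ball and on the ball shrunk by half towards one of its points
differ by at most a multiple of the integral of the weak gradient. -/
theorem abs_integral_dilation_half_sub_le {Ω : Set (EuclideanSpace ℝ (Fin n))}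
    {f : EuclideanSpace ℝ (Fin n) → ℝ} {g : EuclideanSpace ℝ (Fin n) → EuclideanSpace ℝ (Fin n)}
    (hg : HasWeakGradient Ω f g) {ζ : EuclideanSpace ℝ (Fin n) → ℝ} (hζ : ContDiff ℝ ∞ ζ)
    {x a : EuclideanSpace ℝ (Fin n)} {r Λ : ℝ} (ha : ‖a‖ ≤ r)
    (hsupp : Function.support ζ ⊆ Metric.closedBall a r) (hΛ : ∀ y, |ζ y| ≤ Λ)
    (hΩ : Metric.closedBall (x + a) r ⊆ Ω) :
    |(∫ z, f z * (((1 / 2 : ℝ) ^ n)⁻¹ * ζ ((1 / 2 : ℝ)⁻¹ • (z - x)))) - ∫ z, f z * ζ (z - x)| ≤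
      n * (2 ^ n * r * Λ) * ∫ z in Metric.closedBall (x + a) r, ‖g z‖ := by
  have hr : 0 ≤ r := (norm_nonneg a).trans ha
  have hΛ0 : 0 ≤ Λ := (abs_nonneg _).trans (hΛ 0)
  set B := Metric.closedBall (x + a) r
  have hBm : MeasurableSet B := measurableSet_closedBall
  have hBc : IsCompact B := isCompact_closedBall _ _
  have hdiff : Differentiable ℝ ζ := hζ.differentiable (by simp)
  have hc : HasCompactSupport ζ :=
    HasCompactSupport.of_support_subset_isCompact (isCompact_closedBall a r) hsupp
  have hf0 : Integrable (B.indicator f) :=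
    (hg.locallyIntegrableOn.integrableOn_compact_subset hΩ hBc).integrable_indicator hBm
  have hg0 : Integrable (B.indicator g) :=
    (hg.locallyIntegrableOn_grad.integrableOn_compact_subset hΩ hBc).integrable_indicator hBm
  have hz : ∀ s : ℝ, 0 < s → s ≤ 1 → ∀ z ∉ B, ζ (s⁻¹ • (z - x)) = 0 := by
    intro s hs hs1 z hzB
    by_contra hne
    exact hzB (mem_closedBall_of_dilation ha hs hs1 (hsupp hne))
  -- Cutting `f` off outside `B` makes it integrable without changing the averages, whose kernels
  -- vanish off `B` for `0 < s ≤ 1`.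
  set F : ℝ → ℝ := fun s => ∫ z, B.indicator f z * ((s ^ n)⁻¹ * ζ (s⁻¹ • (z - x)))
  have hF : ∀ s : ℝ, 0 < s → s ≤ 1 → F s = ∫ z, f z * ((s ^ n)⁻¹ * ζ (s⁻¹ • (z - x))) := by
    intro s hs hs1
    refine integral_congr_ae (Eventually.of_forall fun z => ?_)
    by_cases hzB : z ∈ B
    · simp [hzB]
    · simp [hzB, hz s hs hs1 z hzB]
  set F' : ℝ → ℝ := fun s => ∫ z, B.indicator f z * -((s ^ (n + 1))⁻¹ *
    (n * ζ (s⁻¹ • (z - x)) + fderiv ℝ ζ (s⁻¹ • (z - x)) (s⁻¹ • (z - x))))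
  have hder : ∀ s : ℝ, 0 < s → HasDerivAt F (F' s) s := fun s hs =>
    hasDerivAt_integral_dilation hζ hc hf0 x hs
  -- `n` counts the coordinates, `2 ^ n` bounds `s⁻ⁿ`, and `2 * r` bounds the points of a ball of
  -- radius `r` whose center has norm at most `r`. The interval of length `1/2` later turns `2 * r`
  -- into `r`.
  have hbound : ∀ s ∈ Ico (1 / 2 : ℝ) 1, ‖F' s‖ ≤ n * (2 ^ n * (2 * r) * Λ) * ∫ z in B, ‖g z‖ := by
    intro s hs
    have hs0 : 0 < s := lt_of_lt_of_le (by norm_num) hs.1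
    set φ : Fin n → EuclideanSpace ℝ (Fin n) → ℝ := dilationField ζ x s
    have hφ0 : ∀ j, ∀ z ∉ B, φ j z = 0 := fun j z hzB => by
      simp [φ, dilationField, hz s hs0 hs.2.le z hzB]
    have hφsupp : ∀ j, tsupport (φ j) ⊆ B := fun j =>
      closure_minimal (fun z hzs => by_contra fun h => hzs (hφ0 j z h)) Metric.isClosed_closedBall
    have hφcs : ∀ j, HasCompactSupport (φ j) := fun j =>
      HasCompactSupport.of_support_subset_isCompact hBc ((subset_tsupport _).trans (hφsupp j))
    have hφ : ∀ j, ContDiff ℝ ∞ (φ j) := fun j => contDiff_dilationField hζ x s j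
    have hdφ0 : ∀ j, ∀ z ∉ B, fderiv ℝ (φ j) z = 0 := fun j z hzB =>
      image_eq_zero_of_notMem_tsupport fun h => hzB (hφsupp j (tsupport_fderiv_subset ℝ h))
    have hdc : ∀ j, Continuous fun z => fderiv ℝ (φ j) z (EuclideanSpace.single j 1) := fun j =>
      ((hφ j).continuous_fderiv (by simp)).clm_apply continuous_const
    have hdcs : ∀ j, HasCompactSupport fun z => fderiv ℝ (φ j) z (EuclideanSpace.single j 1) :=
      fun j => HasCompactSupport.intro hBc fun z hzB => by simp [hdφ0 j z hzB]
    have hi1 : ∀ j, Integrable fun z => B.indicator f z *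
        fderiv ℝ (φ j) z (EuclideanSpace.single j 1) := fun j => by
      obtain ⟨C, hC⟩ := (hdc j).bounded_above_of_compact_support (hdcs j)
      exact hf0.mul_bdd (c := C) (hdc j).aestronglyMeasurable (Eventually.of_forall hC)
    have hgj : ∀ j, Integrable fun z => B.indicator g z j := fun j =>
      (EuclideanSpace.proj j : EuclideanSpace ℝ (Fin n) →L[ℝ] ℝ).integrable_comp hg0
    have hi2 : ∀ j, Integrable fun z => B.indicator g z j * φ j z := fun j => by
      obtain ⟨C, hC⟩ := (hφ j).continuous.bounded_above_of_compact_support (hφcs j)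
      exact (hgj j).mul_bdd (c := C) (hφ j).continuous.aestronglyMeasurable
        (Eventually.of_forall hC)
    have e1 : F' s = -∑ j, ∫ z, B.indicator f z *
        fderiv ℝ (φ j) z (EuclideanSpace.single j 1) := by
      rw [← integral_finsetSum _ fun j _ => hi1 j, ← integral_neg]
      refine integral_congr_ae (Eventually.of_forall fun z => ?_)
      simp only [φ]
      rw [← Finset.mul_sum, sum_fderiv_dilationField hdiff x hs0 z, mul_neg]
    have e2 : ∀ j, ∫ z, B.indicator f z * fderiv ℝ (φ j) z (EuclideanSpace.single j 1) =
        -∫ z, B.indicator g z j * φ j z := by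
      intro j
      have h1 := hg.integral_eq (φ j) (hφ j) (hφcs j) ((hφsupp j).trans hΩ) j
      rw [setIntegral_eq_integral_of_forall_compl_eq_zero fun z hzΩ => by
          rw [hdφ0 j z fun h => hzΩ (hΩ h)]; simp,
        setIntegral_eq_integral_of_forall_compl_eq_zero fun z hzΩ => by
          rw [hφ0 j z fun h => hzΩ (hΩ h), mul_zero]] at h1
      have h2 : ∀ z, B.indicator f z * fderiv ℝ (φ j) z (EuclideanSpace.single j 1) =
          f z * fderiv ℝ (φ j) z (EuclideanSpace.single j 1) := fun z => by
        by_cases hzB : z ∈ B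
        · simp [hzB]
        · simp [hzB, hdφ0 j z hzB]
      have h3 : ∀ z, B.indicator g z j * φ j z = g z j * φ j z := fun z => by
        by_cases hzB : z ∈ B
        · simp [hzB]
        · simp [hzB, hφ0 j z hzB]
      simp only [h2, h3, h1]
    have e3 : F' s = ∑ j, ∫ z, B.indicator g z j * φ j z := by
      rw [e1, Finset.sum_congr rfl fun j _ => e2 j, Finset.sum_neg_distrib, neg_neg]
    rw [e3]
    have hφle : ∀ j z, ‖φ j z‖ ≤ 2 ^ n * (2 * r) * Λ := by
      intro j z
      by_cases hne : ζ (s⁻¹ • (z - x)) = 0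
      · simp only [φ, dilationField, hne, mul_zero, norm_zero]; positivity
      · have h1 := hsupp hne
        rw [mem_closedBall_iff_norm] at h1
        have h2 : ‖s⁻¹ • (z - x)‖ ≤ 2 * r := by
          have := norm_add_le (s⁻¹ • (z - x) - a) a
          rw [sub_add_cancel] at this
          linarith
        simp only [φ, dilationField]
        rw [norm_mul, norm_mul, mul_assoc (2 ^ n)]
        gcongr
        · rw [norm_inv, norm_pow, Real.norm_of_nonneg hs0.le, ← inv_pow]
          gcongr
          rw [inv_le_comm₀ hs0 (by norm_num)]
          linarith [hs.1]
        · exact (PiLp.norm_apply_le _ j).trans h2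
        · exact hΛ _
    calc ‖∑ j, ∫ z, B.indicator g z j * φ j z‖
        ≤ ∑ j : Fin n, (2 ^ n * (2 * r) * Λ) * ∫ z in B, ‖g z‖ := by
          refine (norm_sum_le _ _).trans (Finset.sum_le_sum fun j _ => ?_)
          rw [← integral_indicator hBm, ← integral_const_mul]
          refine norm_integral_le_of_norm_le ?_ (Eventually.of_forall fun z => ?_)
          · refine Integrable.const_mul ?_ _
            simpa only [norm_indicator_eq_indicator_norm] using hg0.norm
          · rw [norm_mul, mul_comm, ← norm_indicator_eq_indicator_norm]
            gcongr
            · exact hφle j z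
            · exact PiLp.norm_apply_le _ j
      _ = _ := by simp; ring
  have hmvt := norm_image_sub_le_of_norm_deriv_le_segment' (f := F) (f' := F') (a := 1 / 2) (b := 1)
    (fun s hs => (hder s (lt_of_lt_of_le (by norm_num) hs.1)).hasDerivWithinAt) hbound 1
    (right_mem_Icc.2 (by norm_num))
  rw [hF 1 one_pos le_rfl, hF (1 / 2) (by norm_num) (by norm_num)] at hmvt
  rw [abs_sub_comm, ← Real.norm_eq_abs]
  simp only [one_pow, inv_one, one_mul, one_smul] at hmvt
  refine hmvt.trans (le_of_eq ?_)
  ring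

/-! ### Smooth averages and their limits almost everywhere -/

/-- A smooth probability density supported in the unit ball. -/
noncomputable def unitBump (n : ℕ) : EuclideanSpace ℝ (Fin n) → ℝ :=
  (⟨1 / 2, 1, by norm_num, by norm_num⟩ : ContDiffBump (0 : EuclideanSpace ℝ (Fin n))).normed volume

theorem contDiff_unitBump : ContDiff ℝ ∞ (unitBump n) := ContDiffBump.contDiff_normed _

theorem integral_unitBump : ∫ y, unitBump n y = 1 := ContDiffBump.integral_normed _

theorem support_unitBump : Function.support (unitBump n) = Metric.ball 0 1 :=
  ContDiffBump.support_normed_eq _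

theorem exists_abs_unitBump_le (n : ℕ) : ∃ Λ : ℝ, 0 ≤ Λ ∧ ∀ y, |unitBump n y| ≤ Λ := by
  obtain ⟨C, hC⟩ := (contDiff_unitBump (n := n)).continuous.bounded_above_of_compact_support
    (ContDiffBump.hasCompactSupport_normed _)
  exact ⟨C, (norm_nonneg _).trans (hC 0), hC⟩

/-- The smooth average of `f` over the ball with center `c` and radius `r`. -/
noncomputable def bumpAvg (f : EuclideanSpace ℝ (Fin n) → ℝ) (c : EuclideanSpace ℝ (Fin n))
    (r : ℝ) : ℝ :=
  ∫ z, f z * ((r ^ n)⁻¹ * unitBump n (r⁻¹ • (z - c)))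

theorem support_unitBump_comp_subset (c : EuclideanSpace ℝ (Fin n)) {r : ℝ} (hr : 0 < r) :
    (Function.support fun z => (r ^ n)⁻¹ * unitBump n (r⁻¹ • (z - c))) ⊆
      Metric.closedBall c r := by
  intro z hz
  have h1 : r⁻¹ • (z - c) ∈ Function.support (unitBump n) := right_ne_zero_of_mul hz
  rw [support_unitBump, mem_ball_zero_iff, norm_smul, norm_inv, Real.norm_of_nonneg hr.le,
    inv_mul_lt_iff₀ hr, mul_one] at h1
  exact mem_closedBall_iff_norm.2 h1.le

theorem integral_unitBump_comp (c : EuclideanSpace ℝ (Fin n)) {r : ℝ} (hr : 0 < r) :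
    ∫ z, (r ^ n)⁻¹ * unitBump n (r⁻¹ • (z - c)) = 1 := by
  rw [integral_const_mul, integral_sub_right_eq_self (fun z => unitBump n (r⁻¹ • z)) c,
    Measure.integral_comp_inv_smul, integral_unitBump, finrank_euclideanSpace_fin,
    abs_of_pos (by positivity)]
  simp [hr.ne']

/-- The kernel has integral `1`, so `t` can be moved under the integral. This reduces convergence of
smooth averages to the Lebesgue point property. -/
theorem abs_bumpAvg_sub_le {Λ : ℝ} (hΛ : ∀ y, |unitBump n y| ≤ Λ)
    {f : EuclideanSpace ℝ (Fin n) → ℝ} {c : EuclideanSpace ℝ (Fin n)} {r : ℝ} (hr : 0 < r)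
    (hf : IntegrableOn f (Metric.closedBall c r)) (t : ℝ) :
    |bumpAvg f c r - t| ≤ Λ * volume.real (Metric.ball (0 : EuclideanSpace ℝ (Fin n)) 1) *
      ⨍ z in Metric.closedBall c r, ‖f z - t‖ := by
  set B := Metric.closedBall c r
  have hBm : MeasurableSet B := measurableSet_closedBall
  set ψ : EuclideanSpace ℝ (Fin n) → ℝ := fun z => (r ^ n)⁻¹ * unitBump n (r⁻¹ • (z - c))
  have hψc : Continuous ψ := continuous_const.mul (contDiff_unitBump.continuous.comp (by fun_prop))
  have hψs : Function.support ψ ⊆ B := support_unitBump_comp_subset c hr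
  have hψb : ∀ z, ‖ψ z‖ ≤ (r ^ n)⁻¹ * Λ := fun z => by
    rw [norm_mul, Real.norm_of_nonneg (by positivity : 0 ≤ (r ^ n)⁻¹)]
    gcongr
    exact hΛ _
  have hψi : Integrable ψ := hψc.integrable_of_hasCompactSupport
    (HasCompactSupport.of_support_subset_isCompact (isCompact_closedBall c r) hψs)
  have hfψ : Integrable fun z => f z * ψ z := by
    have h1 := (hf.integrable_indicator hBm).mul_bdd (c := (r ^ n)⁻¹ * Λ) hψc.aestronglyMeasurable
      (Eventually.of_forall hψb)
    refine h1.congr (Eventually.of_forall fun z => ?_)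
    by_cases hz : z ∈ B
    · simp [hz]
    · simp [hz, Function.notMem_support.1 fun h => hz (hψs h)]
  have e1 : bumpAvg f c r - t = ∫ z, (f z - t) * ψ z := by
    simp only [sub_mul]
    rw [integral_sub hfψ (hψi.const_mul t), integral_const_mul, integral_unitBump_comp c hr,
      mul_one]
    rfl
  have hsub : IntegrableOn (fun z => ‖f z - t‖) B :=
    (hf.sub (integrableOn_const measure_closedBall_lt_top.ne)).norm
  have hvol : volume.real B =
      r ^ n * volume.real (Metric.ball (0 : EuclideanSpace ℝ (Fin n)) 1) := by
    rw [measureReal_def, Measure.addHaar_closedBall _ _ hr.le, finrank_euclideanSpace_fin,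
      ENNReal.toReal_mul, ENNReal.toReal_ofReal (by positivity), measureReal_def]
  rw [e1, ← Real.norm_eq_abs]
  calc ‖∫ z, (f z - t) * ψ z‖ ≤ ∫ z, B.indicator (fun z => ‖f z - t‖ * ((r ^ n)⁻¹ * Λ)) z := by
        refine norm_integral_le_of_norm_le (IntegrableOn.integrable_indicator
          (Integrable.mul_const hsub _) hBm) (Eventually.of_forall fun z => ?_)
        by_cases hz : z ∈ B
        · rw [indicator_of_mem hz, norm_mul]
          gcongr
          exact hψb z
        · simp [hz, Function.notMem_support.1 fun h => hz (hψs h)]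
    _ = _ := by
        rw [integral_indicator hBm, integral_mul_const, setAverage_eq, smul_eq_mul, hvol]
        have : 0 < volume.real (Metric.ball (0 : EuclideanSpace ℝ (Fin n)) 1) :=
          ENNReal.toReal_pos (Metric.measure_ball_pos volume _ one_pos).ne' measure_ball_lt_top.ne
        field_simp

/-- The smooth averages of `f` over balls shrinking to `x` by homotheties centered at `x`
converge to `f x`. -/
def IsAvgPoint (f : EuclideanSpace ℝ (Fin n) → ℝ) (x : EuclideanSpace ℝ (Fin n)) : Prop :=
  ∀ (c : EuclideanSpace ℝ (Fin n)) (r : ℝ), 0 < r → x ∈ Metric.closedBall c r →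
    Tendsto (fun k : ℕ => bumpAvg f (x + (1 / 2 : ℝ) ^ k • (c - x)) ((1 / 2 : ℝ) ^ k * r)) atTop
      (𝓝 (f x))

theorem mem_closedBall_homothety {x c : EuclideanSpace ℝ (Fin n)} {r : ℝ}
    (hx : x ∈ Metric.closedBall c r) (k : ℕ) :
    x ∈ Metric.closedBall (x + (1 / 2 : ℝ) ^ k • (c - x)) ((1 / 2 : ℝ) ^ k * r) := by
  rw [Metric.mem_closedBall', dist_eq_norm] at *
  rw [add_sub_cancel_left, norm_smul, Real.norm_of_nonneg (by positivity)]
  gcongr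

/-- Lebesgue differentiation along balls that contain `x` without being centered at it. The claim is
local, so `f` may be cut off to a closed ball inside `Ω`. -/
theorem ae_isAvgPoint {Ω : Set (EuclideanSpace ℝ (Fin n))} (hΩ : IsOpen Ω)
    {f : EuclideanSpace ℝ (Fin n) → ℝ} (hf : LocallyIntegrableOn f Ω) :
    ∀ᵐ x ∂volume.restrict Ω, IsAvgPoint f x := by
  obtain ⟨Λ, hΛ0, hΛ⟩ := exists_abs_unitBump_le n
  rw [ae_restrict_iff' hΩ.measurableSet, ae_iff]
  refine measure_null_of_locally_null _ fun x₀ hx₀ => ?_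
  have hx₀Ω : x₀ ∈ Ω := by
    by_contra h
    exact hx₀ fun h' => absurd h' h
  obtain ⟨ρ, hρ, hρΩ⟩ := Metric.nhds_basis_closedBall.mem_iff.1 (hΩ.mem_nhds hx₀Ω)
  set K := Metric.closedBall x₀ ρ
  have hfK : IntegrableOn f K := hf.integrableOn_compact_subset hρΩ (isCompact_closedBall _ _)
  have hfi : Integrable (K.indicator f) := hfK.integrable_indicator measurableSet_closedBall
  -- The parameter `1` allows exactly the balls whose center is within one radius of the point.
  have hae := IsUnifLocDoublingMeasure.ae_tendsto_average_norm_sub volume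
    hfi.locallyIntegrable 1
  refine ⟨{x | ¬(x ∈ Ω → IsAvgPoint f x)} ∩ Metric.ball x₀ ρ,
    inter_mem_nhdsWithin _ (Metric.ball_mem_nhds _ hρ), ?_⟩
  refine measure_mono_null ?_ (ae_iff.1 hae)
  rintro x ⟨hx, hxρ⟩ hlim
  apply hx
  intro _ c r hr hxc
  have h0 : Tendsto (fun k : ℕ => (1 / 2 : ℝ) ^ k) atTop (𝓝 0) :=
    tendsto_pow_atTop_nhds_zero_of_lt_one (by norm_num) (by norm_num)
  have hr0 : Tendsto (fun k : ℕ => (1 / 2 : ℝ) ^ k * r) atTop (𝓝[>] 0) := by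
    refine tendsto_nhdsWithin_iff.2 ⟨by simpa using h0.mul_const r, Eventually.of_forall fun k => ?_⟩
    exact mul_pos (by positivity) hr
  have h1 := hlim (fun k : ℕ => x + (1 / 2 : ℝ) ^ k • (c - x)) _ hr0
    (Eventually.of_forall fun k => by rw [one_mul]; exact mem_closedBall_homothety hxc k)
  have h1' := h1.const_mul (Λ * volume.real (Metric.ball (0 : EuclideanSpace ℝ (Fin n)) 1))
  rw [mul_zero] at h1'
  have hKx : K.indicator f x = f x := indicator_of_mem (Metric.ball_subset_closedBall hxρ) f
  have hsub : ∀ᶠ k : ℕ in atTop,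
      Metric.closedBall (x + (1 / 2 : ℝ) ^ k • (c - x)) ((1 / 2 : ℝ) ^ k * r) ⊆ K := by
    have h2 : Tendsto (fun k : ℕ => 2 * ((1 / 2 : ℝ) ^ k * r)) atTop (𝓝 0) := by
      simpa using (h0.mul_const r).const_mul 2
    filter_upwards [h2.eventually_lt_const (show 0 < ρ - dist x x₀ by
      rw [sub_pos]; exact hxρ)] with k hk z hz
    have h3 := mem_closedBall_homothety hxc k
    rw [Metric.mem_closedBall] at *
    have h4 := dist_triangle_right z x (x + (1 / 2 : ℝ) ^ k • (c - x))
    have h5 := dist_triangle z x x₀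
    linarith
  rw [tendsto_iff_norm_sub_tendsto_zero]
  refine squeeze_zero' (Eventually.of_forall fun k => norm_nonneg _) ?_
    h1'
  filter_upwards [hsub] with k hk
  refine (abs_bumpAvg_sub_le hΛ (mul_pos (by positivity) hr) (hfK.mono_set hk) _).trans ?_
  have hcongr := setAverage_congr_fun (μ := volume) (f := fun z => ‖f z - f x‖)
    (g := fun z => ‖K.indicator f z - K.indicator f x‖)
    (measurableSet_closedBall (x := x + (1 / 2 : ℝ) ^ k • (c - x)) (ε := (1 / 2 : ℝ) ^ k * r))
    (Eventually.of_forall fun z hz => by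
      simp only [indicator_of_mem (hk hz), hKx])
  exact le_of_eq (congrArg (fun t => _ * t) hcongr)

/-! ### Morrey's estimate with weights -/

/-- Hölder with three factors, `|g| w^(1/p)`, `w^(-1/p)` and `1`. The exponent of the constant is
fixed at `1 - 1/n` so that the volume cancels `r ^ (1 - n)`; what remains for the weight is the dual
exponent of `A_{p/n}`. -/
theorem lintegral_enorm_le_weighted {p : ℝ} (hn : 1 ≤ n) (hp : (n : ℝ) < p)
    {w : EuclideanSpace ℝ (Fin n) → ℝ} (hm : IsWeight w) (hw : ∀ᵐ x, 0 < w x)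
    {B : Set (EuclideanSpace ℝ (Fin n))} {F : Type*} [NormedAddCommGroup F]
    {g : EuclideanSpace ℝ (Fin n) → F} (hg : AEStronglyMeasurable g (volume.restrict B)) :
    ∫⁻ z in B, ‖g z‖ₑ ≤ (∫⁻ z in B, ‖g z‖ₑ ^ p * ENNReal.ofReal (w z)) ^ (1 / p) *
      dualMass (p / n) w B ^ ((p / n - 1) / p) * volume B ^ (1 - 1 / (n : ℝ)) := by
  have hn0 : (0 : ℝ) < n := by exact_mod_cast hn
  have hn1 : (1 : ℝ) ≤ n := by exact_mod_cast hn
  have hp0 : 0 < p := hn0.trans hp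
  have hwm := (aemeasurable_ofReal_weight hm).restrict (s := B)
  have hq : 0 < p / n - 1 := by rw [sub_pos, lt_div_iff₀ hn0]; linarith
  have h := ENNReal.lintegral_prod_norm_pow_le (μ := volume.restrict B) (Finset.univ : Finset (Fin 3))
    (f := ![fun z => ‖g z‖ₑ ^ p * ENNReal.ofReal (w z),
      fun z => ENNReal.ofReal (w z) ^ (1 / (1 - p / n)), fun _ => 1])
    (p := ![1 / p, (p / n - 1) / p, 1 - 1 / (n : ℝ)])
    (by
      intro i _
      fin_cases i
      · exact (hg.enorm.pow_const _).mul hwm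
      · exact hwm.pow_const _
      · exact aemeasurable_const)
    (by
      simp [Fin.sum_univ_three]
      field_simp
      ring)
    (by
      intro i _
      fin_cases i
      · exact (by positivity : 0 ≤ 1 / p)
      · exact (by positivity : 0 ≤ (p / n - 1) / p)
      · exact sub_nonneg.2 ((div_le_one hn0).2 hn1))
  simp only [Fin.prod_univ_three, Matrix.cons_val_zero, Matrix.cons_val_one, Matrix.cons_val,
    ENNReal.one_rpow, mul_one, lintegral_const, one_mul, Measure.restrict_apply_univ] at h
  refine le_trans (le_of_eq (lintegral_congr_ae (ae_restrict_of_ae (hw.mono fun z hz => ?_)))) h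
  have h0 := (ENNReal.ofReal_pos.2 hz).ne'
  dsimp only
  rw [ENNReal.mul_rpow_of_nonneg _ _ (by positivity), ← ENNReal.rpow_mul, ← ENNReal.rpow_mul,
    mul_assoc, ← ENNReal.rpow_add _ _ h0 ENNReal.ofReal_ne_top, mul_one_div_cancel hp0.ne',
    ENNReal.rpow_one]
  have : 1 / p + 1 / (1 - p / n) * ((p / n - 1) / p) = 0 := by
    have : 1 - p / n ≠ 0 := by linarith
    rw [show p / n - 1 = -(1 - p / n) by ring]
    generalize 1 - p / n = t at *
    field_simp
    ring
  rw [this, ENNReal.rpow_zero, mul_one]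

theorem closedBall_homothety_subset {x c : EuclideanSpace ℝ (Fin n)} {r : ℝ}
    (hx : x ∈ Metric.closedBall c r) :
    Metric.closedBall (x + (1 / 2 : ℝ) • (c - x)) (r / 2) ⊆ Metric.closedBall c r := by
  refine Metric.closedBall_subset_closedBall' ?_
  rw [Metric.mem_closedBall', dist_eq_norm] at hx
  rw [dist_eq_norm, show x + (1 / 2 : ℝ) • (c - x) - c = -((1 / 2 : ℝ) • (c - x)) by module,
    norm_neg, norm_smul, Real.norm_of_nonneg (by norm_num)]
  linarith

theorem edist_bumpAvg_half_le {Λ : ℝ} (hΛ0 : 0 ≤ Λ) (hΛ : ∀ y, |unitBump n y| ≤ Λ)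
    {Ω : Set (EuclideanSpace ℝ (Fin n))} {f : EuclideanSpace ℝ (Fin n) → ℝ}
    {g : EuclideanSpace ℝ (Fin n) → EuclideanSpace ℝ (Fin n)} (hg : HasWeakGradient Ω f g)
    {x c : EuclideanSpace ℝ (Fin n)} {r : ℝ} (hr : 0 < r) (hx : x ∈ Metric.closedBall c r)
    (hΩ : Metric.closedBall c r ⊆ Ω) :
    edist (bumpAvg f c r) (bumpAvg f (x + (1 / 2 : ℝ) • (c - x)) (r / 2)) ≤
      ENNReal.ofReal (n * 2 ^ n * Λ * (r * (r ^ n)⁻¹)) *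
        ∫⁻ z in Metric.closedBall c r, ‖g z‖ₑ := by
  -- The kernel of `bumpAvg f c r` in coordinates centered at `x`; dilating it by `1/2` gives the
  -- kernel of the half-sized ball.
  set ζ : EuclideanSpace ℝ (Fin n) → ℝ := fun y => (r ^ n)⁻¹ * unitBump n (r⁻¹ • (y - (c - x)))
  have hζ : ContDiff ℝ ∞ ζ := contDiff_const.mul (contDiff_unitBump.comp (by fun_prop))
  have ha : ‖c - x‖ ≤ r := by rwa [Metric.mem_closedBall', dist_eq_norm] at hx
  have hb : ∀ y, |ζ y| ≤ (r ^ n)⁻¹ * Λ := fun y => by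
    rw [abs_mul, abs_of_nonneg (by positivity : 0 ≤ (r ^ n)⁻¹)]
    gcongr
    exact hΛ _
  have key := abs_integral_dilation_half_sub_le hg hζ (x := x) ha
    (support_unitBump_comp_subset (c - x) hr) hb (by rwa [add_sub_cancel])
  rw [add_sub_cancel] at key
  have e1 : bumpAvg f c r = ∫ z, f z * ζ (z - x) := by
    simp only [bumpAvg, ζ, sub_sub_sub_cancel_right]
  have e2 : bumpAvg f (x + (1 / 2 : ℝ) • (c - x)) (r / 2) =
      ∫ z, f z * (((1 / 2 : ℝ) ^ n)⁻¹ * ζ ((1 / 2 : ℝ)⁻¹ • (z - x))) := by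
    simp only [bumpAvg, ζ]
    refine integral_congr_ae (Eventually.of_forall fun z => ?_)
    dsimp only
    rw [← mul_assoc ((1 / 2 : ℝ) ^ n)⁻¹, ← mul_inv, ← mul_pow]
    have h1 : (r / 2)⁻¹ • (z - (x + (1 / 2 : ℝ) • (c - x))) =
        r⁻¹ • ((1 / 2 : ℝ)⁻¹ • (z - x) - (c - x)) := by
      rw [show (r / 2)⁻¹ = r⁻¹ * 2 by field_simp]
      module
    rw [h1]
    ring_nf
  have hint : IntegrableOn g (Metric.closedBall c r) :=
    hg.locallyIntegrableOn_grad.integrableOn_compact_subset hΩ (isCompact_closedBall _ _)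
  rw [edist_comm, edist_dist, Real.dist_eq, e1, e2]
  refine (ENNReal.ofReal_le_ofReal key).trans (le_of_eq ?_)
  rw [← ofReal_integral_norm_eq_lintegral_enorm hint, ← ENNReal.ofReal_mul (by positivity)]
  ring_nf

theorem ofReal_mul_volume_closedBall_rpow (hn : 1 ≤ n) (c : EuclideanSpace ℝ (Fin n)) {r : ℝ}
    (hr : 0 < r) : ENNReal.ofReal (r * (r ^ n)⁻¹) *
      volume (Metric.closedBall c r) ^ (1 - 1 / (n : ℝ)) =
      volume (Metric.ball (0 : EuclideanSpace ℝ (Fin n)) 1) ^ (1 - 1 / (n : ℝ)) := by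
  have hn0 : (0 : ℝ) < n := by exact_mod_cast hn
  have he : 0 ≤ 1 - 1 / (n : ℝ) := by
    rw [sub_nonneg, div_le_one hn0]; exact_mod_cast hn
  rw [Measure.addHaar_closedBall _ _ hr.le, finrank_euclideanSpace_fin,
    ENNReal.mul_rpow_of_nonneg _ _ he, ENNReal.ofReal_rpow_of_nonneg (by positivity) he, ← mul_assoc,
    ← ENNReal.ofReal_mul (by positivity)]
  have : r * (r ^ n)⁻¹ * (r ^ n) ^ (1 - 1 / (n : ℝ)) = 1 := by
    rw [Real.rpow_sub (by positivity), Real.rpow_one, ← Real.rpow_natCast r n, ← Real.rpow_mul hr.le,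
      mul_one_div_cancel hn0.ne', Real.rpow_one]
    have := (Real.rpow_pos_of_pos hr (n : ℝ)).ne'
    field_simp
  rw [this, ENNReal.ofReal_one, one_mul]

theorem two_mul_volume_closedBall_half_le (hn : 1 ≤ n) (c c' : EuclideanSpace ℝ (Fin n)) {r : ℝ}
    (hr : 0 < r) :
    2 * volume (Metric.closedBall c' (r / 2)) ≤ volume (Metric.closedBall c r) := by
  rw [Measure.addHaar_closedBall _ _ hr.le, Measure.addHaar_closedBall _ _ (half_pos hr).le,
    finrank_euclideanSpace_fin, ← mul_assoc]
  gcongr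
  rw [show (2 : ℝ≥0∞) = ENNReal.ofReal 2 by norm_num, ← ENNReal.ofReal_mul (by norm_num)]
  refine ENNReal.ofReal_le_ofReal ?_
  rw [div_pow, mul_div_assoc', div_le_iff₀ (by positivity), mul_comm]
  gcongr
  exact le_self_pow₀ (by norm_num) (by omega)

/-- The contribution of a set to the `p`-th power of the norm of a function in `L^p(w)`. -/
noncomputable def weightedEnergy {F : Type*} [NormedAddCommGroup F] (p : ℝ)
    (w : EuclideanSpace ℝ (Fin n) → ℝ) (g : EuclideanSpace ℝ (Fin n) → F)
    (E : Set (EuclideanSpace ℝ (Fin n))) : ℝ≥0∞ :=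
  ∫⁻ z in E, ‖g z‖ₑ ^ p * ENNReal.ofReal (w z)

/-- Halving the radius at least halves the volume, as `n ≥ 1`, so each step costs one factor `θ`. -/
theorem dualMass_closedBall_homothety_le {q : ℝ} (hn : 1 ≤ n)
    {w : EuclideanSpace ℝ (Fin n) → ℝ} {θ : ℝ≥0∞}
    (hθ : ∀ (c : EuclideanSpace ℝ (Fin n)) (r : ℝ), 0 < r → ∀ B' ⊆ Metric.closedBall c r,
        MeasurableSet B' → 2 * volume B' ≤ volume (Metric.closedBall c r) →
          dualMass q w B' ≤ θ * dualMass q w (Metric.closedBall c r))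
    {x c : EuclideanSpace ℝ (Fin n)} {r : ℝ} (hr : 0 < r) (hx : x ∈ Metric.closedBall c r) (k : ℕ) :
    Metric.closedBall (x + (1 / 2 : ℝ) ^ k • (c - x)) ((1 / 2 : ℝ) ^ k * r) ⊆
        Metric.closedBall c r ∧
      dualMass q w (Metric.closedBall (x + (1 / 2 : ℝ) ^ k • (c - x)) ((1 / 2 : ℝ) ^ k * r)) ≤
        θ ^ k * dualMass q w (Metric.closedBall c r) := by
  induction k with
  | zero => simp
  | succ k ih =>
    have h1 := mem_closedBall_homothety hx k
    have hr' : 0 < (1 / 2 : ℝ) ^ k * r := by positivity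
    have e1 : x + (1 / 2 : ℝ) ^ (k + 1) • (c - x) =
        x + (1 / 2 : ℝ) • (x + (1 / 2 : ℝ) ^ k • (c - x) - x) := by
      rw [pow_succ]; module
    have e2 : (1 / 2 : ℝ) ^ (k + 1) * r = (1 / 2 : ℝ) ^ k * r / 2 := by ring
    have h2 := closedBall_homothety_subset h1
    rw [e1, e2]
    refine ⟨h2.trans ih.1, ?_⟩
    refine (hθ _ _ hr' _ h2 measurableSet_closedBall
      (two_mul_volume_closedBall_half_le hn _ _ hr')).trans ?_
    rw [pow_succ', mul_assoc]
    gcongr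
    exact ih.2

/-- Morrey's estimate in weighted form. -/
theorem exists_edist_bumpAvg_le (hn : 1 ≤ n) {p : ℝ} (hp : (n : ℝ) < p) (M : ℝ≥0) :
    ∃ C : ℝ≥0∞, C ≠ ⊤ ∧ ∀ w : EuclideanSpace ℝ (Fin n) → ℝ, MemAp (p / n) w →
      apConst (p / n) w ≤ M → ∀ (Ω : Set (EuclideanSpace ℝ (Fin n)))
        (f : EuclideanSpace ℝ (Fin n) → ℝ)
        (g : EuclideanSpace ℝ (Fin n) → EuclideanSpace ℝ (Fin n)), HasWeakGradient Ω f g →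
        ∀ (c : EuclideanSpace ℝ (Fin n)) (r : ℝ), 0 < r → Metric.closedBall c r ⊆ Ω →
          ∀ x ∈ Metric.closedBall c r, IsAvgPoint f x →
            edist (bumpAvg f c r) (f x) ≤ C * (weightedEnergy p w g (Metric.closedBall c r) ^ (1 / p) *
              dualMass (p / n) w (Metric.closedBall c r) ^ ((p / n - 1) / p)) := by
  have hn0 : (0 : ℝ) < n := by exact_mod_cast hn
  have hp0 : 0 < p := hn0.trans hp
  have hq : 1 < p / n := by rw [lt_div_iff₀ hn0]; linarith
  have he0 : 0 < (p / n - 1) / p := div_pos (by linarith) hp0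
  obtain ⟨θ, hθ1, hθ⟩ := exists_dualMass_le_mul_of_volume_le_half n hq M
  obtain ⟨Λ, hΛ0, hΛ⟩ := exists_abs_unitBump_le n
  -- The ratio of the geometric series; it is below `1` because `p > n` makes the exponent positive.
  set τ : ℝ≥0∞ := θ ^ ((p / n - 1) / p)
  have hτ1 : τ < 1 := ENNReal.rpow_lt_one hθ1 he0
  set C₀ : ℝ≥0∞ := ENNReal.ofReal (n * 2 ^ n * Λ) *
    volume (Metric.ball (0 : EuclideanSpace ℝ (Fin n)) 1) ^ (1 - 1 / (n : ℝ))
  have hC₀ : C₀ ≠ ⊤ := by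
    refine ENNReal.mul_ne_top ENNReal.ofReal_ne_top (ENNReal.rpow_ne_top_of_nonneg ?_
      measure_ball_lt_top.ne)
    rw [sub_nonneg, div_le_one hn0]; exact_mod_cast hn
  refine ⟨C₀ * (1 - τ)⁻¹, ENNReal.mul_ne_top hC₀ (ENNReal.inv_ne_top.2 (tsub_pos_of_lt hτ1).ne'), ?_⟩
  intro w hw hM Ω f g hg c r hr hΩ x hx hxf
  have hθw := fun c r hr => hθ w hw hM c r hr
  set G := weightedEnergy p w g (Metric.closedBall c r)
  set S := dualMass (p / n) w (Metric.closedBall c r)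
  have hstep : ∀ k : ℕ, edist (bumpAvg f (x + (1 / 2 : ℝ) ^ k • (c - x)) ((1 / 2 : ℝ) ^ k * r))
      (bumpAvg f (x + (1 / 2 : ℝ) ^ (k + 1) • (c - x)) ((1 / 2 : ℝ) ^ (k + 1) * r)) ≤
      C₀ * (G ^ (1 / p) * S ^ ((p / n - 1) / p)) * τ ^ k := by
    intro k
    obtain ⟨hsub, hS⟩ := dualMass_closedBall_homothety_le hn hθw hr hx k
    have h1 := mem_closedBall_homothety hx k
    have hr' : 0 < (1 / 2 : ℝ) ^ k * r := by positivity
    have e1 : x + (1 / 2 : ℝ) ^ (k + 1) • (c - x) =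
        x + (1 / 2 : ℝ) • (x + (1 / 2 : ℝ) ^ k • (c - x) - x) := by
      rw [pow_succ]; module
    have e2 : (1 / 2 : ℝ) ^ (k + 1) * r = (1 / 2 : ℝ) ^ k * r / 2 := by ring
    rw [e1, e2]
    refine (edist_bumpAvg_half_le hΛ0 hΛ hg hr' h1 (hsub.trans hΩ)).trans ?_
    set ck := x + (1 / 2 : ℝ) ^ k • (c - x)
    set rk := (1 / 2 : ℝ) ^ k * r
    have hgm : AEStronglyMeasurable g (volume.restrict (Metric.closedBall ck rk)) :=
      (hg.locallyIntegrableOn_grad.integrableOn_compact_subset (hsub.trans hΩ)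
        (isCompact_closedBall _ _)).1
    calc ENNReal.ofReal (n * 2 ^ n * Λ * (rk * (rk ^ n)⁻¹)) *
          ∫⁻ z in Metric.closedBall ck rk, ‖g z‖ₑ
        ≤ ENNReal.ofReal (n * 2 ^ n * Λ * (rk * (rk ^ n)⁻¹)) *
          (weightedEnergy p w g (Metric.closedBall ck rk) ^ (1 / p) *
            dualMass (p / n) w (Metric.closedBall ck rk) ^ ((p / n - 1) / p) *
            volume (Metric.closedBall ck rk) ^ (1 - 1 / (n : ℝ))) := by
          gcongr
          exact lintegral_enorm_le_weighted hn hp hw.isWeight (hw.ae_pos hq) hgm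
      _ = C₀ * (weightedEnergy p w g (Metric.closedBall ck rk) ^ (1 / p) *
            dualMass (p / n) w (Metric.closedBall ck rk) ^ ((p / n - 1) / p)) := by
          rw [ENNReal.ofReal_mul (by positivity)]
          simp only [C₀]
          rw [← ofReal_mul_volume_closedBall_rpow hn ck hr']
          ring
      _ ≤ C₀ * (G ^ (1 / p) * (θ ^ k * S) ^ ((p / n - 1) / p)) := by
          gcongr
          exact lintegral_mono_set hsub
      _ = _ := by
          rw [ENNReal.mul_rpow_of_nonneg _ _ he0.le, ← ENNReal.rpow_natCast θ k, ← ENNReal.rpow_mul,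
            mul_comm (k : ℝ), ENNReal.rpow_mul, ENNReal.rpow_natCast]
          ring
  -- Telescoping from the full ball down to the limit `f x`.
  have h := edist_le_tsum_of_edist_le_of_tendsto₀ _ hstep (hxf c r hr hx)
  rw [ENNReal.tsum_mul_left, ENNReal.tsum_geometric] at h
  simp only [pow_zero, one_smul, one_mul, add_sub_cancel] at h
  refine h.trans (le_of_eq ?_)
  ring

/-- Both points are compared with the same average over the ball. -/
theorem exists_edist_le_of_isAvgPoint (hn : 1 ≤ n) {p : ℝ} (hp : (n : ℝ) < p) (M : ℝ≥0) :
    ∃ C : ℝ≥0∞, C ≠ ⊤ ∧ ∀ w : EuclideanSpace ℝ (Fin n) → ℝ, MemAp (p / n) w →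
      apConst (p / n) w ≤ M → ∀ (Ω : Set (EuclideanSpace ℝ (Fin n)))
        (f : EuclideanSpace ℝ (Fin n) → ℝ)
        (g : EuclideanSpace ℝ (Fin n) → EuclideanSpace ℝ (Fin n)), HasWeakGradient Ω f g →
        ∀ (c : EuclideanSpace ℝ (Fin n)) (r : ℝ), 0 < r → Metric.closedBall c r ⊆ Ω →
          ∀ x ∈ Metric.closedBall c r, IsAvgPoint f x →
          ∀ y ∈ Metric.closedBall c r, IsAvgPoint f y →
            edist (f x) (f y) ≤ C * (weightedEnergy p w g (Metric.closedBall c r) ^ (1 / p) *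
              dualMass (p / n) w (Metric.closedBall c r) ^ ((p / n - 1) / p)) := by
  obtain ⟨C, hC, h⟩ := exists_edist_bumpAvg_le hn hp M
  refine ⟨2 * C, ENNReal.mul_ne_top (by simp) hC, ?_⟩
  intro w hw hM Ω f g hg c r hr hΩ x hx hxf y hy hyf
  refine (edist_triangle_left _ _ (bumpAvg f c r)).trans ?_
  rw [two_mul, add_mul]
  exact add_le_add (h w hw hM Ω f g hg c r hr hΩ x hx hxf) (h w hw hM Ω f g hg c r hr hΩ y hy hyf)

theorem subset_closure_of_ae {U : Set (EuclideanSpace ℝ (Fin n))} (hU : IsOpen U)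
    {P : EuclideanSpace ℝ (Fin n) → Prop} (hP : ∀ᵐ x ∂volume.restrict U, P x) :
    U ⊆ closure {x | x ∈ U ∧ P x} := by
  intro x hx
  by_contra hcon
  rw [ae_restrict_iff' hU.measurableSet, ae_iff] at hP
  have hop : IsOpen (U ∩ (closure {x | x ∈ U ∧ P x})ᶜ) := hU.inter isClosed_closure.isOpen_compl
  refine (hop.measure_pos volume ⟨x, hx, hcon⟩).ne' (measure_mono_null ?_ hP)
  rintro y ⟨hy, hy'⟩ h
  exact hy' (subset_closure ⟨hy, h hy⟩)

theorem HasWeakGradient.congr_ae {Ω : Set (EuclideanSpace ℝ (Fin n))}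
    {f h : EuclideanSpace ℝ (Fin n) → ℝ}
    {g : EuclideanSpace ℝ (Fin n) → EuclideanSpace ℝ (Fin n)} (hg : HasWeakGradient Ω f g)
    (hfh : h =ᵐ[volume.restrict Ω] f) (hh : LocallyIntegrableOn h Ω) : HasWeakGradient Ω h g := by
  refine ⟨hh, hg.locallyIntegrableOn_grad, fun φ h1 h2 h3 j => ?_⟩
  rw [← hg.integral_eq φ h1 h2 h3 j]
  refine integral_congr_ae ?_
  filter_upwards [hfh] with x hx
  rw [hx]

/-- The oscillation on balls of a continuous function with a weak gradient. -/
theorem exists_osc_ball_le (hn : 1 ≤ n) {p : ℝ} (hp : (n : ℝ) < p) (M : ℝ≥0) :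
    ∃ C : ℝ≥0∞, C ≠ ⊤ ∧ ∀ w : EuclideanSpace ℝ (Fin n) → ℝ, MemAp (p / n) w →
      apConst (p / n) w ≤ M → ∀ (Ω : Set (EuclideanSpace ℝ (Fin n))), IsOpen Ω →
        ∀ (f : EuclideanSpace ℝ (Fin n) → ℝ)
        (g : EuclideanSpace ℝ (Fin n) → EuclideanSpace ℝ (Fin n)), HasWeakGradient Ω f g →
        ContinuousOn f Ω → ∀ (c : EuclideanSpace ℝ (Fin n)) (r : ℝ), Metric.ball c r ⊆ Ω →
          osc f (Metric.ball c r) ≤ C * (weightedEnergy p w g (Metric.ball c r) ^ (1 / p) *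
              dualMass (p / n) w (Metric.closedBall c r) ^ ((p / n - 1) / p)) := by
  have hn0 : (0 : ℝ) < n := by exact_mod_cast hn
  have hp0 : 0 < p := hn0.trans hp
  have hq : 1 < p / n := by rw [lt_div_iff₀ hn0]; linarith
  have he0 : 0 < (p / n - 1) / p := div_pos (by linarith) hp0
  obtain ⟨C, hC, h⟩ := exists_edist_le_of_isAvgPoint hn hp M
  refine ⟨C, hC, ?_⟩
  intro w hw hM Ω hΩ f g hg hf c r hr
  set R := C * (weightedEnergy p w g (Metric.ball c r) ^ (1 / p) *
              dualMass (p / n) w (Metric.closedBall c r) ^ ((p / n - 1) / p))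
  set A := {x | x ∈ Metric.ball c r ∧ IsAvgPoint f x}
  have hdense : Metric.ball c r ⊆ closure A := subset_closure_of_ae Metric.isOpen_ball
    (ae_restrict_of_ae_restrict_of_subset hr (ae_isAvgPoint hΩ hg.locallyIntegrableOn))
  have hA : ∀ x ∈ A, ∀ y ∈ A, edist (f x) (f y) ≤ R := by
    rintro x ⟨hx, hxf⟩ y ⟨hy, hyf⟩
    rw [Metric.mem_ball] at hx hy
    -- Both points lie in a concentric closed ball inside the open one. The energy of the open ball
    -- then suffices, as is needed to sum over disjoint open balls.
    obtain ⟨s, hs, hsr⟩ := exists_between (max_lt hx hy)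
    have hs0 : 0 < max s (r / 2) :=
      lt_max_of_lt_right (by linarith [dist_nonneg (x := x) (y := c)])
    have hsr' : max s (r / 2) < r := max_lt hsr (by linarith [dist_nonneg (x := x) (y := c)])
    have hsub : Metric.closedBall c (max s (r / 2)) ⊆ Metric.ball c r :=
      Metric.closedBall_subset_ball hsr'
    refine (h w hw hM Ω f g hg c _ hs0 (hsub.trans hr) x ?_ hxf y ?_ hyf).trans ?_
    · exact ((le_max_left _ _).trans hs.le).trans (le_max_left _ _)
    · exact ((le_max_right _ _).trans hs.le).trans (le_max_left _ _)
    · simp only [R]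
      gcongr
      · exact lintegral_mono_set hsub
      · exact lintegral_mono_set (Metric.closedBall_subset_closedBall hsr'.le)
  have hlim : ∀ x ∈ Metric.ball c r, Tendsto f (𝓝[A] x) (𝓝 (f x)) := fun x hx =>
    ((hf.continuousAt (hΩ.mem_nhds (hr hx))).continuousWithinAt)
  have hne : ∀ x ∈ Metric.ball c r, (𝓝[A] x).NeBot := fun x hx =>
    mem_closure_iff_nhdsWithin_neBot.1 (hdense hx)
  refine iSup₂_le fun x hx => iSup₂_le fun y hy => ?_
  rw [← Real.dist_eq, ← edist_dist]
  have := hne x hx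
  have := hne y hy
  refine le_of_tendsto ((hlim x hx).edist tendsto_const_nhds)
    (eventually_nhdsWithin_of_forall fun x' hx' => ?_)
  exact le_of_tendsto (tendsto_const_nhds.edist (hlim y hy))
    (eventually_nhdsWithin_of_forall fun y' hy' => hA x' hx' y' hy')

/-! ### Variation and continuous representatives of Sobolev functions -/

theorem lpNormWeighted_eq {F : Type*} [NormedAddCommGroup F] {p : ℝ} (hp : 0 < p)
    {Ω : Set (EuclideanSpace ℝ (Fin n))} {w : EuclideanSpace ℝ (Fin n) → ℝ} (hw : IsWeight w)
    (g : EuclideanSpace ℝ (Fin n) → F) :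
    lpNormWeighted p Ω w g = weightedEnergy p w g Ω ^ (1 / p) := by
  rw [lpNormWeighted, eLpNorm_eq_lintegral_rpow_enorm_toReal (by simpa using hp)
    ENNReal.ofReal_ne_top, ENNReal.toReal_ofReal hp.le, weightedMeasure, weightedEnergy,
    lintegral_withDensity_eq_lintegral_mul_non_measurable₀ _ (aemeasurable_ofReal_weight hw).restrict
      (Eventually.of_forall fun x => ENNReal.ofReal_lt_top)]
  simp only [Pi.mul_apply, mul_comm]

/-- In the `p`-th power of the oscillation bound the dual mass appears as `σ(B)^(p/n - 1)`. The
`A_{p/n}` inequality gives `w(B) σ(B)^(p/n - 1) ≤ M (2r)^p`, which cancels `r^(-p)` and leaves the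
energy of the ball, an additive quantity. -/
theorem exists_rieszVar_le (hn : 1 ≤ n) {p : ℝ} (hp : (n : ℝ) < p) (M : ℝ≥0) :
    ∃ C : ℝ≥0∞, C ≠ ⊤ ∧ ∀ w : EuclideanSpace ℝ (Fin n) → ℝ, MemAp (p / n) w →
      apConst (p / n) w ≤ M → ∀ (Ω : Set (EuclideanSpace ℝ (Fin n))), IsOpen Ω →
        ∀ (f : EuclideanSpace ℝ (Fin n) → ℝ)
        (g : EuclideanSpace ℝ (Fin n) → EuclideanSpace ℝ (Fin n)), HasWeakGradient Ω f g →
        ContinuousOn f Ω → rieszVar p Ω w f ≤ C * lpNormWeighted p Ω w g := by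
  have hn0 : (0 : ℝ) < n := by exact_mod_cast hn
  have hp0 : 0 < p := hn0.trans hp
  have hq : 1 < p / n := by rw [lt_div_iff₀ hn0]; linarith
  obtain ⟨C, hC, h⟩ := exists_osc_ball_le hn hp M
  set C₁ : ℝ≥0∞ := C ^ p * M * 2 ^ p
  refine ⟨C₁ ^ (1 / p), by simp only [C₁]; finiteness, ?_⟩
  intro w hw hM Ω hΩ f g hg hf
  rw [lpNormWeighted_eq hp0 hw.isWeight, ← ENNReal.mul_rpow_of_nonneg _ _ (by positivity)]
  refine iSup₂_le fun D hD => ENNReal.rpow_le_rpow ?_ (by positivity)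
  have hball : ∀ b ∈ D, (osc f (Metric.ball b.1 b.2) / ENNReal.ofReal b.2) ^ p *
      ∫⁻ x in Metric.ball b.1 b.2, ENNReal.ofReal (w x) ≤
      C₁ * weightedEnergy p w g (Metric.ball b.1 b.2) := by
    rintro ⟨c, r⟩ hb
    have hr : 0 < r := hD.radius_pos (c, r) hb
    have h1 := h w hw hM Ω hΩ f g hg hf c r (hD.subset (c, r) hb)
    dsimp only
    set G := weightedEnergy p w g (Metric.ball c r)
    set S := dualMass (p / n) w (Metric.closedBall c r)
    have hr0 : ENNReal.ofReal r ≠ 0 := (ENNReal.ofReal_pos.2 hr).ne'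
    have h2 : (C * (G ^ (1 / p) * S ^ ((p / n - 1) / p))) ^ p = C ^ p * G * S ^ (p / n - 1) := by
      rw [ENNReal.mul_rpow_of_nonneg _ _ hp0.le, ENNReal.mul_rpow_of_nonneg _ _ hp0.le,
        ← ENNReal.rpow_mul, ← ENNReal.rpow_mul, one_div_mul_cancel hp0.ne', ENNReal.rpow_one,
        div_mul_cancel₀ _ hp0.ne', mul_assoc]
    have h3 : (∫⁻ x in Metric.ball c r, ENNReal.ofReal (w x)) * S ^ (p / n - 1) ≤
        M * (2 ^ p * ENNReal.ofReal r ^ p) := by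
      calc _ ≤ (∫⁻ x in Metric.closedBall c r, ENNReal.ofReal (w x)) * S ^ (p / n - 1) := by
            gcongr
            exact Metric.ball_subset_closedBall
        _ ≤ apConst (p / n) w * ENNReal.ofReal ((2 * r) ^ n) ^ (p / n) :=
            lintegral_closedBall_mul_dualMass_le hq w c hr
        _ ≤ _ := by
            gcongr
            rw [ENNReal.ofReal_pow (by positivity), ← ENNReal.rpow_natCast, ← ENNReal.rpow_mul,
              mul_div_cancel₀ _ hn0.ne', ENNReal.ofReal_mul (by norm_num),
              ENNReal.mul_rpow_of_nonneg _ _ hp0.le, ENNReal.ofReal_ofNat]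
    rw [ENNReal.div_rpow_of_nonneg _ _ hp0.le]
    calc osc f (Metric.ball c r) ^ p / ENNReal.ofReal r ^ p *
          ∫⁻ x in Metric.ball c r, ENNReal.ofReal (w x)
        ≤ (C ^ p * G * S ^ (p / n - 1)) / ENNReal.ofReal r ^ p *
          ∫⁻ x in Metric.ball c r, ENNReal.ofReal (w x) := by
          rw [← h2]; gcongr
      _ = C ^ p * G * ((∫⁻ x in Metric.ball c r, ENNReal.ofReal (w x)) * S ^ (p / n - 1)) /
            ENNReal.ofReal r ^ p := by
          simp only [div_eq_mul_inv]; ring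
      _ ≤ C ^ p * G * (M * (2 ^ p * ENNReal.ofReal r ^ p)) / ENNReal.ofReal r ^ p := by gcongr
      _ = C₁ * G * (ENNReal.ofReal r ^ p * (ENNReal.ofReal r ^ p)⁻¹) := by
          simp only [div_eq_mul_inv, C₁]; ring
      _ = C₁ * G := by
          rw [ENNReal.mul_inv_cancel, mul_one]
          · exact (ENNReal.rpow_pos (pos_iff_ne_zero.2 hr0) ENNReal.ofReal_ne_top).ne'
          · finiteness
  have := hD.countable.to_subtype
  calc _ ≤ ∑' b : D, C₁ * weightedEnergy p w g (Metric.ball b.1.1 b.1.2) :=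
        ENNReal.tsum_le_tsum fun b => hball b.1 b.2
    _ = C₁ * weightedEnergy p w g (⋃ b : D, Metric.ball b.1.1 b.1.2) := by
        rw [ENNReal.tsum_mul_left, weightedEnergy, lintegral_iUnion (fun _ => measurableSet_ball)]
        · rfl
        · intro b b' hbb'
          exact hD.disjoint b.2 b'.2 fun h => hbb' (Subtype.ext h)
    _ ≤ _ := by
        gcongr
        exact lintegral_mono_set (iUnion_subset fun b => hD.subset b.1 b.2)

/-- Restricted to the dense set of averaging points, `f` has arbitrarily small oscillation near each
point of `Ω`, so it extends continuously to `Ω`. -/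
theorem HasWeakGradient.exists_isContinuousRep (hn : 1 ≤ n) {p : ℝ} (hp : (n : ℝ) < p)
    {w : EuclideanSpace ℝ (Fin n) → ℝ} (hw : MemAp (p / n) w)
    {Ω : Set (EuclideanSpace ℝ (Fin n))} (hΩ : IsOpen Ω) {f : EuclideanSpace ℝ (Fin n) → ℝ}
    {g : EuclideanSpace ℝ (Fin n) → EuclideanSpace ℝ (Fin n)} (hg : HasWeakGradient Ω f g)
    (hgp : lpNormWeighted p Ω w g < ⊤) : ∃ h, IsContinuousRep Ω f h := by
  have hn0 : (0 : ℝ) < n := by exact_mod_cast hn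
  have hp0 : 0 < p := hn0.trans hp
  have hq : 1 < p / n := by rw [lt_div_iff₀ hn0]; linarith
  have he0 : 0 < (p / n - 1) / p := div_pos (by linarith) hp0
  have hMtop := hw.apConst_lt_top
  lift apConst (p / n) w to ℝ≥0 using hMtop.ne with M hM
  obtain ⟨C, hC, hosc⟩ := exists_edist_le_of_isAvgPoint hn hp M
  obtain ⟨θ, hθ1, hθ⟩ := exists_dualMass_le_mul_of_volume_le_half n hq M
  have hθw := hθ w hw hM.symm.le
  rw [lpNormWeighted_eq hp0 hw.isWeight] at hgp
  set A := {x | x ∈ Ω ∧ IsAvgPoint f x}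
  have hae := ae_isAvgPoint hΩ hg.locallyIntegrableOn
  have hdense : Ω ⊆ closure A := subset_closure_of_ae hΩ hae
  have hcauchy : ∀ x ∈ Ω, Cauchy (map f (𝓝[A] x)) := by
    intro x hx
    have := mem_closure_iff_nhdsWithin_neBot.1 (hdense hx)
    obtain ⟨ρ, hρ, hρΩ⟩ := Metric.nhds_basis_closedBall.mem_iff.1 (hΩ.mem_nhds hx)
    rw [EMetric.cauchy_iff]
    refine ⟨(this.map f).ne, fun ε hε => ?_⟩
    set S := dualMass (p / n) w (Metric.closedBall x ρ)
    have hSt : S ≠ ⊤ := (dualMass_closedBall_lt_top hq hw x ρ).ne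
    -- The energy is only bounded; smallness comes from the dual mass of the balls shrinking to `x`.
    set E := weightedEnergy p w g Ω ^ (1 / p)
    have hlim : Tendsto (fun k : ℕ => C * (E * (θ ^ k * S) ^ ((p / n - 1) / p))) atTop
        (𝓝 (C * (E * (0 * S) ^ ((p / n - 1) / p)))) := by
      have h1 := ENNReal.Tendsto.mul_const (b := S)
        (ENNReal.tendsto_pow_atTop_nhds_zero_of_lt_one hθ1) (Or.inr hSt)
      have h2 := h1.ennrpow_const ((p / n - 1) / p)
      exact ENNReal.Tendsto.const_mul (ENNReal.Tendsto.const_mul h2 (Or.inr hgp.ne)) (Or.inr hC)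
    rw [zero_mul, ENNReal.zero_rpow_of_pos he0, mul_zero, mul_zero] at hlim
    obtain ⟨k, hk⟩ := (hlim.eventually_lt_const hε).exists
    have hxk := dualMass_closedBall_homothety_le hn hθw hρ
      (Metric.mem_closedBall_self (x := x) hρ.le) k
    rw [sub_self, smul_zero, add_zero] at hxk
    have hρk : 0 < (1 / 2 : ℝ) ^ k * ρ := by positivity
    refine ⟨f '' (Metric.ball x ((1 / 2 : ℝ) ^ k * ρ) ∩ A), image_mem_map
      (inter_mem (mem_nhdsWithin_of_mem_nhds (Metric.ball_mem_nhds _ hρk)) self_mem_nhdsWithin), ?_⟩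
    rintro _ ⟨y, ⟨hy, hyA⟩, rfl⟩ _ ⟨z, ⟨hz, hzA⟩, rfl⟩
    refine lt_of_le_of_lt ((hosc w hw hM.symm.le Ω f g hg x _ hρk (hxk.1.trans hρΩ) y
      (Metric.ball_subset_closedBall hy) hyA.2 z (Metric.ball_subset_closedBall hz) hzA.2).trans ?_)
      hk
    gcongr
    · exact ENNReal.rpow_le_rpow (lintegral_mono_set (hxk.1.trans hρΩ)) (by positivity)
    · exact hxk.2
  have hlim : ∀ x ∈ Ω, ∃ l, Tendsto f (𝓝[A] x) (𝓝 l) := fun x hx =>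
    CompleteSpace.complete (hcauchy x hx)
  refine ⟨extendFrom A f, continuousOn_extendFrom hdense hlim, ?_⟩
  filter_upwards [hae, ae_restrict_mem hΩ.measurableSet] with x hx hxΩ
  obtain ⟨l, hl⟩ := hlim x hxΩ
  -- An averaging point belongs to `A`, so the limit along `A` can only be `f x`.
  have hpure : Tendsto f (pure x) (𝓝 l) := hl.mono_left (pure_le_nhdsWithin ⟨hxΩ, hx⟩)
  rw [extendFrom_eq (hdense hxΩ) hl]
  exact tendsto_nhds_unique hpure (tendsto_pure_nhds f x)

/-! ### Difference quotients on a grid -/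

/-- The half-open cell, with index `z`, of the grid of side length `ε`. -/
def gridCell (ε : ℝ) (z : Fin n → ℤ) : Set (EuclideanSpace ℝ (Fin n)) :=
  {x | ∀ i, ⌊x i / ε⌋ = z i}

/-- The center of a cell of the grid of side length `ε`. -/
noncomputable def gridCenter (ε : ℝ) (z : Fin n → ℤ) : EuclideanSpace ℝ (Fin n) :=
  WithLp.toLp 2 fun i => ε * (z i + 1 / 2)

theorem measurableSet_gridCell (ε : ℝ) (z : Fin n → ℤ) : MeasurableSet (gridCell ε z) := by
  have : gridCell ε z = ⋂ i, {x : EuclideanSpace ℝ (Fin n) | ⌊x i / ε⌋ = z i} := by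
    ext x; simp [gridCell]
  rw [this]
  refine MeasurableSet.iInter fun i => ?_
  have h1 : Measurable fun x : EuclideanSpace ℝ (Fin n) => ⌊x i / ε⌋ :=
    Int.measurable_floor.comp
      (((EuclideanSpace.proj i : EuclideanSpace ℝ (Fin n) →L[ℝ] ℝ).measurable).div_const ε)
  exact h1 (measurableSet_singleton (z i))

theorem dist_gridCenter_le {ε : ℝ} (hε : 0 < ε) {z : Fin n → ℤ} {x : EuclideanSpace ℝ (Fin n)}
    (hx : x ∈ gridCell ε z) : dist x (gridCenter ε z) ≤ n * ε / 2 := by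
  have h1 : ∀ i, dist (x i) (gridCenter ε z i) ^ 2 ≤ (ε / 2) ^ 2 := by
    intro i
    have h2 := Int.floor_le (x i / ε)
    have h3 := Int.lt_floor_add_one (x i / ε)
    rw [hx i] at h2 h3
    rw [le_div_iff₀ hε] at h2
    rw [div_lt_iff₀ hε] at h3
    refine sq_le_sq' (by linarith [dist_nonneg (x := x i) (y := gridCenter ε z i)]) ?_
    rw [Real.dist_eq, abs_le]
    simp only [gridCenter]
    constructor <;> nlinarith
  rw [EuclideanSpace.dist_eq, Real.sqrt_le_left (by positivity)]
  refine (Finset.sum_le_sum fun i _ => h1 i).trans ?_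
  -- The half-diagonal is `√n * ε / 2`; replacing `√n` by `n` avoids the root.
  have hn : (n : ℝ) ≤ n ^ 2 := by exact_mod_cast Nat.le_self_pow two_ne_zero n
  simp only [Finset.sum_const, Finset.card_univ, Fintype.card_fin, nsmul_eq_mul]
  nlinarith [sq_nonneg ε]

theorem gridCenter_injective {ε : ℝ} (hε : 0 < ε) :
    Function.Injective (gridCenter (n := n) ε) := by
  intro z z' h
  funext i
  have h1 : gridCenter ε z i = gridCenter ε z' i := by rw [h]
  simp only [gridCenter] at h1
  have h2 := mul_left_cancel₀ hε.ne' h1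
  exact_mod_cast add_right_cancel h2

/-- Distinct indices congruent modulo `m` differ by at least `m` in some coordinate. The residue
vector serves as the colour of a cell. -/
theorem le_dist_gridCenter {ε : ℝ} (hε : 0 < ε) {m : ℕ} {z z' : Fin n → ℤ} (hne : z ≠ z')
    (hz : (fun i => (z i : ZMod m)) = fun i => (z' i : ZMod m)) :
    m * ε ≤ dist (gridCenter ε z) (gridCenter ε z') := by
  obtain ⟨i, hi⟩ := Function.ne_iff.1 hne
  have h1 : (m : ℤ) ∣ z i - z' i := by
    rw [← ZMod.intCast_zmod_eq_zero_iff_dvd, Int.cast_sub, sub_eq_zero]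
    exact congrFun hz i
  have h2 : (m : ℤ) ≤ |z i - z' i| :=
    Int.le_of_dvd (abs_pos.2 (sub_ne_zero.2 hi)) ((dvd_abs _ _).2 h1)
  have h3 : (m : ℝ) ≤ |(z i : ℝ) - z' i| := by exact_mod_cast h2
  rw [dist_eq_norm]
  refine le_trans ?_ (PiLp.norm_apply_le _ i)
  rw [Real.norm_eq_abs]
  have h4 : (gridCenter ε z - gridCenter ε z') i = ε * ((z i : ℝ) - z' i) := by
    simp only [gridCenter, PiLp.sub_apply]; ring
  rw [h4, abs_mul, abs_of_pos hε, mul_comm]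
  gcongr

theorem tsum_le_rieszVar_rpow {p : ℝ} (hp : 0 < p) {Ω : Set (EuclideanSpace ℝ (Fin n))}
    (w f : EuclideanSpace ℝ (Fin n) → ℝ) {D : Set (EuclideanSpace ℝ (Fin n) × ℝ)}
    (hD : IsBallFamily Ω D) :
    ∑' b : D, (osc f (Metric.ball b.1.1 b.1.2) / ENNReal.ofReal b.1.2) ^ p *
      ∫⁻ x in Metric.ball b.1.1 b.1.2, ENNReal.ofReal (w x) ≤ rieszVar p Ω w f ^ p := by
  have h : _ ≤ rieszVar p Ω w f := le_iSup₂_of_le (f := fun D (_ : IsBallFamily Ω D) =>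
    (∑' b : D, (osc f (Metric.ball b.1.1 b.1.2) / ENNReal.ofReal b.1.2) ^ p *
      ∫⁻ x in Metric.ball b.1.1 b.1.2, ENNReal.ofReal (w x)) ^ (1 / p)) D hD le_rfl
  have h2 := ENNReal.rpow_le_rpow h hp.le
  rwa [← ENNReal.rpow_mul, one_div_mul_cancel hp.ne', ENNReal.rpow_one] at h2

/-- Grid balls of the same colour are disjoint, so that their sum is controlled by the variation. -/
theorem tsum_grid_le {p : ℝ} (hp : 0 < p) {Ω : Set (EuclideanSpace ℝ (Fin n))}
    (w f : EuclideanSpace ℝ (Fin n) → ℝ) {ε : ℝ} (hε : 0 < ε) (S : Set (Fin n → ℤ))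
    (hS : ∀ z ∈ S, Metric.ball (gridCenter ε z) ((n + 1) * ε) ⊆ Ω) :
    ∑' z : S, (osc f (Metric.ball (gridCenter ε z.1) ((n + 1) * ε)) /
        ENNReal.ofReal ((n + 1) * ε)) ^ p *
      ∫⁻ x in Metric.ball (gridCenter ε z.1) ((n + 1) * ε), ENNReal.ofReal (w x) ≤
      (2 * (n + 1)) ^ n * rieszVar p Ω w f ^ p := by
  -- Centers of one colour are at least `2 * (n + 1) * ε` apart, two radii, so their open balls are
  -- disjoint.
  set m : ℕ := 2 * (n + 1)
  have : NeZero m := ⟨by omega⟩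
  set a : (Fin n → ℤ) → ℝ≥0∞ := fun z => (osc f (Metric.ball (gridCenter ε z) ((n + 1) * ε)) /
        ENNReal.ofReal ((n + 1) * ε)) ^ p *
      ∫⁻ x in Metric.ball (gridCenter ε z) ((n + 1) * ε), ENNReal.ofReal (w x)
  set κ : S → (Fin n → ZMod m) := fun z i => (z.1 i : ZMod m)
  change ∑' z : S, a z.1 ≤ _
  rw [← (Equiv.sigmaFiberEquiv κ).tsum_eq, ENNReal.tsum_sigma', tsum_fintype]
  have hcard : ((2 * (n + 1)) ^ n : ℝ≥0∞) = (Fintype.card (Fin n → ZMod m) : ℝ≥0∞) := by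
    simp [m, ZMod.card]
  rw [hcard, ← nsmul_eq_mul, ← Finset.card_univ]
  refine Finset.sum_le_card_nsmul _ _ _ fun t _ => ?_
  set T : Set (Fin n → ℤ) := {z | ∃ h : z ∈ S, κ ⟨z, h⟩ = t}
  set G : (Fin n → ℤ) → EuclideanSpace ℝ (Fin n) × ℝ := fun z => (gridCenter ε z, (n + 1) * ε)
  have hGinj : Function.Injective G := fun z z' h => gridCenter_injective hε (congrArg Prod.fst h)
  have hD : IsBallFamily Ω (G '' T) := by
    refine ⟨(to_countable T).image G, ?_, ?_, ?_⟩
    · rintro _ ⟨z, -, rfl⟩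
      exact (by positivity : 0 < ((n : ℝ) + 1) * ε)
    · rintro _ ⟨z, ⟨hz, -⟩, rfl⟩
      exact hS z hz
    · rintro _ ⟨z, ⟨hz, hzt⟩, rfl⟩ _ ⟨z', ⟨hz', hzt'⟩, rfl⟩ hne
      refine Metric.ball_disjoint_ball ?_
      have h1 := le_dist_gridCenter hε (m := m) (fun h => hne (congrArg G h)) (hzt.trans hzt'.symm)
      refine le_trans (le_of_eq ?_) h1
      simp only [G, m]
      push_cast
      ring
  refine le_trans (le_of_eq ?_) (tsum_le_rieszVar_rpow hp w f hD)
  rw [tsum_image (fun b : EuclideanSpace ℝ (Fin n) × ℝ =>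
    (osc f (Metric.ball b.1 b.2) / ENNReal.ofReal b.2) ^ p *
      ∫⁻ x in Metric.ball b.1 b.2, ENNReal.ofReal (w x)) hGinj.injOn]
  let e : {z : S // κ z = t} ≃ T :=
    { toFun := fun z => ⟨z.1.1, z.1.2, z.2⟩
      invFun := fun z => ⟨⟨z.1, z.2.1⟩, z.2.2⟩
      left_inv := fun _ => rfl
      right_inv := fun _ => rfl }
  exact (e.tsum_eq fun z : T => a z.1)

/-- Difference quotients are bounded in `L^p(w)` by the variation. -/
theorem lintegral_difference_quotient_le {p : ℝ} (hp : 0 < p)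
    {Ω : Set (EuclideanSpace ℝ (Fin n))} {w : EuclideanSpace ℝ (Fin n) → ℝ} (hw : IsWeight w)
    (f : EuclideanSpace ℝ (Fin n) → ℝ) {ε : ℝ} (hε : 0 < ε) (j : Fin n) :
    ∫⁻ x in (Metric.thickening (2 * ((n + 1) * ε)) Ωᶜ)ᶜ,
        ‖ε⁻¹ * (f (x + ε • EuclideanSpace.single j 1) - f x)‖ₑ ^ p * ENNReal.ofReal (w x) ≤
      ENNReal.ofReal (n + 1) ^ p * ((2 * (n + 1)) ^ n * rieszVar p Ω w f ^ p) := by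
  have hn0 : (0 : ℝ) < n := by exact_mod_cast j.pos
  -- Here `x` is at least a diameter of the grid balls away from `Ωᶜ`, so the ball attached to its
  -- cell lies in `Ω`.
  set T := (Metric.thickening (2 * ((n + 1) * ε)) Ωᶜ)ᶜ
  have hTm : MeasurableSet T := Metric.isOpen_thickening.measurableSet.compl
  set F : EuclideanSpace ℝ (Fin n) → ℝ≥0∞ := fun x =>
    ‖ε⁻¹ * (f (x + ε • EuclideanSpace.single j 1) - f x)‖ₑ ^ p * ENNReal.ofReal (w x)
  set B : (Fin n → ℤ) → Set (EuclideanSpace ℝ (Fin n)) := fun z =>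
    Metric.ball (gridCenter ε z) ((n + 1) * ε)
  set S : Set (Fin n → ℤ) := {z | B z ⊆ Ω}
  have hcover : T ⊆ ⋃ z : S, gridCell ε z.1 ∩ T := by
    intro x hx
    set z : Fin n → ℤ := fun i => ⌊x i / ε⌋
    have hxz : x ∈ gridCell ε z := fun i => rfl
    have hz : z ∈ S := by
      intro y hy
      by_contra hyΩ
      refine hx (Metric.mem_thickening_iff.2 ⟨y, hyΩ, ?_⟩)
      have h1 := dist_gridCenter_le hε hxz
      have h2 : dist y (gridCenter ε z) < (n + 1) * ε := hy
      have h3 := dist_triangle_right x y (gridCenter ε z)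
      nlinarith
    exact mem_iUnion.2 ⟨⟨z, hz⟩, hxz, hx⟩
  have hcell : ∀ z : S, ∫⁻ x in gridCell ε z.1 ∩ T, F x ≤
      ENNReal.ofReal (n + 1) ^ p * ((osc f (B z.1) / ENNReal.ofReal ((n + 1) * ε)) ^ p *
        ∫⁻ x in B z.1, ENNReal.ofReal (w x)) := by
    rintro ⟨z, hz⟩
    -- The radius leaves room for `n * ε / 2` within the cell plus the shift `ε`. Dividing by `ε`
    -- instead of the radius costs the factor `n + 1`.
    have hmemB : ∀ x ∈ gridCell ε z, x ∈ B z ∧ x + ε • EuclideanSpace.single j (1 : ℝ) ∈ B z := by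
      intro x hx
      have h1 := dist_gridCenter_le hε hx
      constructor
      · refine lt_of_le_of_lt h1 ?_
        nlinarith
      · refine lt_of_le_of_lt (dist_triangle _ x _) ?_
        rw [dist_self_add_left, norm_smul, PiLp.norm_single, Real.norm_of_nonneg hε.le]
        simp only [norm_one, mul_one]
        nlinarith
    have hpt : ∀ x ∈ gridCell ε z ∩ T, F x ≤ ENNReal.ofReal (n + 1) ^ p *
        (osc f (B z) / ENNReal.ofReal ((n + 1) * ε)) ^ p * ENNReal.ofReal (w x) := by
      rintro x ⟨hx, -⟩
      obtain ⟨h1, h2⟩ := hmemB x hx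
      have h3 : ENNReal.ofReal |f (x + ε • EuclideanSpace.single j 1) - f x| ≤ osc f (B z) :=
        le_iSup₂_of_le _ h2 (le_iSup₂_of_le _ h1 le_rfl)
      simp only [F]
      gcongr
      rw [← ENNReal.mul_rpow_of_nonneg _ _ hp.le]
      gcongr
      rw [enorm_mul, Real.enorm_eq_ofReal (by positivity), Real.enorm_eq_ofReal_abs,
        ENNReal.ofReal_mul (by positivity), ENNReal.ofReal_inv_of_pos hε, mul_comm,
        ← mul_div_assoc, ENNReal.mul_div_mul_left _ _ (ENNReal.ofReal_pos.2 (by positivity)).ne'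
          ENNReal.ofReal_ne_top, div_eq_mul_inv]
      gcongr
    calc ∫⁻ x in gridCell ε z ∩ T, F x
        ≤ ∫⁻ x in gridCell ε z ∩ T, ENNReal.ofReal (n + 1) ^ p *
          (osc f (B z) / ENNReal.ofReal ((n + 1) * ε)) ^ p * ENNReal.ofReal (w x) :=
          setLIntegral_mono' ((measurableSet_gridCell ε z).inter hTm) hpt
      _ = ENNReal.ofReal (n + 1) ^ p * (osc f (B z) / ENNReal.ofReal ((n + 1) * ε)) ^ p *
          ∫⁻ x in gridCell ε z ∩ T, ENNReal.ofReal (w x) :=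
          lintegral_const_mul'' _ (aemeasurable_ofReal_weight hw).restrict
      _ ≤ _ := by
          rw [mul_assoc]
          gcongr
          exact fun x hx => (hmemB x hx.1).1
  calc ∫⁻ x in T, F x ≤ ∫⁻ x in ⋃ z : S, gridCell ε z.1 ∩ T, F x := lintegral_mono_set hcover
    _ ≤ ∑' z : S, ∫⁻ x in gridCell ε z.1 ∩ T, F x := lintegral_iUnion_le _ _
    _ ≤ _ := ENNReal.tsum_le_tsum hcell
    _ ≤ _ := by
        rw [ENNReal.tsum_mul_left]
        gcongr
        exact tsum_grid_le hp w f hε S fun z hz => hz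

/-- The difference quotient of `f` in direction `e_j`, extended by zero to the points that are close
to the complement of `Ω`. -/
noncomputable def truncDiffQuotient (Ω : Set (EuclideanSpace ℝ (Fin n)))
    (f : EuclideanSpace ℝ (Fin n) → ℝ) (j : Fin n) (ε : ℝ) : EuclideanSpace ℝ (Fin n) → ℝ :=
  (Metric.thickening (2 * ((n + 1) * ε)) Ωᶜ)ᶜ.indicator fun x =>
    ε⁻¹ * (Ω.indicator f (x + ε • EuclideanSpace.single j 1) - Ω.indicator f x)

theorem measurable_truncDiffQuotient {Ω : Set (EuclideanSpace ℝ (Fin n))} (hΩ : IsOpen Ω)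
    {f : EuclideanSpace ℝ (Fin n) → ℝ} (hf : ContinuousOn f Ω) (j : Fin n) (ε : ℝ) :
    Measurable (truncDiffQuotient Ω f j ε) := by
  classical
  have h1 : Measurable (Ω.indicator f) := by
    rw [← piecewise_eq_indicator]
    exact hf.measurable_piecewise continuousOn_const hΩ.measurableSet
  refine Measurable.indicator ?_ Metric.isOpen_thickening.measurableSet.compl
  exact ((h1.comp (by fun_prop)).sub h1).const_mul _

theorem osc_congr {f h : EuclideanSpace ℝ (Fin n) → ℝ} {E : Set (EuclideanSpace ℝ (Fin n))}
    (hfh : EqOn f h E) : osc f E = osc h E := by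
  simp only [osc]
  refine iSup_congr fun x => iSup_congr fun hx => iSup_congr fun y => iSup_congr fun hy => ?_
  rw [hfh hx, hfh hy]

theorem rieszVar_congr {p : ℝ} {Ω : Set (EuclideanSpace ℝ (Fin n))}
    {w f h : EuclideanSpace ℝ (Fin n) → ℝ} (hfh : EqOn f h Ω) :
    rieszVar p Ω w f = rieszVar p Ω w h := by
  simp only [rieszVar]
  refine iSup_congr fun D => iSup_congr fun hD => ?_
  congr 1
  refine tsum_congr fun b => ?_
  rw [osc_congr (hfh.mono (hD.subset b.1 b.2))]

theorem lpNormWeighted_truncDiffQuotient_le {p : ℝ} (hp : 0 < p)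
    {Ω : Set (EuclideanSpace ℝ (Fin n))} {w : EuclideanSpace ℝ (Fin n) → ℝ} (hw : IsWeight w)
    (f : EuclideanSpace ℝ (Fin n) → ℝ) (j : Fin n) {ε : ℝ} (hε : 0 < ε) :
    lpNormWeighted p Ω w (truncDiffQuotient Ω f j ε) ≤
      (ENNReal.ofReal (n + 1) ^ p * (2 * (n + 1)) ^ n) ^ (1 / p) * rieszVar p Ω w f := by
  rw [lpNormWeighted_eq hp hw]
  have h1 : weightedEnergy p w (truncDiffQuotient Ω f j ε) Ω ≤
      ENNReal.ofReal (n + 1) ^ p * ((2 * (n + 1)) ^ n * rieszVar p Ω w f ^ p) := by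
    have h2 := lintegral_difference_quotient_le hp (Ω := Ω) hw (Ω.indicator f) hε j
    rw [rieszVar_congr (eqOn_indicator (s := Ω) (f := f))] at h2
    refine le_trans ?_ h2
    rw [← lintegral_indicator Metric.isOpen_thickening.measurableSet.compl]
    refine (lintegral_mono' Measure.restrict_le_self le_rfl).trans (lintegral_mono fun x => ?_)
    by_cases hx : x ∈ (Metric.thickening (2 * ((n + 1) * ε)) Ωᶜ)ᶜ
    · rw [indicator_of_mem hx, truncDiffQuotient, indicator_of_mem hx]
    · rw [truncDiffQuotient, indicator_of_notMem hx, enorm_zero, ENNReal.zero_rpow_of_pos hp,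
        zero_mul]
      exact zero_le
  refine (ENNReal.rpow_le_rpow h1 (by positivity)).trans (le_of_eq ?_)
  rw [← mul_assoc, ENNReal.mul_rpow_of_nonneg _ _ (by positivity), ← ENNReal.rpow_mul,
    mul_one_div_cancel hp.ne', ENNReal.rpow_one]

/-- Discrete integration by parts: translation invariance moves the difference quotient onto `φ`,
with step `-ε e_j`, where it converges to a derivative. For small `ε` the truncation does not meet
the support of `φ`. -/
theorem tendsto_integral_truncDiffQuotient {Ω : Set (EuclideanSpace ℝ (Fin n))} (hΩ : IsOpen Ω)
    {f : EuclideanSpace ℝ (Fin n) → ℝ} (hf : ContinuousOn f Ω) (j : Fin n)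
    {φ : EuclideanSpace ℝ (Fin n) → ℝ} (hφ : ContDiff ℝ ∞ φ) (hc : HasCompactSupport φ)
    (hs : tsupport φ ⊆ Ω) :
    Tendsto (fun ε => ∫ x in Ω, truncDiffQuotient Ω f j ε x * φ x) (𝓝[>] 0)
      (𝓝 (-∫ x in Ω, f x * fderiv ℝ φ x (EuclideanSpace.single j 1))) := by
  obtain ⟨δ, hδ, hδΩ⟩ := hc.exists_cthickening_subset_open hΩ hs
  set e : EuclideanSpace ℝ (Fin n) := EuclideanSpace.single j 1
  have he : ‖e‖ = 1 := by simp [e]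
  set K := Metric.cthickening δ (tsupport φ)
  have hKc : IsCompact K := IsCompact.cthickening hc
  have hKm : MeasurableSet K := hKc.measurableSet
  -- An integrable cutoff of `f` that agrees with it at `x` and at `x + ε • e` for `x` in the
  -- support of `φ` and `ε` small.
  set f₁ := K.indicator f
  have hf₁ : Integrable f₁ :=
    ((hf.mono hδΩ).integrableOn_compact hKc).integrable_indicator hKm
  obtain ⟨L, hL⟩ := ContDiff.lipschitzWith_of_hasCompactSupport (𝕂 := ℝ) hc hφ (by simp)
  obtain ⟨C, hC⟩ := hφ.continuous.bounded_above_of_compact_support hc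
  have hlim := hL.integral_inv_smul_sub_mul_tendsto_integral_lineDeriv_mul hf₁ (-e)
  have hd : ∫ x, lineDeriv ℝ φ x (-e) * f₁ x = -∫ x in Ω, f x * fderiv ℝ φ x e := by
    rw [setIntegral_eq_integral_of_forall_compl_eq_zero, ← integral_neg]
    · refine integral_congr_ae (Eventually.of_forall fun x => ?_)
      dsimp only
      rw [((hφ.differentiable (by simp)) x).lineDeriv_eq_fderiv, map_neg]
      by_cases hx : x ∈ K
      · simp only [f₁, indicator_of_mem hx]; ring
      · have : fderiv ℝ φ x = 0 := image_eq_zero_of_notMem_tsupport fun h =>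
          hx (Metric.self_subset_cthickening _ (tsupport_fderiv_subset ℝ h))
        simp [this]
    · intro x hx
      have : fderiv ℝ φ x = 0 := image_eq_zero_of_notMem_tsupport fun h =>
        hx (hs (tsupport_fderiv_subset ℝ h))
      simp [this]
  rw [hd] at hlim
  refine hlim.congr' ?_
  have hsmall : ∀ᶠ ε : ℝ in 𝓝[>] 0, 2 * ((n + 1) * ε) < δ := by
    have h0 : Tendsto (fun ε : ℝ => 2 * (((n : ℝ) + 1) * ε)) (𝓝 0) (𝓝 (2 * ((n + 1) * 0))) :=
      (tendsto_id.const_mul _).const_mul _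
    rw [mul_zero, mul_zero] at h0
    exact (h0.mono_left nhdsWithin_le_nhds).eventually_lt_const hδ
  filter_upwards [hsmall, self_mem_nhdsWithin] with ε hεδ hε
  have hε0 : (0 : ℝ) < ε := hε
  have hpt : ∀ x, truncDiffQuotient Ω f j ε x * φ x =
      ε⁻¹ * (f₁ (x + ε • e) * φ x - f₁ x * φ x) := by
    intro x
    by_cases hx : x ∈ tsupport φ
    · have hxT : x ∈ (Metric.thickening (2 * ((n + 1) * ε)) Ωᶜ)ᶜ := by
        intro hcon
        obtain ⟨y, hy, hxy⟩ := Metric.mem_thickening_iff.1 hcon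
        refine hy (hδΩ (Metric.mem_cthickening_of_dist_le y x δ _ hx ?_))
        rw [dist_comm]; linarith
      have hxK : x ∈ K := Metric.self_subset_cthickening _ hx
      have hxeK : x + ε • e ∈ K := by
        refine Metric.mem_cthickening_of_dist_le _ x δ _ hx ?_
        rw [dist_self_add_left, norm_smul, he, Real.norm_of_nonneg hε0.le]
        have : (0 : ℝ) ≤ n * ε := by positivity
        nlinarith
      rw [truncDiffQuotient, indicator_of_mem hxT, indicator_of_mem (hδΩ hxK),
        indicator_of_mem (hδΩ hxeK)]
      simp only [f₁, indicator_of_mem hxK, indicator_of_mem hxeK]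
      ring
    · simp [image_eq_zero_of_notMem_tsupport hx]
  have hφb : ∀ v, Integrable fun x => f₁ (x + v) * φ x := fun v =>
    (hf₁.comp_add_right v).mul_bdd (c := C) hφ.continuous.aestronglyMeasurable
      (Eventually.of_forall hC)
  have hφb' : ∀ v, Integrable fun x => f₁ x * φ (x + v) := fun v =>
    hf₁.mul_bdd (c := C) (hφ.continuous.comp (by fun_prop)).aestronglyMeasurable
      (Eventually.of_forall fun x => hC _)
  have hi0 : Integrable fun x => f₁ x * φ x := by simpa using hφb 0
  rw [setIntegral_eq_integral_of_forall_compl_eq_zero fun x hx => by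
    rw [image_eq_zero_of_notMem_tsupport fun h => hx (hs h), mul_zero]]
  have hshift : ∫ x, f₁ (x + ε • e) * φ x = ∫ x, f₁ x * φ (x + ε • -e) := by
    rw [← integral_add_right_eq_self (fun x => f₁ x * φ (x + ε • -e)) (ε • e)]
    refine integral_congr_ae (Eventually.of_forall fun x => ?_)
    simp
  calc ∫ x, ε⁻¹ • (φ (x + ε • -e) - φ x) * f₁ x
      = ∫ x, ε⁻¹ * (f₁ x * φ (x + ε • -e) - f₁ x * φ x) :=
        integral_congr_ae (Eventually.of_forall fun x => by simp only [smul_eq_mul]; ring)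
    _ = ε⁻¹ * ((∫ x, f₁ (x + ε • e) * φ x) - ∫ x, f₁ x * φ x) := by
        rw [integral_const_mul, integral_sub (hφb' _) hi0, hshift]
    _ = ∫ x, truncDiffQuotient Ω f j ε x * φ x := by
        simp only [hpt]
        rw [integral_const_mul, integral_sub (hφb _) hi0]

/-! ### Weak derivatives as weak limits in the weighted space -/

theorem sigmaFinite_weightedMeasure (w : EuclideanSpace ℝ (Fin n) → ℝ)
    (Ω : Set (EuclideanSpace ℝ (Fin n))) : SigmaFinite (weightedMeasure Ω w) :=
  SigmaFinite.withDensity_of_ne_top (Eventually.of_forall fun _ => ENNReal.ofReal_ne_top)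

theorem restrict_absolutelyContinuous_weightedMeasure {w : EuclideanSpace ℝ (Fin n) → ℝ}
    (hw : IsWeight w) (hpos : ∀ᵐ x, 0 < w x) (Ω : Set (EuclideanSpace ℝ (Fin n))) :
    volume.restrict Ω ≪ weightedMeasure Ω w :=
  withDensity_absolutelyContinuous' (aemeasurable_ofReal_weight hw).restrict
    (ae_restrict_of_ae (hpos.mono fun _ hx => (ENNReal.ofReal_pos.2 hx).ne'))

theorem weightedMeasure_absolutelyContinuous (w : EuclideanSpace ℝ (Fin n) → ℝ)
    (Ω : Set (EuclideanSpace ℝ (Fin n))) : weightedMeasure Ω w ≪ volume.restrict Ω :=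
  withDensity_absolutelyContinuous _ _

theorem integral_weightedMeasure_mul_div {w : EuclideanSpace ℝ (Fin n) → ℝ}
    (hw : IsWeight w) (hpos : ∀ᵐ x, 0 < w x) (Ω : Set (EuclideanSpace ℝ (Fin n)))
    (u φ : EuclideanSpace ℝ (Fin n) → ℝ) :
    ∫ x, u x * (φ x / w x) ∂weightedMeasure Ω w = ∫ x in Ω, u x * φ x := by
  rw [weightedMeasure, integral_withDensity_eq_integral_toReal_smul₀
    (aemeasurable_ofReal_weight hw).restrict (Eventually.of_forall fun _ => ENNReal.ofReal_lt_top)]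
  refine integral_congr_ae (ae_restrict_of_ae (hpos.mono fun x hx => ?_))
  simp only [ENNReal.toReal_ofReal hx.le, smul_eq_mul]
  field_simp

/-- `|φ / w|^q w = |φ|^q w^(1 - q)`, and `1 - q = 1 / (1 - p)`: this is the dual density of `A_p`,
integrable on balls. So unweighted pairings with `φ` are continuous on `L^p(w)`. -/
theorem memLp_div_weight {p q : ℝ} (hpq : p.HolderConjugate q)
    {w : EuclideanSpace ℝ (Fin n) → ℝ} (hw : MemAp p w) (Ω : Set (EuclideanSpace ℝ (Fin n)))
    {φ : EuclideanSpace ℝ (Fin n) → ℝ} (hφ : Continuous φ) (hc : HasCompactSupport φ) :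
    MemLpWeighted q Ω w fun x => φ x / w x := by
  have hq0 := hpq.symm.pos
  have hpos := hw.ae_pos hpq.lt
  have hwm : AEMeasurable w volume := hw.isWeight.locallyIntegrable.aestronglyMeasurable.aemeasurable
  refine ⟨((hφ.aemeasurable.div hwm).restrict.mono_ac
    (weightedMeasure_absolutelyContinuous w Ω)).aestronglyMeasurable, ?_⟩
  change lpNormWeighted q Ω w _ < ⊤
  rw [lpNormWeighted_eq hq0 hw.isWeight]
  refine ENNReal.rpow_lt_top_of_nonneg (by positivity) ?_
  obtain ⟨C, hC⟩ := hφ.bounded_above_of_compact_support hc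
  obtain ⟨ρ, hρ⟩ := hc.isBounded.subset_closedBall (0 : EuclideanSpace ℝ (Fin n))
  have h1 : weightedEnergy q w (fun x => φ x / w x) Ω ≤
      ENNReal.ofReal C ^ q * dualMass p w (Metric.closedBall 0 ρ) := by
    rw [dualMass, ← lintegral_const_mul'' _ ((aemeasurable_ofReal_weight hw.isWeight).restrict.pow_const _),
      ← lintegral_indicator measurableSet_closedBall]
    refine (lintegral_mono' Measure.restrict_le_self le_rfl).trans
      (lintegral_mono_ae (hpos.mono fun x hx => ?_))
    by_cases hxρ : x ∈ Metric.closedBall (0 : EuclideanSpace ℝ (Fin n)) ρ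
    · rw [indicator_of_mem hxρ]
      have h0 := (ENNReal.ofReal_pos.2 hx).ne'
      have e1 : ‖φ x / w x‖ₑ ^ q = ‖φ x‖ₑ ^ q * ENNReal.ofReal (w x) ^ (-q) := by
        rw [div_eq_mul_inv, enorm_mul, ENNReal.mul_rpow_of_nonneg _ _ hq0.le,
          Real.enorm_eq_ofReal (inv_nonneg.2 hx.le), ENNReal.ofReal_inv_of_pos hx,
          ENNReal.inv_rpow, ENNReal.rpow_neg]
      have e2 : ENNReal.ofReal (w x) ^ (-q) * ENNReal.ofReal (w x) =
          ENNReal.ofReal (w x) ^ (1 / (1 - p)) := by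
        nth_rewrite 2 [← ENNReal.rpow_one (ENNReal.ofReal (w x))]
        rw [← ENNReal.rpow_add _ _ h0 ENNReal.ofReal_ne_top]
        congr 1
        have : 1 - p ≠ 0 := by linarith [hpq.lt]
        rw [eq_div_iff this]
        linear_combination hpq.mul_eq_add
      rw [e1, mul_assoc, e2]
      gcongr
      rw [← ofReal_norm]
      exact ENNReal.ofReal_le_ofReal (hC x)
    · have : φ x = 0 := image_eq_zero_of_notMem_tsupport fun h => hxρ (hρ h)
      simp [this, hq0]
  refine (h1.trans_lt (ENNReal.mul_lt_top (by finiteness) ?_)).ne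
  exact dualMass_closedBall_lt_top hpq.lt hw _ _

/-- Hölder on `|g| = (|g| w^(1/p)) * w^(-1/p)`, the second factor being controlled by the local dual
mass. -/
theorem MemLpWeighted.locallyIntegrableOn {F : Type*} [NormedAddCommGroup F] {p : ℝ} (hp : 1 < p)
    {w : EuclideanSpace ℝ (Fin n) → ℝ} (hw : MemAp p w) {Ω : Set (EuclideanSpace ℝ (Fin n))}
    (hΩ : IsOpen Ω) {g : EuclideanSpace ℝ (Fin n) → F} (hg : MemLpWeighted p Ω w g) :
    LocallyIntegrableOn g Ω := by
  have hp0 : 0 < p := by linarith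
  have hpos := hw.ae_pos hp
  have hwm := aemeasurable_ofReal_weight hw.isWeight
  have hgm : AEStronglyMeasurable g (volume.restrict Ω) :=
    hg.1.mono_ac (restrict_absolutelyContinuous_weightedMeasure hw.isWeight hpos Ω)
  have hE : weightedEnergy p w g Ω < ⊤ := by
    have h1 : lpNormWeighted p Ω w g < ⊤ := hg.2
    rw [lpNormWeighted_eq hp0 hw.isWeight, ENNReal.rpow_lt_top_iff_of_pos (by positivity)] at h1
    exact h1
  rw [locallyIntegrableOn_iff hΩ.isLocallyClosed]
  intro K hK hKc
  obtain ⟨ρ, hρ⟩ := hKc.isBounded.subset_closedBall (0 : EuclideanSpace ℝ (Fin n))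
  have hgK : AEStronglyMeasurable g (volume.restrict K) :=
    hgm.mono_measure (Measure.restrict_mono hK le_rfl)
  refine ⟨hgK, ?_⟩
  have h1 := ENNReal.lintegral_mul_norm_pow_le (μ := volume.restrict K)
    (f := fun x => ‖g x‖ₑ ^ p * ENNReal.ofReal (w x))
    (g := fun x => ENNReal.ofReal (w x) ^ (1 / (1 - p)))
    ((hgK.enorm.pow_const _).mul hwm.restrict) (hwm.restrict.pow_const _)
    (p := 1 / p) (q := (p - 1) / p) (by positivity) (div_nonneg (by linarith) hp0.le)
    (by field_simp; ring)
  refine lt_of_le_of_lt (le_trans (le_of_eq (lintegral_congr_ae (ae_restrict_of_ae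
    (hpos.mono fun x hx => ?_)))) h1) (ENNReal.mul_lt_top ?_ ?_)
  · have h0 := (ENNReal.ofReal_pos.2 hx).ne'
    dsimp only
    rw [ENNReal.mul_rpow_of_nonneg _ _ (by positivity), ← ENNReal.rpow_mul, ← ENNReal.rpow_mul,
      mul_assoc, ← ENNReal.rpow_add _ _ h0 ENNReal.ofReal_ne_top, mul_one_div_cancel hp0.ne',
      ENNReal.rpow_one]
    have : 1 / p + 1 / (1 - p) * ((p - 1) / p) = 0 := by
      have : 1 - p ≠ 0 := by linarith
      field_simp
      ring
    rw [this, ENNReal.rpow_zero, mul_one]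
  · exact ENNReal.rpow_lt_top_of_nonneg (by positivity)
      ((lintegral_mono_set hK).trans_lt hE).ne
  · exact ENNReal.rpow_lt_top_of_nonneg (div_nonneg (by linarith) hp0.le)
      ((lintegral_mono_set hρ).trans_lt (dualMass_closedBall_lt_top hp hw 0 ρ)).ne

/-- A continuous function of bounded variation has weak partial derivatives. -/
theorem exists_weak_partial_of_rieszVar_lt_top {p : ℝ} (hp : 1 < p)
    {w : EuclideanSpace ℝ (Fin n) → ℝ} (hw : MemAp p w) {Ω : Set (EuclideanSpace ℝ (Fin n))}
    (hΩ : IsOpen Ω) {f : EuclideanSpace ℝ (Fin n) → ℝ} (hf : ContinuousOn f Ω)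
    (hV : rieszVar p Ω w f < ⊤) (j : Fin n) :
    ∃ v : EuclideanSpace ℝ (Fin n) → ℝ, MemLpWeighted p Ω w v ∧
      lpNormWeighted p Ω w v ≤
        (ENNReal.ofReal (n + 1) ^ p * (2 * (n + 1)) ^ n) ^ (1 / p) * rieszVar p Ω w f ∧
      ∀ φ : EuclideanSpace ℝ (Fin n) → ℝ, ContDiff ℝ ∞ φ → HasCompactSupport φ → tsupport φ ⊆ Ω →
        ∫ x in Ω, f x * fderiv ℝ φ x (EuclideanSpace.single j 1) = -∫ x in Ω, v x * φ x := by
  have hp0 : 0 < p := by linarith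
  have hpq := Real.HolderConjugate.conjExponent hp
  have hpos := hw.ae_pos hp
  set A := (ENNReal.ofReal (n + 1) ^ p * (2 * (n + 1)) ^ n) ^ (1 / p) * rieszVar p Ω w f
  have hA : A ≠ ⊤ := ENNReal.mul_ne_top (by finiteness) hV.ne
  have := sigmaFinite_weightedMeasure w Ω
  set ε : ℕ → ℝ := fun k => 1 / ((k : ℝ) + 1)
  have hε0 : ∀ k, 0 < ε k := fun k => by positivity
  have hε : Tendsto ε atTop (𝓝[>] 0) :=
    tendsto_nhdsWithin_iff.2 ⟨tendsto_one_div_add_atTop_nhds_zero_nat, Eventually.of_forall hε0⟩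
  obtain ⟨v, hvm, hvA, hv⟩ := exists_memLp_of_tendsto_integral_mul (weightedMeasure Ω w) hpq hA
    (u := fun k => truncDiffQuotient Ω f j (ε k))
    (fun k => (measurable_truncDiffQuotient hΩ hf j (ε k)).aestronglyMeasurable)
    (fun k => lpNormWeighted_truncDiffQuotient_le hp0 hw.isWeight f j (hε0 k))
  refine ⟨v, ⟨hvm, hvA.trans_lt hA.lt_top⟩, hvA, fun φ hφ hc hs => ?_⟩
  have h1 := hv _ (memLp_div_weight hpq hw Ω hφ.continuous hc)
    (-∫ x in Ω, f x * fderiv ℝ φ x (EuclideanSpace.single j 1)) (by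
      simp only [integral_weightedMeasure_mul_div hw.isWeight hpos]
      exact (tendsto_integral_truncDiffQuotient hΩ hf j hφ hc hs).comp hε)
  rw [integral_weightedMeasure_mul_div hw.isWeight hpos] at h1
  rw [h1, neg_neg]

/-- The partial derivatives are assembled into a vector; the triangle inequality over coordinates
gives the factor `n`. -/
theorem exists_hasWeakGradient_of_rieszVar_lt_top {p : ℝ} (hp : 1 < p)
    {w : EuclideanSpace ℝ (Fin n) → ℝ} (hw : MemAp p w) {Ω : Set (EuclideanSpace ℝ (Fin n))}
    (hΩ : IsOpen Ω) {f : EuclideanSpace ℝ (Fin n) → ℝ} (hf : ContinuousOn f Ω)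
    (hV : rieszVar p Ω w f < ⊤) :
    ∃ g : EuclideanSpace ℝ (Fin n) → EuclideanSpace ℝ (Fin n), HasWeakGradient Ω f g ∧
      MemLpWeighted p Ω w g ∧ lpNormWeighted p Ω w g ≤
        n * (ENNReal.ofReal (n + 1) ^ p * (2 * (n + 1)) ^ n) ^ (1 / p) * rieszVar p Ω w f := by
  choose v hv hvA hvφ using exists_weak_partial_of_rieszVar_lt_top hp hw hΩ hf hV
  set g : EuclideanSpace ℝ (Fin n) → EuclideanSpace ℝ (Fin n) := fun x => WithLp.toLp 2 fun j => v j x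
  have hg : MemLpWeighted p Ω w g := memLp_piLp_iff.2 hv
  have hp1 : (1 : ℝ≥0∞) ≤ ENNReal.ofReal p := by
    rw [← ENNReal.ofReal_one]; exact ENNReal.ofReal_le_ofReal hp.le
  refine ⟨g, ⟨hf.locallyIntegrableOn hΩ.measurableSet, hg.locallyIntegrableOn hp hw hΩ,
    fun φ h1 h2 h3 j => hvφ j φ h1 h2 h3⟩, hg, ?_⟩
  have hsum : g = ∑ j, fun x => EuclideanSpace.single j (v j x) := by
    funext x
    ext i
    simp [g, Finset.sum_apply]
  have hnorm : ∀ j, lpNormWeighted p Ω w (fun x => EuclideanSpace.single j (v j x)) =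
      lpNormWeighted p Ω w (v j) := fun j =>
    eLpNorm_congr_norm_ae (Eventually.of_forall fun x => by simp)
  have hm : ∀ j ∈ Finset.univ, AEStronglyMeasurable
      (fun x => (EuclideanSpace.single j (v j x) : EuclideanSpace ℝ (Fin n)))
      (weightedMeasure Ω w) := fun j _ => by
    have := (LinearIsometry.toContinuousLinearMap
      (LinearIsometry.mk (LinearMap.toSpanSingleton ℝ (EuclideanSpace ℝ (Fin n))
        (EuclideanSpace.single j 1)) fun t => by simp [norm_smul])).continuous
    refine (this.comp_aestronglyMeasurable (hv j).1).congr (Eventually.of_forall fun x => ?_)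
    ext i
    simp
  calc lpNormWeighted p Ω w g
      ≤ ∑ j, lpNormWeighted p Ω w (fun x => EuclideanSpace.single j (v j x)) := by
        rw [hsum]; exact eLpNorm_sum_le hm hp1
    _ ≤ ∑ _j : Fin n, (ENNReal.ofReal (n + 1) ^ p * (2 * (n + 1)) ^ n) ^ (1 / p) *
          rieszVar p Ω w f := Finset.sum_le_sum fun j _ => (hnorm j).trans_le (hvA j)
    _ = _ := by simp [mul_assoc]

/-! ### Uniqueness of the weak gradient and conclusion -/

/-- The fundamental lemma of the calculus of variations, coordinate by coordinate. It transfers the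
norm bound from the gradient built as a weak limit to any given one. -/
theorem HasWeakGradient.ae_eq {Ω : Set (EuclideanSpace ℝ (Fin n))} (hΩ : IsOpen Ω)
    {f : EuclideanSpace ℝ (Fin n) → ℝ}
    {g g' : EuclideanSpace ℝ (Fin n) → EuclideanSpace ℝ (Fin n)} (hg : HasWeakGradient Ω f g)
    (hg' : HasWeakGradient Ω f g') : g =ᵐ[volume.restrict Ω] g' := by
  have hcoord : ∀ (u : EuclideanSpace ℝ (Fin n) → EuclideanSpace ℝ (Fin n)) (j : Fin n),
      LocallyIntegrableOn u Ω → LocallyIntegrableOn (fun x => u x j) Ω := by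
    intro u j hu
    rw [locallyIntegrableOn_iff hΩ.isLocallyClosed] at hu ⊢
    exact fun K hK hKc => (EuclideanSpace.proj j : EuclideanSpace ℝ (Fin n) →L[ℝ] ℝ).integrable_comp
      (hu K hK hKc)
  have key : ∀ j : Fin n, ∀ᵐ x, x ∈ Ω → g x j - g' x j = 0 := by
    intro j
    have h1 := hcoord g j hg.locallyIntegrableOn_grad
    have h2 := hcoord g' j hg'.locallyIntegrableOn_grad
    refine hΩ.ae_eq_zero_of_integral_contDiff_smul_eq_zero (h1.sub h2) fun φ hφ hc hs => ?_
    have hint : ∀ u : EuclideanSpace ℝ (Fin n) → ℝ, LocallyIntegrableOn u Ω →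
        IntegrableOn (fun x => u x * φ x) Ω := by
      intro u hu
      obtain ⟨C, hC⟩ := hφ.continuous.bounded_above_of_compact_support hc
      have h3 : IntegrableOn (fun x => u x * φ x) (tsupport φ) :=
        (hu.integrableOn_compact_subset hs hc).mul_bdd (c := C)
          hφ.continuous.aestronglyMeasurable (Eventually.of_forall hC)
      refine ((integrableOn_iff_integrable_of_support_subset ?_).1 h3).integrableOn
      intro x hx
      exact subset_tsupport _ (right_ne_zero_of_mul hx)
    have h4 : ∫ x in Ω, g x j * φ x = ∫ x in Ω, g' x j * φ x := by
      have := (hg.integral_eq φ hφ hc hs j).symm.trans (hg'.integral_eq φ hφ hc hs j)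
      exact neg_injective this
    rw [← setIntegral_eq_integral_of_forall_compl_eq_zero (s := Ω) fun x hx => by
      rw [image_eq_zero_of_notMem_tsupport fun h => hx (hs h), zero_smul]]
    calc ∫ x in Ω, φ x • (g x j - g' x j) = ∫ x in Ω, (g x j * φ x - g' x j * φ x) :=
          integral_congr_ae (Eventually.of_forall fun x => by simp only [smul_eq_mul]; ring)
      _ = 0 := by rw [integral_sub (hint _ h1) (hint _ h2), h4, sub_self]
  rw [EventuallyEq, ae_restrict_iff' hΩ.measurableSet]
  filter_upwards [ae_all_iff.2 key] with x hx hxΩ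
  ext j
  exact sub_eq_zero.1 (hx j hxΩ)

theorem MemLpWeighted.congr_ae {F : Type*} [NormedAddCommGroup F] {p : ℝ}
    {Ω : Set (EuclideanSpace ℝ (Fin n))} {w : EuclideanSpace ℝ (Fin n) → ℝ}
    {f h : EuclideanSpace ℝ (Fin n) → F} (hf : MemLpWeighted p Ω w f)
    (hfh : f =ᵐ[volume.restrict Ω] h) : MemLpWeighted p Ω w h :=
  MemLp.ae_eq ((weightedMeasure_absolutelyContinuous w Ω).ae_le hfh) hf

theorem IsContinuousRep.hasWeakGradient {Ω : Set (EuclideanSpace ℝ (Fin n))} (hΩ : IsOpen Ω)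
    {f h : EuclideanSpace ℝ (Fin n) → ℝ} (hh : IsContinuousRep Ω f h)
    {g : EuclideanSpace ℝ (Fin n) → EuclideanSpace ℝ (Fin n)} (hg : HasWeakGradient Ω f g) :
    HasWeakGradient Ω h g :=
  hg.congr_ae hh.2 (hh.1.locallyIntegrableOn hΩ.measurableSet)

theorem memW1p_iff (hn : 1 ≤ n) {p : ℝ} (hp : (n : ℝ) < p) {w : EuclideanSpace ℝ (Fin n) → ℝ}
    (hw : MemAp p w) (hw' : MemAp (p / n) w) {Ω : Set (EuclideanSpace ℝ (Fin n))} (hΩ : IsOpen Ω)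
    (f : EuclideanSpace ℝ (Fin n) → ℝ) :
    MemW1p p Ω w f ↔ ∃ h : EuclideanSpace ℝ (Fin n) → ℝ, IsContinuousRep Ω f h ∧
      MemRBV p Ω w h ∧ MemLpWeighted p Ω w h := by
  have hn1 : (1 : ℝ) ≤ n := by exact_mod_cast hn
  constructor
  · rintro ⟨hf, g, hg, hgp⟩
    obtain ⟨h, hh⟩ := hg.exists_isContinuousRep hn hp hw' hΩ hgp.2
    refine ⟨h, hh, ⟨hh.1.aemeasurable hΩ.measurableSet, ?_⟩, hf.congr_ae hh.2.symm⟩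
    have hMtop := hw'.apConst_lt_top
    lift apConst (p / n) w to ℝ≥0 using hMtop.ne with M hM
    obtain ⟨C, hC, hvar⟩ := exists_rieszVar_le hn hp M
    exact (hvar w hw' hM.symm.le Ω hΩ h g (hh.hasWeakGradient hΩ hg) hh.1).trans_lt
      (ENNReal.mul_lt_top hC.lt_top hgp.2)
  · rintro ⟨h, hh, hV, hhp⟩
    obtain ⟨g, hg, hgp, -⟩ := exists_hasWeakGradient_of_rieszVar_lt_top (hn1.trans_lt hp) hw hΩ
      hh.1 hV.2
    refine ⟨hhp.congr_ae hh.2, g, hg.congr_ae hh.2.symm ?_, hgp⟩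
    exact (hhp.congr_ae hh.2).locallyIntegrableOn (hn1.trans_lt hp) hw hΩ

theorem lpNormWeighted_grad_le (hn : 1 ≤ n) {p : ℝ} (hp : (n : ℝ) < p)
    {w : EuclideanSpace ℝ (Fin n) → ℝ} (hw : MemAp p w) {Ω : Set (EuclideanSpace ℝ (Fin n))}
    (hΩ : IsOpen Ω) {h : EuclideanSpace ℝ (Fin n) → ℝ}
    {g : EuclideanSpace ℝ (Fin n) → EuclideanSpace ℝ (Fin n)} (hh : ContinuousOn h Ω)
    (hg : HasWeakGradient Ω h g) :
    lpNormWeighted p Ω w g ≤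
      n * (ENNReal.ofReal (n + 1) ^ p * (2 * (n + 1)) ^ n) ^ (1 / p) * rieszVar p Ω w h := by
  have hn1 : (1 : ℝ) ≤ n := by exact_mod_cast hn
  rcases eq_top_or_lt_top (rieszVar p Ω w h) with hV | hV
  -- If the variation is infinite the bound is trivial, the constant being nonzero. No finiteness of
  -- the variation is needed, so the constant involves only `n` and `p`.
  · rw [hV, ENNReal.mul_top]
    · exact le_top
    · refine mul_ne_zero (by exact_mod_cast (by omega : n ≠ 0)) ?_
      refine (ENNReal.rpow_pos (pos_iff_ne_zero.2 (mul_ne_zero ?_ ?_)) (by finiteness)).ne'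
      · exact (ENNReal.rpow_pos (ENNReal.ofReal_pos.2 (by positivity)) ENNReal.ofReal_ne_top).ne'
      · exact pow_ne_zero _ (by simp)
  · obtain ⟨g', hg', -, hle⟩ := exists_hasWeakGradient_of_rieszVar_lt_top (hn1.trans_lt hp) hw hΩ
      hh hV
    refine le_trans (le_of_eq ?_) hle
    exact eLpNorm_congr_ae ((weightedMeasure_absolutelyContinuous w Ω).ae_le (hg.ae_eq hΩ hg'))

end RieszBV

theorem mainTheorem1 (n : ℕ) (hn : 1 ≤ n) (p : ℝ) (hp : (n : ℝ) < p) :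
    (∀ w : EuclideanSpace ℝ (Fin n) → ℝ,
      RieszBV.MemAp p w → n * RieszBV.critIndex w < p →
        RieszBV.MemAp (p / n) w ∧
        ∀ (Ω : Set (EuclideanSpace ℝ (Fin n))), IsOpen Ω →
          ∀ f : EuclideanSpace ℝ (Fin n) → ℝ,
            (RieszBV.MemW1p p Ω w f ↔
              ∃ h : EuclideanSpace ℝ (Fin n) → ℝ, RieszBV.IsContinuousRep Ω f h ∧
                RieszBV.MemRBV p Ω w h ∧ RieszBV.MemLpWeighted p Ω w h)) ∧
    (∀ M : ℝ≥0, ∃ C : ℝ≥0, ∀ w : EuclideanSpace ℝ (Fin n) → ℝ,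
      RieszBV.MemAp p w → n * RieszBV.critIndex w < p → RieszBV.apConst p w ≤ M →
        ∀ (Ω : Set (EuclideanSpace ℝ (Fin n))), IsOpen Ω →
          ∀ (f h : EuclideanSpace ℝ (Fin n) → ℝ)
            (g : EuclideanSpace ℝ (Fin n) → EuclideanSpace ℝ (Fin n)),
            RieszBV.MemW1p p Ω w f → RieszBV.IsContinuousRep Ω f h →
              RieszBV.HasWeakGradient Ω f g →
                RieszBV.lpNormWeighted p Ω w g ≤ C * RieszBV.rieszVar p Ω w h) ∧
    (∀ M : ℝ≥0, ∃ C : ℝ≥0, ∀ w : EuclideanSpace ℝ (Fin n) → ℝ,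
      RieszBV.MemAp p w → n * RieszBV.critIndex w < p → RieszBV.apConst (p / n) w ≤ M →
        ∀ (Ω : Set (EuclideanSpace ℝ (Fin n))), IsOpen Ω →
          ∀ (f h : EuclideanSpace ℝ (Fin n) → ℝ)
            (g : EuclideanSpace ℝ (Fin n) → EuclideanSpace ℝ (Fin n)),
            RieszBV.MemW1p p Ω w f → RieszBV.IsContinuousRep Ω f h →
              RieszBV.HasWeakGradient Ω f g →
                RieszBV.rieszVar p Ω w h ≤ C * RieszBV.lpNormWeighted p Ω w g) := by
  refine ⟨fun w hw hc => ?_, fun M => ?_, fun M => ?_⟩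
  · have hw' := hw.div_of_mul_critIndex_lt hn hp hc
    exact ⟨hw', fun Ω hΩ f => RieszBV.memW1p_iff hn hp hw hw' hΩ f⟩
  · have hp0 : 0 ≤ p := (Nat.cast_nonneg n).trans hp.le
    have hC : (n * (ENNReal.ofReal (n + 1) ^ p * (2 * (n + 1)) ^ n) ^ (1 / p) : ℝ≥0∞) ≠ ⊤ := by
      finiteness
    refine ⟨ENNReal.toNNReal (n * (ENNReal.ofReal (n + 1) ^ p * (2 * (n + 1)) ^ n) ^ (1 / p)),
      fun w hw _ _ Ω hΩ f h g _ hh hg => ?_⟩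
    rw [ENNReal.coe_toNNReal hC]
    exact RieszBV.lpNormWeighted_grad_le hn hp hw hΩ hh.1 (hh.hasWeakGradient hΩ hg)
  · obtain ⟨C, hC, hvar⟩ := RieszBV.exists_rieszVar_le hn hp M
    lift C to ℝ≥0 using hC
    exact ⟨C, fun w hw hc hM Ω hΩ f h g _ hh hg => hvar w (hw.div_of_mul_critIndex_lt hn hp hc) hM
      Ω hΩ h g (hh.hasWeakGradient hΩ hg) hh.1⟩
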